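/- Let $R(x,y)=(x,-y)$, let $D\subset\mathbb{R}^2$ be a bounded open set with $R(D)=D$, and let $F=(F_1,F_2):D\to\mathbb{R}^2$ be of class $\mathcal{C}^2$. Put $F^-=F$, $F^+=-R\circ F\circ R$, and consider the $R$-reversible system that is given by $z'=F^+(z)$ for $y>0$ and by $z'=F^-(z)$ for $y<0$, with switching line $\Sigma=\{y=0\}$. Let $\Gamma(t,z)=(\Gamma_1,\Gamma_2)(t,z)$ be the flow of $F$ in $D$ and $Y(t,z)=D_z\Gamma(t,z)$. Assume: $(h_1)$ there are $x_i<x_v$ with $[x_i,x_v]\times\{0\}\subset D$, $F_2(x_i,0)=F_2(x_v,0)=0$, $\frac{\partial F_2}{\partial x}(x_v,0)F_1(x_v,0)<0$, $\frac{\partial F_2}{\partial x}(x_i,0)F_1(x_i,0)>0$, and $F_2(x,0)\ne0$ for $x_i<x<x_v$; $(h_2)$ for each $x\in(x_i,x_v]$ the solution $\Gamma(t,x,0)$ reaches $\Sigma$ for the first time at some $t=\overline\sigma(x)>0$, through the lower half plane and transversally: $\Gamma_2(t,x,0)<0$ for $0<t<\overline\sigma(x)$, $\Gamma_2(\overline\sigma(x),x,0)=0$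 and $F_2(\Gamma(\overline\sigma(x),x,0))\neq0$. Let $x_\sigma\in(x_i,x_v)$ with $\overline\sigma(x_\sigma)=\sigma$ and $\overline\sigma'(x_\sigma)\ne0$. Let $\varepsilon_0>0$ and let $G^\pm(t,z)$ and $H^\pm(t,z;\varepsilon)$ be smooth functions on $\mathbb{R}\times D$ and $\mathbb{R}\times D\times(-\varepsilon_0,\varepsilon_0)$ with values in $\mathbb{R}^2$, $2\sigma$-periodic in $t$. Consider the piecewise smooth system $$z'=X_\varepsilon^{\pm}(t,z)=F^\pm(z)+\varepsilon G^\pm(t,z)+\varepsilon^2H^\pm(t,z;\varepsilon)\quad\text{for } \pm y>0,\qquad(\ast)$$ whose solutions are understood in Filippov's sense. For $\theta\in\mathbb{R}/2\sigma\mathbb{Z}$ and $x\in(x_i,x_v]$ let $$M(\theta,x)=F\big(\Gamma(\overline\sigma(x),x,0)\big)\wedge\Big(Y(\overline\sigma(x),x,0)\int_0^{\overline\sigma(x)}Y(t,x,0)^{-1}\big[G^-(t+\theta,\Gamma(t,x,0))+R\,G^+(-t+\theta,R\,\Gamma(t,x,0))\big]dt\Big),$$ where $(a_1,a_2)\wedge(b_1,b_2)=a_1b_2-a_2b_1$.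 If $\theta^*$ satisfies $M(\theta^*,x_\sigma)=0$ and $\frac{\partial M}{\partial\theta}(\theta^*,x_\sigma)\neq0$, then there are $C>0$ and $\varepsilon_1\in(0,\varepsilon_0]$ such that for every $\varepsilon\in(0,\varepsilon_1)$ there are $\theta_\varepsilon,x_\varepsilon$ with $|\theta_\varepsilon-\theta^*|\le C\varepsilon$, $|x_\varepsilon-x_\sigma|\le C\varepsilon$ and a $2\sigma$-periodic solution $w$ of $(\ast)$ in $D$ with $w(\theta_\varepsilon)=(x_\varepsilon,0)$ which is crossing (it meets $\Sigma$ only at points where the second components of $X^+_\varepsilon$ and $X^-_\varepsilon$ have the same strict sign) and isolated (for some $\delta>0$, every $2\sigma$-periodic solution $u$ of $(\ast)$ in $D$ with $|u(t)-w(t)|<\delta$ for some $t$ equals $w$). -/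

import Mathlib

open Set MeasureTheory
open scoped ContDiff

noncomputable section

namespace TwoFold

/-- The phase plane, with coordinates `z = (x, y) = (z.1, z.2)`. The switching line is `z.2 = 0`. -/
abbrev Plane : Type := ℝ × ℝ

/-- The involution `R (x, y) = (x, -y)`. -/
def R (z : Plane) : Plane := (z.1, -z.2)

/-- The wedge product `(a₁, a₂) ∧ (b₁, b₂) = ⟨(-a₂, a₁), (b₁, b₂)⟩`. -/
def wedge (a b : Plane) : ℝ := -a.2 * b.1 + a.1 * b.2

/-- The upper vector field `F⁺ = - R ∘ F ∘ R` of the `R`-reversible system whose lower vector field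
is `F⁻ = F`. -/
def upperField (F : Plane → Plane) (z : Plane) : Plane := -R (F (R z))

/-- `c` is a solution of `z' = F z` in `D` with `c 0 = z` on the closed interval between
`0` and `T`. -/
def IsSolutionCurve (F : Plane → Plane) (D : Set Plane) (z : Plane) (T : ℝ) (c : ℝ → Plane) :
    Prop :=
  c 0 = z ∧ ∀ t ∈ uIcc 0 T, c t ∈ D ∧ HasDerivWithinAt c (F (c t)) (uIcc 0 T) t

/-- The solution of `z' = F z`, `z(0) = z`, in `D` exists from time `0` up to time `T`. -/
def SolutionExists (F : Plane → Plane) (D : Set Plane) (z : Plane) (T : ℝ) : Prop :=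
  ∃ c : ℝ → Plane, IsSolutionCurve F D z T c

open Classical in
/-- The flow `Γ(t, z)` of `z' = F z` in `D` (for a `C¹` field on an open set the solution curve
is unique); the value is `z` where the solution does not exist up to time `t`. -/
def flow (F : Plane → Plane) (D : Set Plane) (t : ℝ) (z : Plane) : Plane :=
  if h : SolutionExists F D z t then h.choose t else z

/-- The derivative `Y(t, z) = D_z Γ(t, z)` of the flow with respect to the initial condition. -/
def Y (F : Plane → Plane) (D : Set Plane) (t : ℝ) (z : Plane) : Plane →L[ℝ] Plane :=
  fderiv ℝ (fun w => flow F D t w) z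

/-- The half-return time `σ̄(x)`: the first positive time at which the solution of `z' = F z`
starting at `(x, 0)` is on the switching line. -/
def halfReturnTime (F : Plane → Plane) (D : Set Plane) (x : ℝ) : ℝ :=
  sInf {t : ℝ | 0 < t ∧ SolutionExists F D (x, 0) t ∧ (flow F D t (x, 0)).2 = 0}

/-- The fold condition: `(x_v, 0)` is a visible and `(x_i, 0)` an invisible fold, and there is no
tangency on the open segment between them. -/
structure FoldCondition (F : Plane → Plane) (D : Set Plane) (xi xv : ℝ) : Prop where
  lt : xi < xv
  mem : ∀ x ∈ Icc xi xv, ((x, 0) : Plane) ∈ D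
  tangent_v : (F (xv, 0)).2 = 0
  tangent_i : (F (xi, 0)).2 = 0
  visible : deriv (fun x : ℝ => (F (x, 0)).2) xv * (F (xv, 0)).1 < 0
  invisible : 0 < deriv (fun x : ℝ => (F (x, 0)).2) xi * (F (xi, 0)).1
  ne_zero : ∀ x ∈ Ioo xi xv, (F (x, 0)).2 ≠ 0

/-- The return condition: for each `x_i < x ≤ x_v` the solution of `z' = F z` starting at `(x, 0)`
runs through the lower half plane and reaches the switching line, transversely, at the
time `σ̄(x) > 0`. -/
structure ReturnCondition (F : Plane → Plane) (D : Set Plane) (xi xv : ℝ) : Prop where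
  pos : ∀ x ∈ Ioc xi xv, 0 < halfReturnTime F D x
  exists_solution : ∀ x ∈ Ioc xi xv, SolutionExists F D (x, 0) (halfReturnTime F D x)
  below : ∀ x ∈ Ioc xi xv, ∀ t ∈ Ioo 0 (halfReturnTime F D x), (flow F D t (x, 0)).2 < 0
  hits : ∀ x ∈ Ioc xi xv, (flow F D (halfReturnTime F D x) (x, 0)).2 = 0
  transverse : ∀ x ∈ Ioc xi xv, (F (flow F D (halfReturnTime F D x) (x, 0))).2 ≠ 0

/-- The periodic orbit `γ(·, x)` of the unperturbed system through `(x, 0)`, parametrised by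
`t ∈ [-σ̄(x), σ̄(x)]`. -/
def orbit (F : Plane → Plane) (D : Set Plane) (t x : ℝ) : Plane :=
  if 0 ≤ t then flow F D t (x, 0) else R (flow F D (-t) (x, 0))

/-- The defect of reversibility `G⁻(t + θ, z) + R G⁺(-t + θ, R z)`. -/
def reversibilityDefect (Gp Gm : ℝ → Plane → Plane) (θ t : ℝ) (z : Plane) : Plane :=
  Gm (t + θ) z + R (Gp (-t + θ) (R z))

/-- The Melnikov function `M(θ, x)`. -/
def melnikov (F : Plane → Plane) (D : Set Plane) (Gp Gm : ℝ → Plane → Plane) (θ x : ℝ) : ℝ :=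
  wedge (F (orbit F D (halfReturnTime F D x) x))
    (Y F D (halfReturnTime F D x) (x, 0)
      (∫ t in (0 : ℝ)..halfReturnTime F D x,
        (Y F D t (x, 0)).inverse (reversibilityDefect Gp Gm θ t (orbit F D t x))))

/-- The perturbed field `F(z) + ε G(t, z) + ε² H(t, z; ε)`. -/
def perturbedField (F : Plane → Plane) (G : ℝ → Plane → Plane) (H : ℝ → Plane → ℝ → Plane)
    (ε t : ℝ) (z : Plane) : Plane :=
  F z + ε • G t z + ε ^ 2 • H t z ε

/-- The set-valued right-hand side, in Filippov's sense, of the piecewise smooth system given by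
`Xp` for `y > 0` and by `Xm` for `y < 0`: on `y = 0` it is the segment between the two values. -/
def filippovSet (Xp Xm : ℝ → Plane → Plane) (t : ℝ) (z : Plane) : Set Plane :=
  {v | (0 < z.2 ∧ v = Xp t z) ∨ (z.2 < 0 ∧ v = Xm t z) ∨
    (z.2 = 0 ∧ v ∈ segment ℝ (Xp t z) (Xm t z))}

/-- `w` is a `T`-periodic solution in `D`, in Filippov's sense, of the piecewise smooth
system `(Xp, Xm)`: it is the integral of a locally integrable function (that is, `w` is locally
absolutely continuous) and its velocity is almost everywhere in the Filippov set. -/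
structure IsPeriodicSolution (Xp Xm : ℝ → Plane → Plane) (D : Set Plane) (T : ℝ)
    (w : ℝ → Plane) : Prop where
  mem : ∀ t, w t ∈ D
  periodic : ∀ t, w (t + T) = w t
  inclusion : ∃ v : ℝ → Plane, (∀ a b : ℝ, IntervalIntegrable v volume a b) ∧
    (∀ a b : ℝ, w b - w a = ∫ t in a..b, v t) ∧
    ∀ᵐ t : ℝ, v t ∈ filippovSet Xp Xm t (w t)

/-- The solution `w` meets the switching line only in the crossing region, that is, where the
normal components of both fields have the same strict sign. -/
def IsCrossing (Xp Xm : ℝ → Plane → Plane) (w : ℝ → Plane) : Prop :=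
  ∀ t, (w t).2 = 0 → 0 < (Xp t (w t)).2 * (Xm t (w t)).2

/-- The `T`-periodic solution `w` is isolated: some neighbourhood of its graph is not met by the
graph of any other `T`-periodic solution (crossing or not). -/
def IsIsolated (Xp Xm : ℝ → Plane → Plane) (D : Set Plane) (T : ℝ) (w : ℝ → Plane) : Prop :=
  ∃ δ > 0, ∀ u : ℝ → Plane, IsPeriodicSolution Xp Xm D T u →
    (∃ t, dist (u t) (w t) < δ) → u = w

end TwoFold

end

open TwoFold

noncomputable section

namespace TwoFold

open Filter Topology
open scoped NNReal

section

open scoped unitInterval Manifold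

section Superposition

universe u

variable {X : Type*} [TopologicalSpace X] [CompactSpace X]

/-- Pointwise application of a continuous family of operators to a continuous function. -/
def pointwiseApply (X : Type*) [TopologicalSpace X] [CompactSpace X] (E G : Type*)
    [NormedAddCommGroup E] [NormedSpace ℝ E] [NormedAddCommGroup G] [NormedSpace ℝ G] :
    C(X, E →L[ℝ] G) →L[ℝ] C(X, E) →L[ℝ] C(X, G) :=
  LinearMap.mkContinuous₂
    (LinearMap.mk₂ ℝ (fun (A : C(X, E →L[ℝ] G)) (h : C(X, E)) =>
        (⟨fun x => A x (h x), by fun_prop⟩ : C(X, G)))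
      (fun _ _ _ => by ext; simp) (fun _ _ _ => by ext; simp)
      (fun _ _ _ => by ext; simp) (fun _ _ _ => by ext; simp)) 1
    (fun A h => by
      rw [ContinuousMap.norm_le _ (by positivity)]
      intro x
      simp only [LinearMap.mk₂_apply, ContinuousMap.coe_mk, one_mul]
      exact (A x).le_of_opNorm_le_of_le (A.norm_coe_le_norm x) (h.norm_coe_le_norm x))

variable {E G : Type u} [NormedAddCommGroup E] [NormedSpace ℝ E]
  [NormedAddCommGroup G] [NormedSpace ℝ G]

@[simp] lemma pointwiseApply_apply (A : C(X, E →L[ℝ] G)) (h : C(X, E)) (x : X) :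
    pointwiseApply X E G A h x = A x (h x) := rfl

lemma hasFDerivAt_superposition {f : E → G} (hf : ContDiff ℝ 1 f) (u : C(X, E)) :
    HasFDerivAt (fun v : C(X, E) => (⟨f, hf.continuous⟩ : C(E, G)).comp v)
      (pointwiseApply X E G
        ((⟨fderiv ℝ f, hf.continuous_fderiv one_ne_zero⟩ : C(E, E →L[ℝ] G)).comp u)) u := by
  rw [hasFDerivAt_iff_isLittleO, Asymptotics.isLittleO_iff]
  intro c hc
  have hK : IsCompact (range u) := isCompact_range u.continuous
  have huc := hK.uniformContinuousAt_of_continuousAt (fderiv ℝ f)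
    (fun a _ => (hf.continuous_fderiv one_ne_zero).continuousAt) (Metric.dist_mem_uniformity hc)
  obtain ⟨δ, hδ, hδ'⟩ := Metric.mem_uniformity_dist.1 huc
  filter_upwards [Metric.ball_mem_nhds u hδ] with v hv
  rw [ContinuousMap.norm_le _ (by positivity)]
  intro x
  simp only [ContinuousMap.sub_apply, ContinuousMap.comp_apply, ContinuousMap.coe_mk,
    pointwiseApply_apply]
  have hvx : v x ∈ Metric.ball (u x) δ := by
    rw [Metric.mem_ball] at hv ⊢
    exact (ContinuousMap.dist_apply_le_dist x).trans_lt hv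
  have := (convex_ball (u x) δ).norm_image_sub_le_of_norm_fderiv_le'
    (𝕜 := ℝ) (f := f) (φ := fderiv ℝ f (u x)) (C := c)
    (fun y _ => hf.differentiable one_ne_zero y)
    (fun y hy => by
      have h := @hδ' (u x) y (by rw [dist_comm]; exact hy) ⟨x, rfl⟩
      simp only [mem_ofPred_eq] at h
      rw [dist_comm, dist_eq_norm] at h
      exact h.le) (Metric.mem_ball_self hδ) hvx
  refine this.trans ?_
  gcongr
  exact (v - u).norm_coe_le_norm x

lemma contDiff_superposition (n : ℕ) : ∀ {G : Type u} [NormedAddCommGroup G] [NormedSpace ℝ G]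
    {f : E → G} (hf : ContDiff ℝ n f),
    ContDiff ℝ n (fun v : C(X, E) => (⟨f, hf.continuous⟩ : C(E, G)).comp v) := by
  induction n with
  | zero =>
    intro G _ _ f hf
    exact contDiff_zero.2 (ContinuousMap.continuous_postcomp _)
  | succ n ih =>
    intro G _ _ f hf
    have h1 : ContDiff ℝ 1 f := hf.of_le (by exact_mod_cast Nat.le_add_left 1 n)
    have hd : ContDiff ℝ n (fderiv ℝ f) := (contDiff_succ_iff_fderiv.1 hf).2.2
    have hfd : ∀ u : C(X, E), fderiv ℝ (fun v : C(X, E) =>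
        (⟨f, hf.continuous⟩ : C(E, G)).comp v) u = pointwiseApply X E G
        ((⟨fderiv ℝ f, hd.continuous⟩ : C(E, E →L[ℝ] G)).comp u) :=
      fun u => (hasFDerivAt_superposition h1 u).fderiv
    refine (contDiff_succ_iff_fderiv (n := (n : WithTop ℕ∞))).2 ?_
    refine ⟨fun u => (hasFDerivAt_superposition h1 u).differentiableAt, by simp, ?_⟩
    simp_rw [funext hfd]
    exact (pointwiseApply X E G).contDiff.comp (ih hd)

end Superposition

section Volterra

universe u
variable {E : Type u} [NormedAddCommGroup E] [NormedSpace ℝ E]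

/-- Integration from `0`, as an operator on continuous functions on the unit interval. -/
def volterra (E : Type*) [NormedAddCommGroup E] [NormedSpace ℝ E] : C(I, E) →L[ℝ] C(I, E) :=
  LinearMap.mkContinuous
    { toFun := fun w => ⟨fun s : I => ∫ r in (0 : ℝ)..s, IccExtend zero_le_one w r,
        (intervalIntegral.continuous_primitive (fun a b =>
          (w.continuous.Icc_extend' (h := zero_le_one)).intervalIntegrable a b) 0).comp
          continuous_subtype_val⟩
      map_add' := fun w w' => by
        ext s
        simp only [ContinuousMap.coe_mk, ContinuousMap.add_apply]
        rw [← intervalIntegral.integral_add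
          ((w.continuous.Icc_extend' (h := zero_le_one)).intervalIntegrable _ _)
          ((w'.continuous.Icc_extend' (h := zero_le_one)).intervalIntegrable _ _)]
        rfl
      map_smul' := fun c w => by
        ext s
        simp only [ContinuousMap.coe_mk, ContinuousMap.smul_apply, RingHom.id_apply]
        rw [← intervalIntegral.integral_smul]
        rfl } 1
    (fun w => by
      rw [ContinuousMap.norm_le _ (by positivity)]
      intro s
      simp only [LinearMap.coe_mk, AddHom.coe_mk, ContinuousMap.coe_mk]
      have := intervalIntegral.norm_integral_le_of_norm_le_const (a := 0) (b := (s : ℝ))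
        (f := IccExtend zero_le_one w) (C := ‖w‖) (fun x _ => w.norm_coe_le_norm _)
      refine this.trans ?_
      rw [sub_zero, abs_of_nonneg s.2.1, one_mul]
      exact mul_le_of_le_one_right (norm_nonneg _) s.2.2)

lemma volterra_apply (w : C(I, E)) (s : I) :
    volterra E w s = ∫ r in (0 : ℝ)..s, IccExtend zero_le_one w r := rfl

lemma norm_volterra_le : ‖volterra E‖ ≤ 1 := LinearMap.mkContinuous_norm_le _ zero_le_one _

end Volterra

section Flow

universe u
variable {E : Type u} [NormedAddCommGroup E] [NormedSpace ℝ E]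

/-- The flow equation `∂ₜ φ = f ∘ φ`, `φ 0 = id`. -/
structure IsGlobalFlow (f : E → E) (φ : ℝ → E → E) : Prop where
  zero : ∀ z, φ 0 z = z
  deriv : ∀ z t, HasDerivAt (fun t => φ t z) (f (φ t z)) t

lemma IsGlobalFlow.unique {f : E → E} {φ : ℝ → E → E} (h : IsGlobalFlow f φ) {K : ℝ≥0}
    (hK : LipschitzWith K f) {c : ℝ → E} (hc : ∀ t, HasDerivAt c (f (c t)) t) (t : ℝ) :
    c t = φ t (c 0) :=
  congrFun (ODE_solution_unique_univ (v := fun _ => f) (s := fun _ => univ) (K := K) (t₀ := 0)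
    (fun _ => hK.lipschitzOnWith) (fun t => ⟨hc t, mem_univ _⟩)
    (fun t => ⟨h.deriv (c 0) t, mem_univ _⟩) (h.zero _).symm) t

lemma IsGlobalFlow.add {f : E → E} {φ : ℝ → E → E} (h : IsGlobalFlow f φ) {K : ℝ≥0}
    (hK : LipschitzWith K f) (s t : ℝ) (z : E) : φ (t + s) z = φ t (φ s z) := by
  have := h.unique hK (c := fun t => φ (t + s) z) (fun t => by
    simpa using (h.deriv z (t + s)).comp_add_const t s) t
  simpa using this

/-- Mixed partial derivatives: if `∂ₛ ζ = Θ` then `∂ₛ (D_e ζ · v) = D_e Θ · v`. -/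
theorem hasDerivAt_fderiv_of_contDiff {G : Type*} [NormedAddCommGroup G] [NormedSpace ℝ G]
    {ζ Θ : ℝ → E → G} (hζ : ContDiff ℝ 2 (fun p : ℝ × E => ζ p.1 p.2)) {s : ℝ} {e : E}
    (hΘ : ∀ᶠ p : ℝ × E in 𝓝 (s, e), HasDerivAt (fun s => ζ s p.2) (Θ p.1 p.2) p.1) (v : E) :
    HasDerivAt (fun s => fderiv ℝ (ζ s) e v) (fderiv ℝ (Θ s) e v) s := by
  set Φ := fun p : ℝ × E => ζ p.1 p.2 with hΦ
  have hΦd : Differentiable ℝ Φ := hζ.differentiable two_ne_zero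
  have hz : ∀ t z, fderiv ℝ (ζ t) z = fderiv ℝ Φ (t, z) ∘L ContinuousLinearMap.inr ℝ ℝ E := by
    intro t z
    exact ((hΦd (t, z)).hasFDerivAt.comp z (hasFDerivAt_prodMk_right t z)).fderiv
  have ht : ∀ᶠ p : ℝ × E in 𝓝 (s, e), fderiv ℝ Φ p (1, 0) = Θ p.1 p.2 := by
    filter_upwards [hΘ] with p hp
    have h1 := (hΦd p).hasFDerivAt.comp_hasDerivAt p.1
      (HasDerivAt.prodMk (hasDerivAt_id p.1) (hasDerivAt_const p.1 p.2))
    exact h1.unique hp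
  have hD : Differentiable ℝ (fderiv ℝ Φ) :=
    (hζ.fderiv_right (m := 1) (by norm_num)).differentiable one_ne_zero
  have hsymm := (hζ.contDiffAt (x := (s, e))).isSymmSndFDerivAt (by simp)
  have h1 : HasDerivAt (fun t => fderiv ℝ (ζ t) e v)
      (fderiv ℝ (fderiv ℝ Φ) (s, e) (1, 0) (0, v)) s := by
    have ha : HasDerivAt (fun t : ℝ => fderiv ℝ Φ (t, e)) (fderiv ℝ (fderiv ℝ Φ) (s, e) (1, 0)) s :=
      (hD (s, e)).hasFDerivAt.comp_hasDerivAt (f := fun t : ℝ => (t, e)) s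
        (HasDerivAt.prodMk (hasDerivAt_id s) (hasDerivAt_const s e))
    have hb : HasDerivAt (fun t : ℝ => fderiv ℝ Φ (t, e) (0, v))
        (fderiv ℝ (fderiv ℝ Φ) (s, e) (1, 0) (0, v)) s := by
      simpa using ha.clm_apply (hasDerivAt_const s ((0 : ℝ), v))
    simp_rw [hz]
    exact hb
  convert h1 using 1
  rw [hsymm.eq (1, 0) (0, v)]
  have h2 : HasFDerivAt (fun p => fderiv ℝ Φ p (1, 0))
      ((ContinuousLinearMap.apply ℝ G ((1 : ℝ), (0 : E))) ∘L fderiv ℝ (fderiv ℝ Φ) (s, e)) (s, e) :=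
    (ContinuousLinearMap.apply ℝ G ((1 : ℝ), (0 : E))).hasFDerivAt.comp (s, e)
      (hD (s, e)).hasFDerivAt
  have h3 : HasFDerivAt (fun p : ℝ × E => Θ p.1 p.2) _ (s, e) :=
    h2.congr_of_eventuallyEq (ht.mono fun p hp => hp.symm)
  have h4 : HasFDerivAt (Θ s) _ e := h3.comp e (hasFDerivAt_prodMk_right s e)
  rw [h4.fderiv]
  rfl

variable [CompleteSpace E]

/-- A bounded Lipschitz vector field has a global integral curve through each point. -/
lemma exists_global_integralCurve {f : E → E} {K L : ℝ≥0} (hK : LipschitzWith K f)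
    (hL : ∀ z, ‖f z‖ ≤ L) (z : E) :
    ∃ c : ℝ → E, c 0 = z ∧ ∀ t, HasDerivAt c (f (c t)) t := by
  have key : ∀ N : ℕ, ∃ c : ℝ → E, c 0 = z ∧
      ∀ t ∈ Ioo (-(N + 1 : ℝ)) (N + 1), HasDerivAt c (f (c t)) t := by
    intro N
    have h0 : (0 : ℝ) ∈ Icc (-(N + 1 : ℝ)) (N + 1) := by constructor <;> [linarith; positivity]
    have hpl : IsPicardLindelof (fun _ => f) (⟨0, h0⟩ : Icc (-(N + 1 : ℝ)) (N + 1)) z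
        (L * (N + 1)) 0 L K := by
      refine ⟨fun t _ => hK.lipschitzOnWith, fun x _ => continuousOn_const, fun t _ x _ => hL x, ?_⟩
      simp
    obtain ⟨c, hc0, hc⟩ := hpl.exists_eq_forall_mem_Icc_hasDerivWithinAt₀
    exact ⟨c, hc0, fun t ht => (hc t (Ioo_subset_Icc_self ht)).hasDerivAt
      (Icc_mem_nhds ht.1 ht.2)⟩
  choose c hc0 hc using key
  have agree : ∀ N M : ℕ, N ≤ M → EqOn (c N) (c M) (Ioo (-(N + 1 : ℝ)) (N + 1)) := by
    intro N M hNM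
    have hcast : (N : ℝ) ≤ M := by exact_mod_cast hNM
    refine ODE_solution_unique_of_mem_Ioo (v := fun _ => f) (s := fun _ => univ) (K := K) (t₀ := 0)
      (fun t _ => hK.lipschitzOnWith) ⟨by linarith [N.cast_nonneg (α := ℝ)], by positivity⟩
      (fun t ht => ⟨hc N t ht, mem_univ _⟩)
      (fun t ht => ⟨hc M t ⟨by linarith [ht.1], by linarith [ht.2]⟩, mem_univ _⟩)
      (by rw [hc0, hc0])
  refine ⟨fun t => c ⌈|t|⌉₊ t, by simp [hc0], fun t => ?_⟩
  have hmem : ∀ s : ℝ, ∀ N : ℕ, |s| < N + 1 → s ∈ Ioo (-(N + 1 : ℝ)) (N + 1) := fun s N h =>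
    abs_lt.1 h
  have hev : (fun t => c ⌈|t|⌉₊ t) =ᶠ[𝓝 t] c (⌈|t|⌉₊ + 1) := by
    have : ∀ᶠ s : ℝ in 𝓝 t, |s| < (⌈|t|⌉₊ : ℝ) + 1 := by
      refine (continuous_abs.tendsto t).eventually (gt_mem_nhds ?_)
      linarith [Nat.le_ceil |t|]
    filter_upwards [this] with s hs
    refine agree _ _ ?_ (hmem s _ (by linarith [Nat.le_ceil |s|]))
    exact Nat.ceil_le.2 (by push_cast; exact hs.le)
  have h1 := hc (⌈|t|⌉₊ + 1) t (hmem t _ (by push_cast; linarith [Nat.le_ceil |t|]))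
  have h2 := h1.congr_of_eventuallyEq hev
  rwa [← hev.eq_of_nhds] at h2

lemma exists_isGlobalFlow {f : E → E} {K L : ℝ≥0} (hK : LipschitzWith K f)
    (hL : ∀ z, ‖f z‖ ≤ L) : ∃ φ : ℝ → E → E, IsGlobalFlow f φ := by
  choose c h0 h using exists_global_integralCurve hK hL
  exact ⟨fun t z => c z t, h0, h⟩

lemma IsGlobalFlow.contDiffAt_of_small {f : E → E} {φ : ℝ → E → E} (h : IsGlobalFlow f φ) {K : ℝ≥0}
    (hK : LipschitzWith K f) {n : ℕ} (hn : n ≠ 0) (hf : ContDiff ℝ n f) {T : ℝ} (z : E)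
    (hT : |T| * K < 1) : ContDiffAt ℝ n (fun p : ℝ × E => φ p.1 p.2) (T, z) := by
  have hn1 : (1 : WithTop ℕ∞) ≤ n := by exact_mod_cast Nat.one_le_iff_ne_zero.2 hn
  have hn0 : (n : WithTop ℕ∞) ≠ 0 := by exact_mod_cast hn
  let S : C(I, E) → C(I, E) := fun v => (⟨f, hf.continuous⟩ : C(E, E)).comp v
  have hS : ContDiff ℝ n S := contDiff_superposition n hf
  let c : E →L[ℝ] C(I, E) := ContinuousLinearMap.const ℝ I
  let Ψ : (ℝ × E) × C(I, E) → C(I, E) := fun q => q.2 - c q.1.2 - q.1.1 • volterra E (S q.2)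
  have hΨ : ContDiff ℝ n Ψ := by
    refine (contDiff_snd.sub (c.contDiff.comp (contDiff_snd.comp contDiff_fst))).sub ?_
    exact (contDiff_fst.comp contDiff_fst).smul ((volterra E).contDiff.comp (hS.comp contDiff_snd))
  have hcont : Continuous fun t => φ t z :=
    continuous_iff_continuousAt.2 fun t => (h.deriv z t).continuousAt
  let u₀ : C(I, E) := ⟨fun s => φ (T * s) z, by fun_prop⟩
  have hΨ0 : Ψ ((T, z), u₀) = 0 := by
    ext s
    have hd : ∀ r : ℝ, HasDerivAt (fun r => φ (T * r) z) (T • f (φ (T * r) z)) r := by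
      intro r
      have := (h.deriv z (T * r)).scomp r ((hasDerivAt_id r).const_mul T)
      simpa [Function.comp_def] using this
    have hi := intervalIntegral.integral_eq_sub_of_hasDerivAt (a := 0) (b := (s : ℝ))
      (fun r _ => hd r) ((continuous_const.smul (hf.continuous.comp
        (hcont.comp (continuous_const.mul continuous_id)))).intervalIntegrable _ _)
    rw [intervalIntegral.integral_smul] at hi
    have hv : volterra E (S u₀) s = ∫ r in (0 : ℝ)..s, f (φ (T * r) z) := by
      rw [volterra_apply]
      refine intervalIntegral.integral_congr fun r hr => ?_
      rw [uIcc_of_le s.2.1] at hr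
      have hr' : r ∈ Icc (0 : ℝ) 1 := ⟨hr.1, hr.2.trans s.2.2⟩
      change IccExtend zero_le_one _ r = _
      rw [IccExtend_of_mem _ _ hr']
      rfl
    simp only [Ψ, ContinuousMap.sub_apply, ContinuousMap.smul_apply, hv, hi]
    simp [u₀, c, h.zero]
  let A : C(I, E) →L[ℝ] C(I, E) := pointwiseApply I E E
    ((⟨fderiv ℝ f, hf.continuous_fderiv hn0⟩ : C(E, E →L[ℝ] E)).comp u₀)
  have hA : ‖A‖ ≤ K := by
    refine A.opNorm_le_bound K.2 fun v => ?_
    refine (ContinuousMap.norm_le _ (by positivity)).2 fun x => ?_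
    change ‖fderiv ℝ f (u₀ x) (v x)‖ ≤ _
    exact ContinuousLinearMap.le_of_opNorm_le_of_le _ (norm_fderiv_le_of_lipschitz ℝ hK)
      (v.norm_coe_le_norm x)
  have hfd : fderiv ℝ Ψ ((T, z), u₀) ∘L ContinuousLinearMap.inr ℝ (ℝ × E) C(I, E)
      = 1 - T • (volterra E ∘L A) := by
    have h1 : HasFDerivAt (fun v => Ψ ((T, z), v)) (1 - T • (volterra E ∘L A)) u₀ := by
      have hs : HasFDerivAt S A u₀ := hasFDerivAt_superposition (hf.of_le hn1) u₀
      exact ((hasFDerivAt_id (𝕜 := ℝ) u₀).sub_const (c z)).sub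
        (((volterra E).hasFDerivAt.comp u₀ hs).const_smul T)
    have h2 : HasFDerivAt (fun v => Ψ ((T, z), v))
        (fderiv ℝ Ψ ((T, z), u₀) ∘L ContinuousLinearMap.inr ℝ (ℝ × E) C(I, E)) u₀ :=
      HasFDerivAt.comp (f := fun v => ((T, z), v)) u₀
        ((hΨ.differentiable hn0) ((T, z), u₀)).hasFDerivAt (hasFDerivAt_prodMk_right (T, z) u₀)
    exact h2.unique h1
  have hinv : (fderiv ℝ Ψ ((T, z), u₀) ∘L
      ContinuousLinearMap.inr ℝ (ℝ × E) C(I, E)).IsInvertible := by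
    rw [hfd]
    have hlt : ‖T • (volterra E ∘L A)‖ < 1 := by
      refine lt_of_le_of_lt ((ContinuousLinearMap.opNorm_smul_le T _).trans
        (mul_le_mul_of_nonneg_left ?_ (norm_nonneg T))) hT
      calc ‖volterra E ∘L A‖ ≤ ‖volterra E‖ * ‖A‖ := ContinuousLinearMap.opNorm_comp_le _ _
        _ ≤ 1 * K := by gcongr; exact norm_volterra_le
        _ = K := one_mul _
    exact ⟨ContinuousLinearEquiv.unitsEquiv ℝ C(I, E)
      (Units.oneSub (T • (volterra E ∘L A)) hlt), rfl⟩
  have hcd : ContDiffAt ℝ n Ψ ((T, z), u₀) := hΨ.contDiffAt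
  have hψ := hcd.contDiffAt_implicitFunction hn0 hinv
  have hev := hcd.eventually_apply_implicitFunction hn0 hinv
  set ψ := hcd.implicitFunction hn0 hinv
  let e : C(I, E) →L[ℝ] E := ContinuousMap.evalCLM ℝ (1 : I)
  refine (e.contDiff.contDiffAt.comp (T, z) hψ).congr_of_eventuallyEq ?_
  filter_upwards [hev] with p hp
  rw [hΨ0] at hp
  set w := ψ p
  let W : ℝ → E := fun s => p.2 + p.1 • ∫ r in (0 : ℝ)..s, f (IccExtend zero_le_one w r)
  have hWw : ∀ s : I, W s = w s := by
    intro s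
    have := congrArg (fun g : C(I, E) => g s) hp
    simp only [Ψ, ContinuousMap.sub_apply, ContinuousMap.smul_apply, volterra_apply,
      ContinuousMap.zero_apply] at this
    rw [sub_sub, sub_eq_zero] at this
    rw [this]
    rfl
  have hWd : ∀ s, HasDerivAt W (p.1 • f (IccExtend zero_le_one w s)) s := by
    intro s
    have hc : Continuous fun r => f (IccExtend zero_le_one w r) :=
      hf.continuous.comp w.continuous.Icc_extend'
    exact ((intervalIntegral.integral_hasDerivAt_right (hc.intervalIntegrable _ _)
      hc.aestronglyMeasurable.stronglyMeasurableAtFilter hc.continuousAt).const_smul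
        p.1).const_add _
  have huniq : EqOn W (fun s => φ (p.1 * s) p.2) (Icc 0 1) := by
    refine ODE_solution_unique (v := fun _ y => p.1 • f y) (K := ‖p.1‖₊ * K)
      (fun _ => (lipschitzWith_smul p.1).comp hK)
      (fun s _ => (hWd s).continuousAt.continuousWithinAt) (fun s hs => ?_)
      (fun s _ => ?_) (fun s _ => ?_) ?_
    · have := hWd s
      rw [IccExtend_of_mem _ _ (Ico_subset_Icc_self hs), ← hWw ⟨s, Ico_subset_Icc_self hs⟩] at this
      exact this.hasDerivWithinAt
    · have := (h.deriv p.2 (p.1 * s)).scomp s ((hasDerivAt_id s).const_mul p.1)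
      exact this.continuousAt.continuousWithinAt
    · have := (h.deriv p.2 (p.1 * s)).scomp s ((hasDerivAt_id s).const_mul p.1)
      simpa [Function.comp_def] using this.hasDerivWithinAt
    · simp [W, h.zero]
  have := huniq (right_mem_Icc.2 zero_le_one)
  simp only [mul_one] at this
  rw [← this]
  exact hWw 1

/-- The flow of a Lipschitz `Cⁿ` vector field is of class `Cⁿ`. -/
theorem IsGlobalFlow.contDiff {f : E → E} {φ : ℝ → E → E} (h : IsGlobalFlow f φ) {K : ℝ≥0}
    (hK : LipschitzWith K f) {n : ℕ} (hn : n ≠ 0) (hf : ContDiff ℝ n f) :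
    ContDiff ℝ n (fun p : ℝ × E => φ p.1 p.2) := by
  have key : ∀ k : ℕ, ∀ p : ℝ × E, |p.1| * K < 2 ^ k →
      ContDiffAt ℝ n (fun p : ℝ × E => φ p.1 p.2) p := by
    intro k
    induction k with
    | zero => exact fun p hp => h.contDiffAt_of_small hK hn hf p.2 (by simpa using hp)
    | succ k ih =>
      intro p hp
      have heq : (fun p : ℝ × E => φ p.1 p.2) =
          (fun p : ℝ × E => φ p.1 p.2) ∘ fun p => (p.1 / 2, φ (p.1 / 2) p.2) := by
        funext q
        simp only [Function.comp]
        rw [← h.add hK, add_halves]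
      have hhalf : |p.1 / 2| * K < 2 ^ k := by
        rw [abs_div, abs_two]
        rw [pow_succ] at hp
        linarith
      rw [heq]
      have hd : ContDiffAt ℝ n (fun p : ℝ × E => p.1 / 2) p := contDiffAt_fst.div_const 2
      refine ContDiffAt.comp p (ih _ hhalf) (hd.prodMk ?_)
      exact ContDiffAt.comp (f := fun p : ℝ × E => (p.1 / 2, p.2)) p (ih (p.1 / 2, p.2) hhalf)
        (hd.prodMk contDiffAt_snd)
  rw [contDiff_iff_contDiffAt]
  intro p
  obtain ⟨k, hk⟩ := pow_unbounded_of_one_lt (|p.1| * (K : ℝ)) one_lt_two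
  exact key k p hk

end Flow

section Cutoff

variable {E G : Type*} [NormedAddCommGroup E] [NormedSpace ℝ E] [FiniteDimensional ℝ E]
  [NormedAddCommGroup G] [NormedSpace ℝ G]

/-- A `Cⁿ` function on an open set agrees, near a compact subset, with a `Cⁿ` function of compact
support on the whole space. -/
lemma exists_contDiff_hasCompactSupport_eqOn {n : ℕ} {f : E → G} {U K : Set E} (hU : IsOpen U)
    (hf : ContDiffOn ℝ n f U) (hK : IsCompact K) (hKU : K ⊆ U) :
    ∃ g : E → G, ContDiff ℝ n g ∧ HasCompactSupport g ∧
      ∃ N, IsOpen N ∧ K ⊆ N ∧ N ⊆ U ∧ EqOn g f N := by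
  obtain ⟨L, hL, hKL, hLU⟩ := exists_compact_between hK hU hKU
  obtain ⟨χ, hχ1, hχ0, -⟩ := exists_contMDiffMap_one_nhds_of_subset_interior (n := n) 𝓘(ℝ, E)
    hK.isClosed hKL
  have hχ : ContDiff ℝ n χ := χ.contMDiff.contDiff
  have hsupp : ∀ x ∉ L, χ x • f x = 0 := fun x hx => by rw [hχ0 x hx, zero_smul]
  refine ⟨fun x => χ x • f x, ?_, HasCompactSupport.intro hL hsupp, ?_⟩
  · rw [contDiff_iff_contDiffAt]
    intro x
    by_cases hx : x ∈ L
    · exact hχ.contDiffAt.smul (hf.contDiffAt (hU.mem_nhds (hLU hx)))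
    · refine (contDiffAt_const (c := (0 : G))).congr_of_eventuallyEq ?_
      filter_upwards [hL.isClosed.isOpen_compl.mem_nhds hx] with y hy using hsupp y hy
  · obtain ⟨N, hN, hKN, hN1⟩ := mem_nhdsSet_iff_exists.1 hχ1
    refine ⟨N ∩ interior L, hN.inter isOpen_interior, subset_inter hKN hKL,
      fun x hx => hLU (interior_subset hx.2), fun x hx => ?_⟩
    have : χ x = 1 := hN1 hx.1
    simp [this]

end Cutoff

section Uniqueness

variable {E : Type*} [NormedAddCommGroup E] [NormedSpace ℝ E]

/-- Two solutions of `u' = X(t, u)` in an open set with the same initial value agree. -/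
lemma eqOn_Icc_of_solution {X : ℝ → E → E} {D : Set E} (hD : IsOpen D)
    (hX : ContDiffOn ℝ 1 (fun p : ℝ × E => X p.1 p.2) (univ ×ˢ D)) {a b : ℝ} {u w : ℝ → E}
    (hu : ∀ t ∈ Icc a b, u t ∈ D ∧ HasDerivWithinAt u (X t (u t)) (Icc a b) t)
    (hw : ∀ t ∈ Icc a b, w t ∈ D ∧ HasDerivWithinAt w (X t (w t)) (Icc a b) t)
    (h : u a = w a) : EqOn u w (Icc a b) := by
  have huc : ContinuousOn u (Icc a b) := fun t ht => (hu t ht).2.continuousWithinAt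
  have hwc : ContinuousOn w (Icc a b) := fun t ht => (hw t ht).2.continuousWithinAt
  set K : Set (ℝ × E) := (fun t => (t, u t)) '' Icc a b ∪ (fun t => (t, w t)) '' Icc a b
  have hK : IsCompact K := (isCompact_Icc.image_of_continuousOn (continuousOn_id.prodMk huc)).union
    (isCompact_Icc.image_of_continuousOn (continuousOn_id.prodMk hwc))
  have hKU : K ⊆ univ ×ˢ D := by
    rintro p (⟨t, ht, rfl⟩ | ⟨t, ht, rfl⟩)
    exacts [⟨mem_univ _, (hu t ht).1⟩, ⟨mem_univ _, (hw t ht).1⟩]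
  have hlip : LocallyLipschitzOn K (fun p : ℝ × E => X p.1 p.2) := by
    intro p hp
    obtain ⟨C, s, hs, hC⟩ :=
      (hX.contDiffAt ((isOpen_univ.prod hD).mem_nhds (hKU hp))).exists_lipschitzOnWith
    exact ⟨C, s, mem_nhdsWithin_of_mem_nhds hs, hC⟩
  obtain ⟨C, hC⟩ := hlip.exists_lipschitzOnWith_of_compact hK
  refine ODE_solution_unique_of_mem_Icc_right (v := X) (s := fun t => {z | (t, z) ∈ K}) (K := C)
    (fun t _ x hx y hy => ?_) huc (fun t ht => ?_) (fun t ht => ?_) hwc (fun t ht => ?_)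
    (fun t ht => ?_) h
  · have := hC hx hy
    simpa [Prod.edist_eq] using this
  · exact (hu t (Ico_subset_Icc_self ht)).2.mono_of_mem_nhdsWithin (Icc_mem_nhdsGE_of_mem ht)
  · exact Or.inl ⟨t, Ico_subset_Icc_self ht, rfl⟩
  · exact (hw t (Ico_subset_Icc_self ht)).2.mono_of_mem_nhdsWithin (Icc_mem_nhdsGE_of_mem ht)
  · exact Or.inr ⟨t, Ico_subset_Icc_self ht, rfl⟩

end Uniqueness

section PlanarFlow

variable {F : Plane → Plane} {D : Set Plane}

lemma IsSolutionCurve.restrict {z : Plane} {T t : ℝ} {c : ℝ → Plane}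
    (hc : IsSolutionCurve F D z T c) (ht : t ∈ Icc 0 T) : IsSolutionCurve F D z t c := by
  have hT : 0 ≤ T := ht.1.trans ht.2
  refine ⟨hc.1, fun s hs => ?_⟩
  rw [uIcc_of_le ht.1] at hs ⊢
  have := hc.2 s (by rw [uIcc_of_le hT]; exact ⟨hs.1, hs.2.trans ht.2⟩)
  rw [uIcc_of_le hT] at this
  exact ⟨this.1, this.2.mono (Icc_subset_Icc_right ht.2)⟩

lemma flow_eq_of_isSolutionCurve (hD : IsOpen D) (hF : ContDiffOn ℝ 1 F D) {z : Plane} {T t : ℝ}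
    {c : ℝ → Plane} (hc : IsSolutionCurve F D z T c) (ht : t ∈ Icc 0 T) :
    flow F D t z = c t := by
  have hct := hc.restrict ht
  have hex : SolutionExists F D z t := ⟨c, hct⟩
  rw [flow, dif_pos hex]
  have h1 := hex.choose_spec
  have hX : ContDiffOn ℝ 1 (fun p : ℝ × Plane => F p.2) (univ ×ˢ D) :=
    hF.comp contDiffOn_snd fun p hp => hp.2
  refine eqOn_Icc_of_solution (X := fun _ => F) hD hX (a := 0) (b := t) ?_ ?_
    (h1.1.trans hct.1.symm) (right_mem_Icc.2 ht.1)
  · have := h1.2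
    rwa [uIcc_of_le ht.1] at this
  · have := hct.2
    rwa [uIcc_of_le ht.1] at this

end PlanarFlow

section Branch

lemma hasStrictFDerivAt_integral_segment {h : ℝ × ℝ × ℝ → ℝ} {a : ℝ × ℝ}
    (hh : ContDiffAt ℝ 1 h (0, a)) :
    HasStrictFDerivAt (fun q : ℝ × ℝ × ℝ => ∫ s in (0 : ℝ)..1, h (s * q.1, q.2))
      (fderiv ℝ h (0, a) ∘L
        (((2 : ℝ)⁻¹ • ContinuousLinearMap.id ℝ ℝ).prodMap (ContinuousLinearMap.id ℝ (ℝ × ℝ))))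
      (0, a) := by
  have hs := hh.hasStrictFDerivAt one_ne_zero
  set A := fderiv ℝ h (0, a)
  rw [hasStrictFDerivAt_iff_isLittleO, Asymptotics.isLittleO_iff]
  intro c hc
  rw [hasStrictFDerivAt_iff_isLittleO, Asymptotics.isLittleO_iff] at hs
  have h1 := hs hc
  have hcont : ∀ᶠ q in 𝓝 ((0 : ℝ), a), ContinuousAt h q :=
    (hh.eventually (by simp)).mono fun q hq => hq.continuousAt
  rw [nhds_prod_eq] at h1
  obtain ⟨r, hr, hball⟩ := Metric.eventually_nhds_iff_ball.1 (by rw [← nhds_prod_eq] at h1; exact h1)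
  obtain ⟨r', hr', hball'⟩ := Metric.eventually_nhds_iff_ball.1 hcont
  have hscale : ∀ q : ℝ × ℝ × ℝ, ∀ ρ, q ∈ Metric.ball ((0 : ℝ), a) ρ → ∀ s ∈ Icc (0 : ℝ) 1,
      (s * q.1, q.2) ∈ Metric.ball ((0 : ℝ), a) ρ := by
    intro q ρ hq s hs
    rw [Metric.mem_ball, Prod.dist_eq, max_lt_iff] at hq ⊢
    refine ⟨lt_of_le_of_lt ?_ hq.1, hq.2⟩
    simp only [dist_zero_right, norm_mul, Real.norm_eq_abs, abs_of_nonneg hs.1]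
    exact mul_le_of_le_one_left (abs_nonneg _) hs.2
  rw [Metric.eventually_nhds_iff_ball]
  refine ⟨min r r', lt_min hr hr', fun p hp => ?_⟩
  have hp1 : p.1 ∈ Metric.ball ((0 : ℝ), a) (min r r') := by
    rw [Metric.mem_ball, Prod.dist_eq] at hp
    exact (le_max_left _ _).trans_lt hp
  have hp2 : p.2 ∈ Metric.ball ((0 : ℝ), a) (min r r') := by
    rw [Metric.mem_ball, Prod.dist_eq] at hp
    exact (le_max_right _ _).trans_lt hp
  have hint : ∀ q ∈ Metric.ball ((0 : ℝ), a) (min r r'),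
      IntervalIntegrable (fun s : ℝ => h (s * q.1, q.2)) volume 0 1 := by
    intro q hq
    refine ContinuousOn.intervalIntegrable fun s hs => ?_
    rw [uIcc_of_le zero_le_one] at hs
    have hc := hball' _ (hscale q r' (Metric.ball_subset_ball (min_le_right _ _) hq) s hs)
    exact (hc.comp (f := fun s : ℝ => (s * q.1, q.2)) (by fun_prop)).continuousWithinAt
  have hlin : ∫ s in (0 : ℝ)..1, A (s * (p.1 - p.2).1, (p.1 - p.2).2) =
      (A ∘L (((2 : ℝ)⁻¹ • ContinuousLinearMap.id ℝ ℝ).prodMap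
        (ContinuousLinearMap.id ℝ (ℝ × ℝ)))) (p.1 - p.2) := by
    have hsplit : ∀ s : ℝ, A (s * (p.1 - p.2).1, (p.1 - p.2).2) =
        s * A ((p.1 - p.2).1, 0) + A (0, (p.1 - p.2).2) := by
      intro s
      rw [← smul_eq_mul s (A _), ← map_smul, ← map_add]
      simp
    simp_rw [hsplit]
    rw [intervalIntegral.integral_add (Continuous.intervalIntegrable (by fun_prop) _ _)
        (Continuous.intervalIntegrable (by fun_prop) _ _),
      intervalIntegral.integral_mul_const, integral_id]
    simp only [intervalIntegral.integral_const, ContinuousLinearMap.comp_apply]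
    rw [← smul_eq_mul _ (A _), ← map_smul, ← map_smul, ← map_add]
    congr 1
    ext <;> simp
  rw [← hlin, ← intervalIntegral.integral_sub (hint _ hp1) (hint _ hp2),
    ← intervalIntegral.integral_sub ((hint _ hp1).sub (hint _ hp2))
      (Continuous.intervalIntegrable (by fun_prop) _ _)]
  have := intervalIntegral.norm_integral_le_of_norm_le_const (a := 0) (b := 1)
    (f := fun s => h (s * p.1.1, p.1.2) - h (s * p.2.1, p.2.2)
      - A (s * (p.1 - p.2).1, (p.1 - p.2).2)) (C := c * ‖p.1 - p.2‖) (fun s hs => ?_)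
  · simpa using this
  · rw [uIoc_of_le zero_le_one] at hs
    have hs' : s ∈ Icc (0 : ℝ) 1 := ⟨hs.1.le, hs.2⟩
    have hb := hball ((s * p.1.1, p.1.2), (s * p.2.1, p.2.2)) (by
      rw [Metric.mem_ball, Prod.dist_eq, max_lt_iff]
      exact ⟨hscale p.1 r (Metric.ball_subset_ball (min_le_left _ _) hp1) s hs',
        hscale p.2 r (Metric.ball_subset_ball (min_le_left _ _) hp2) s hs'⟩)
    have heq : ((s * p.1.1, p.1.2) : ℝ × ℝ × ℝ) - (s * p.2.1, p.2.2) =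
        (s * (p.1 - p.2).1, (p.1 - p.2).2) := by
      ext <;> simp [mul_sub]
    simp only [heq] at hb
    refine hb.trans ?_
    gcongr
    rw [Prod.norm_def, Prod.norm_def]
    refine max_le_max ?_ le_rfl
    simp only [norm_mul, Real.norm_eq_abs, abs_of_nonneg hs'.1]
    exact mul_le_of_le_one_left (abs_nonneg _) hs'.2

/-- Solutions of `S = P = 0` near `(0, θ₀, x₀)` where `P` vanishes for `ε = 0`: they form a branch
parametrised by `ε`, provided that `∂ₓS ≠ 0 = ∂_θ S` and `∂_θ ∂_ε P ≠ 0 = ∂_ε P`. -/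
lemma exists_branch {S P : ℝ × ℝ × ℝ → ℝ} {θ₀ x₀ : ℝ}
    (hS : ContDiffAt ℝ 1 S (0, θ₀, x₀)) (hP : ContDiffAt ℝ 2 P (0, θ₀, x₀))
    (hS0 : S (0, θ₀, x₀) = 0) (hSθ : fderiv ℝ S (0, θ₀, x₀) (0, 1, 0) = 0)
    (hSx : fderiv ℝ S (0, θ₀, x₀) (0, 0, 1) ≠ 0)
    (hP0 : ∀ᶠ a in 𝓝 (θ₀, x₀), P (0, a) = 0)
    (hP1 : fderiv ℝ P (0, θ₀, x₀) (1, 0, 0) = 0)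
    (hP2 : deriv (fun θ => fderiv ℝ P (0, θ, x₀) (1, 0, 0)) θ₀ ≠ 0) :
    ∃ C > 0, ∃ ρ > 0, ∃ ε₁ > 0, ∀ ε ∈ Ioo 0 ε₁, ∃ θ x, |θ - θ₀| ≤ C * ε ∧ |x - x₀| ≤ C * ε ∧
      S (ε, θ, x) = 0 ∧ P (ε, θ, x) = 0 ∧
      ∀ θ' x', |θ' - θ₀| < ρ → |x' - x₀| < ρ → S (ε, θ', x') = 0 → P (ε, θ', x') = 0 →
        θ' = θ ∧ x' = x := by
  set q₀ : ℝ × ℝ × ℝ := (0, θ₀, x₀) with hq₀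
  set h : ℝ × ℝ × ℝ → ℝ := fun q => fderiv ℝ P q (1, 0, 0) with hh
  have hh1 : ContDiffAt ℝ 1 h q₀ :=
    (hP.fderiv_right (m := 1) (by norm_num)).clm_apply contDiffAt_const
  set Q : ℝ × ℝ × ℝ → ℝ := fun q => ∫ s in (0 : ℝ)..1, h (s * q.1, q.2) with hQ
  have hQd := hasStrictFDerivAt_integral_segment (a := (θ₀, x₀)) hh1
  set B := fderiv ℝ h q₀
  set B' := B ∘L (((2 : ℝ)⁻¹ • ContinuousLinearMap.id ℝ ℝ).prodMap
    (ContinuousLinearMap.id ℝ (ℝ × ℝ))) with hB'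
  have hSd := hS.hasStrictFDerivAt one_ne_zero
  set A := fderiv ℝ S q₀
  have hf : HasStrictFDerivAt (fun q => (S q, Q q)) (A.prod B') q₀ := hSd.prodMk hQd
  have hBθ : B (0, 1, 0) ≠ 0 := by
    have h1 : HasDerivAt (fun θ : ℝ => h (0, θ, x₀)) (B (0, 1, 0)) θ₀ :=
      (hh1.differentiableAt one_ne_zero).hasFDerivAt.comp_hasDerivAt (f := fun θ : ℝ => (0, θ, x₀))
        θ₀ ((hasDerivAt_const _ _).prodMk ((hasDerivAt_id _).prodMk (hasDerivAt_const _ _)))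
    rw [h1.deriv] at hP2
    exact hP2
  have hinj : Function.Injective
      ((A.prod B') ∘L ContinuousLinearMap.inr ℝ ℝ (ℝ × ℝ)) := by
    rw [injective_iff_map_eq_zero]
    rintro ⟨u, v⟩ huv
    have e1 : A (0, u, v) = 0 := congrArg Prod.fst huv
    have e2 : B (0, u, v) = 0 := by
      have := congrArg Prod.snd huv
      simpa [hB'] using this
    have hsplit : ((0 : ℝ), u, v) = u • ((0 : ℝ), (1 : ℝ), (0 : ℝ)) + v • ((0 : ℝ), (0 : ℝ), (1 : ℝ)) := by
      simp
    rw [hsplit, map_add, map_smul, map_smul, hSθ] at e1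
    have hv : v = 0 := by simpa [hSx] using e1
    rw [hsplit, hv, map_add, map_smul, map_smul] at e2
    have hu : u = 0 := by simpa [hBθ] using e2
    rw [hu, hv]; rfl
  have hinv : ((A.prod B') ∘L ContinuousLinearMap.inr ℝ ℝ (ℝ × ℝ)).IsInvertible :=
    ⟨(LinearEquiv.ofInjectiveEndo _ hinj).toContinuousLinearEquiv, by ext <;> rfl⟩
  have hQ0 : Q q₀ = 0 := by
    have : ∀ s : ℝ, h (s * q₀.1, q₀.2) = 0 := fun s => by simpa [hq₀] using hP1
    simp [hQ, this]
  have hiff := hf.eventually_apply_eq_iff_implicitFunctionOfProdDomain hinv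
  have hψd := (hf.hasStrictFDerivAt_implicitFunctionOfProdDomain hinv).hasFDerivAt.isBigO_sub
  have hψt := hf.tendsto_implicitFunctionOfProdDomain hinv
  set ψ := hf.implicitFunctionOfProdDomain hinv
  have hψ0 : ψ 0 = (θ₀, x₀) := hiff.self_of_nhds.1 rfl
  -- near the base point `P = ε Q`
  have hPQ : ∀ᶠ q in 𝓝 q₀, P q = q.1 * Q q := by
    obtain ⟨r, hr, hball⟩ := Metric.eventually_nhds_iff_ball.1 (hP.eventually (by simp))
    have hP0' : ∀ᶠ q : ℝ × ℝ × ℝ in 𝓝 q₀, P (0, q.2) = 0 :=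
      (continuous_snd.tendsto q₀).eventually hP0
    filter_upwards [Metric.ball_mem_nhds q₀ hr, hP0'] with q hq hq0
    have hmem : ∀ s ∈ Icc (0 : ℝ) 1, (s * q.1, q.2) ∈ Metric.ball q₀ r := by
      intro s hs
      rw [Metric.mem_ball, Prod.dist_eq, max_lt_iff] at hq ⊢
      refine ⟨lt_of_le_of_lt ?_ hq.1, hq.2⟩
      simp only [hq₀, dist_zero_right, norm_mul, Real.norm_eq_abs, abs_of_nonneg hs.1]
      exact mul_le_of_le_one_left (abs_nonneg _) hs.2
    have hd : ∀ s ∈ uIcc (0 : ℝ) 1, HasDerivAt (fun s : ℝ => P (s * q.1, q.2))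
        (q.1 * h (s * q.1, q.2)) s := by
      intro s hs
      rw [uIcc_of_le zero_le_one] at hs
      have h1 := ((hball _ (hmem s hs)).differentiableAt two_ne_zero).hasFDerivAt.comp_hasDerivAt
        (f := fun s : ℝ => (s * q.1, q.2)) s
        (((hasDerivAt_id s).mul_const q.1).prodMk (hasDerivAt_const s q.2))
      have h2 : q.1 * h (s * q.1, q.2) = fderiv ℝ P (s * q.1, q.2) (1 * q.1, 0) := by
        rw [hh, ← smul_eq_mul, ← map_smul]
        congr 1
        ext <;> simp
      rw [h2]
      exact h1
    have hc : ContinuousOn (fun s : ℝ => q.1 * h (s * q.1, q.2)) (uIcc 0 1) := by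
      intro s hs
      rw [uIcc_of_le zero_le_one] at hs
      have : ContinuousAt h (s * q.1, q.2) := by
        have h2 := (hball _ (hmem s hs)).fderiv_right (m := 1) (by norm_num)
        exact (h2.clm_apply contDiffAt_const).continuousAt
      exact (continuousAt_const.mul (this.comp (f := fun s : ℝ => (s * q.1, q.2))
        (by fun_prop))).continuousWithinAt
    have := intervalIntegral.integral_eq_sub_of_hasDerivAt hd hc.intervalIntegrable
    rw [intervalIntegral.integral_const_mul] at this
    simp only [one_mul, zero_mul, hq0, sub_zero] at this
    exact this.symm
  have hgood : ∀ᶠ q in 𝓝 q₀, q.1 ≠ 0 → ((S q = 0 ∧ P q = 0) ↔ ψ q.1 = q.2) := by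
    filter_upwards [hiff, hPQ] with q h1 h2 h3
    rw [← h1, Prod.mk.injEq, hS0, hQ0, h2]
    simp [h3]
  obtain ⟨ρ, hρ, hball⟩ := Metric.eventually_nhds_iff_ball.1 hgood
  obtain ⟨C, hC⟩ := hψd.bound
  have hψball : ∀ᶠ ε in 𝓝 (0 : ℝ), ψ ε ∈ Metric.ball (θ₀, x₀) ρ :=
    hψt.eventually (Metric.ball_mem_nhds _ hρ)
  obtain ⟨ε₁, hε₁, hε⟩ := Metric.eventually_nhds_iff_ball.1 (hC.and hψball)
  refine ⟨max C 1, by positivity, ρ, hρ, min ε₁ ρ, lt_min hε₁ hρ, fun ε hεm => ?_⟩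
  have hεb : ε ∈ Metric.ball (0 : ℝ) ε₁ := by
    rw [Metric.mem_ball, dist_zero_right, Real.norm_eq_abs, abs_of_pos hεm.1]
    exact hεm.2.trans_le (min_le_left _ _)
  have hερ : ∀ a ∈ Metric.ball (θ₀, x₀) ρ, (ε, a) ∈ Metric.ball q₀ ρ := by
    intro a ha
    rw [Metric.mem_ball, Prod.dist_eq, max_lt_iff]
    refine ⟨?_, ha⟩
    simp only [hq₀, dist_zero_right, Real.norm_eq_abs, abs_of_pos hεm.1]
    exact hεm.2.trans_le (min_le_right _ _)
  obtain ⟨h1, h2⟩ := hε ε hεb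
  have hle : ‖ψ ε - (θ₀, x₀)‖ ≤ max C 1 * ε := by
    rw [hψ0] at h1
    refine h1.trans ?_
    simp only [hq₀, sub_zero, Real.norm_eq_abs, abs_of_pos hεm.1]
    exact mul_le_mul_of_nonneg_right (le_max_left _ _) hεm.1.le
  rw [Prod.norm_def] at hle
  have hsol := (hball (ε, ψ ε) (hερ _ h2) hεm.1.ne').2 rfl
  refine ⟨(ψ ε).1, (ψ ε).2, (le_max_left _ _).trans hle, (le_max_right _ _).trans hle,
    hsol.1, hsol.2, fun θ' x' hθ' hx' hS' hP' => ?_⟩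
  have hmem : ((θ', x') : ℝ × ℝ) ∈ Metric.ball (θ₀, x₀) ρ := by
    rw [Metric.mem_ball, Prod.dist_eq, max_lt_iff]
    exact ⟨by rwa [Real.dist_eq], by rwa [Real.dist_eq]⟩
  have := (hball (ε, θ', x') (hερ _ hmem) hεm.1.ne').1 ⟨hS', hP'⟩
  simp only at this
  rw [this]
  exact ⟨rfl, rfl⟩

end Branch

end

section ArcFlow

lemma exists_Ioo_subset_of_Icc_subset {U : Set ℝ} (hU : IsOpen U) {a b : ℝ} (hab : a ≤ b)
    (h : Icc a b ⊆ U) : ∃ η > 0, Ioo (a - η) (b + η) ⊆ U := by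
  obtain ⟨η, hη, hsub⟩ := isCompact_Icc.exists_thickening_subset_open hU h
  refine ⟨η, hη, fun s hs => hsub (Metric.mem_thickening_iff.2
    ⟨max a (min s b), ⟨le_max_left _ _, max_le hab (min_le_right _ _)⟩, ?_⟩)⟩
  rw [Real.dist_eq, abs_lt]
  rcases le_total s b with h1 | h1 <;> rcases le_total a s with h2 | h2
  · rw [min_eq_left h1, max_eq_right h2]; constructor <;> linarith
  · rw [min_eq_left h1, max_eq_left h2]; constructor <;> linarith [hs.1]
  · rw [min_eq_right h1, max_eq_right hab]; constructor <;> linarith [hs.2]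
  · rw [min_eq_right h1, max_eq_right hab]; constructor <;> linarith [hs.2]

/-- An open condition that holds on `[a, b] × {y}` holds on a neighbourhood. -/
lemma exists_tube {Y : Type*} [PseudoMetricSpace Y] {O : Set (ℝ × Y)} (hO : IsOpen O) {a b : ℝ}
    (hab : a ≤ b) {y : Y} (h : ∀ s ∈ Icc a b, (s, y) ∈ O) :
    ∃ η > 0, ∃ r > 0, ∀ s ∈ Ioo (a - η) (b + η), ∀ z ∈ Metric.ball y r, (s, z) ∈ O := by
  obtain ⟨u, v, hu, hv, hau, hyv, huv⟩ := generalized_tube_lemma (isCompact_Icc (a := a) (b := b))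
    (isCompact_singleton (x := y)) hO (by
      rintro ⟨s, z⟩ ⟨hs, hz⟩
      rw [mem_singleton_iff] at hz
      simp only at hz
      rw [hz]
      exact h s hs)
  obtain ⟨η, hη, hηu⟩ := exists_Ioo_subset_of_Icc_subset hu hab hau
  obtain ⟨r, hr, hrv⟩ := Metric.isOpen_iff.1 hv y (hyv rfl)
  exact ⟨η, hη, r, hr, fun s hs z hz => huv ⟨hηu hs, hrv hz⟩⟩

/-- For initial data `e = (t, z, ε)` near `e₀` and times between `-η` and `T + η`, the curve
`ζ · e` solves `u'(s) = h(t + κ s, u(s), ε)`, `u(0) = z`, in `D`; it depends `C²` on everything. -/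
structure IsArcFlow (h : ℝ → Plane → ℝ → Plane) (D : Set Plane) (κ T η r : ℝ)
    (e₀ : ℝ × Plane × ℝ) (ζ : ℝ → ℝ × Plane × ℝ → Plane) : Prop where
  η_pos : 0 < η
  r_pos : 0 < r
  smooth : ContDiff ℝ 2 (fun p : ℝ × (ℝ × Plane × ℝ) => ζ p.1 p.2)
  zero : ∀ e, ζ 0 e = e.2.1
  mem : ∀ e ∈ Metric.ball e₀ r, ∀ s ∈ Ioo (-η) (T + η), ζ s e ∈ D
  deriv : ∀ e ∈ Metric.ball e₀ r, ∀ s ∈ Ioo (-η) (T + η),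
    HasDerivAt (fun s => ζ s e) (h (e.1 + κ * s) (ζ s e) e.2.2) s

lemma exists_isArcFlow {h : ℝ → Plane → ℝ → Plane} {D : Set Plane} {κ T ε₀ θ₀ : ℝ} {c : ℝ → Plane}
    (hD : IsOpen D) (hε₀ : 0 < ε₀) (hT : 0 ≤ T)
    (hh : ContDiffOn ℝ 2 (fun e : ℝ × Plane × ℝ => h e.1 e.2.1 e.2.2)
      (univ ×ˢ D ×ˢ Ioo (-ε₀) ε₀))
    (hc : ∀ t ∈ Icc 0 T, c t ∈ D ∧
      HasDerivWithinAt c (h (θ₀ + κ * t) (c t) 0) (Icc 0 T) t) :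
    ∃ ζ η r, IsArcFlow h D κ T η r (θ₀, c 0, 0) ζ ∧ r ≤ ε₀ := by
  set U : Set (ℝ × Plane × ℝ) := univ ×ˢ D ×ˢ Ioo (-ε₀) ε₀
  have hU : IsOpen U := isOpen_univ.prod (hD.prod isOpen_Ioo)
  set γ : ℝ → ℝ × Plane × ℝ := fun s => (θ₀ + κ * s, c s, 0) with hc'
  have hcc : ContinuousOn c (Icc 0 T) := fun t ht => (hc t ht).2.continuousWithinAt
  have hK : IsCompact (γ '' Icc 0 T) := isCompact_Icc.image_of_continuousOn (by fun_prop)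
  have hKU : γ '' Icc 0 T ⊆ U := by
    rintro _ ⟨s, hs, rfl⟩
    exact ⟨mem_univ _, (hc s hs).1, by simpa [hc'] using hε₀⟩
  obtain ⟨g, hg, hgc, N, hN, hKN, hNU, hgN⟩ :=
    exists_contDiff_hasCompactSupport_eqOn (n := 2) hU hh hK hKU
  set V : ℝ × Plane × ℝ → ℝ × Plane × ℝ := fun e => (κ, g e, 0) with hV
  have hVc : ContDiff ℝ 2 V := contDiff_const.prodMk (hg.prodMk contDiff_const)
  obtain ⟨Kg, hKg⟩ := hg.lipschitzWith_of_hasCompactSupport hgc (by norm_num)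
  have hVl := (LipschitzWith.const (α := ℝ × Plane × ℝ) κ).prodMk
    (hKg.prodMk (LipschitzWith.const (α := ℝ × Plane × ℝ) (0 : ℝ)))
  obtain ⟨M, hM⟩ := hgc.exists_bound_of_continuous hg.continuous
  have hVb : ∀ e, ‖V e‖ ≤ (⟨max |κ| (max M 0), by positivity⟩ : ℝ≥0) := by
    intro e
    simp only [hV, Prod.norm_def, norm_zero, Real.norm_eq_abs]
    exact max_le_max le_rfl (max_le_max (hM e) le_rfl)
  obtain ⟨φ, hφ⟩ := exists_isGlobalFlow hVl hVb
  have hφs : ContDiff ℝ 2 (fun p : ℝ × (ℝ × Plane × ℝ) => φ p.1 p.2) :=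
    hφ.contDiff hVl two_ne_zero hVc
  have h1 : ∀ s e, (φ s e).1 = e.1 + κ * s := by
    intro s e
    have hd : ∀ s, HasDerivAt (fun s => (φ s e).1 - κ * s) 0 s := by
      intro s
      have ha : HasDerivAt (fun s => (φ s e).1) κ s := (hφ.deriv e s).fst
      simpa using ha.fun_sub ((hasDerivAt_id' s).const_mul κ)
    have := is_const_of_deriv_eq_zero (fun s => (hd s).differentiableAt) (fun s => (hd s).deriv) s 0
    simp only [hφ.zero, mul_zero, sub_zero] at this
    linarith
  have h2 : ∀ s e, (φ s e).2.2 = e.2.2 := by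
    intro s e
    have hd : ∀ s, HasDerivAt (fun s => (φ s e).2.2) 0 s := fun s => (hφ.deriv e s).snd.snd
    have := is_const_of_deriv_eq_zero (fun s => (hd s).differentiableAt) (fun s => (hd s).deriv) s 0
    simpa only [hφ.zero] using this
  have hbase : EqOn (fun s => φ s (θ₀, c 0, 0)) γ (Icc 0 T) := by
    refine eqOn_Icc_of_solution (X := fun _ => V) isOpen_univ
      ((hVc.of_le one_le_two).comp contDiff_snd).contDiffOn (fun t _ => ⟨mem_univ _, ?_⟩)
      (fun t ht => ⟨mem_univ _, ?_⟩) ?_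
    · exact (hφ.deriv _ t).hasDerivWithinAt
    · have ha : HasDerivWithinAt (fun s => θ₀ + κ * s) κ (Icc 0 T) t := by
        simpa using (((hasDerivAt_id t).const_mul κ).const_add θ₀).hasDerivWithinAt
      have hb := (hc t ht).2
      have hgt : g (γ t) = h (θ₀ + κ * t) (c t) 0 := hgN (hKN ⟨t, ht, rfl⟩)
      simp only [hV, hgt]
      exact ha.prodMk (hb.prodMk (hasDerivWithinAt_const _ _ _))
    · simp [hφ.zero, hc']
  obtain ⟨η, hη, r, hr, htube⟩ := exists_tube (hN.preimage hφs.continuous) hT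
    (y := (θ₀, c 0, (0 : ℝ))) (fun s hs => by
      change φ s (θ₀, c 0, 0) ∈ N
      have := hbase hs
      simp only at this
      rw [this]
      exact hKN ⟨s, hs, rfl⟩)
  simp only [zero_sub] at htube
  refine ⟨fun s e => (φ s e).2.1, η, min r ε₀, ⟨hη, lt_min hr hε₀, ?_, ?_, ?_, ?_⟩,
    min_le_right _ _⟩
  · exact (contDiff_fst.comp contDiff_snd).comp hφs
  · intro e; simp [hφ.zero]
  · intro e he s hs
    exact (hNU (htube s hs e (Metric.ball_subset_ball (min_le_left _ _) he))).2.1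
  · intro e he s hs
    have hmem := htube s hs e (Metric.ball_subset_ball (min_le_left _ _) he)
    have hd : HasDerivAt (fun s => (φ s e).2.1) (g (φ s e)) s := (hφ.deriv e s).snd.fst
    have := hgN hmem
    simp only at this
    rwa [this, h1, h2] at hd

lemma eqOn_zero_of_linear_ode {E : Type*} [NormedAddCommGroup E] [NormedSpace ℝ E] {a b : ℝ}
    {A : ℝ → E →L[ℝ] E} (hA : ContinuousOn A (Icc a b)) {d : ℝ → E}
    (hd : ∀ t ∈ Icc a b, HasDerivWithinAt d (A t (d t)) (Icc a b) t) (h0 : d a = 0 ∨ d b = 0) :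
    EqOn d 0 (Icc a b) := by
  obtain ⟨K, hK⟩ := isCompact_Icc.exists_bound_of_continuousOn hA
  have hlip : ∀ t ∈ Icc a b, LipschitzWith K.toNNReal (A t) := fun t ht =>
    (A t).lipschitz.weaken (by
      rw [← NNReal.coe_le_coe, coe_nnnorm]
      exact (hK t ht).trans (Real.le_coe_toNNReal K))
  have hdc : ContinuousOn d (Icc a b) := fun t ht => (hd t ht).continuousWithinAt
  rcases h0 with h0 | h0
  · exact ODE_solution_unique_of_mem_Icc_right (v := fun t => A t) (s := fun _ => univ)
      (fun t ht => (hlip t (Ico_subset_Icc_self ht)).lipschitzOnWith) hdc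
      (fun t ht => (hd t (Ico_subset_Icc_self ht)).mono_of_mem_nhdsWithin
        (Icc_mem_nhdsGE_of_mem ht)) (fun _ _ => mem_univ _) continuousOn_const
      (fun t _ => by
        simp only [Pi.zero_apply, map_zero]
        exact hasDerivWithinAt_const _ _ _) (fun _ _ => mem_univ _) h0
  · exact ODE_solution_unique_of_mem_Icc_left (v := fun t => A t) (s := fun _ => univ)
      (fun t ht => (hlip t (Ioc_subset_Icc_self ht)).lipschitzOnWith) hdc
      (fun t ht => (hd t (Ioc_subset_Icc_self ht)).mono_of_mem_nhdsWithin
        (Icc_mem_nhdsLE_of_mem ht)) (fun _ _ => mem_univ _) continuousOn_const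
      (fun t _ => by
        simp only [Pi.zero_apply, map_zero]
        exact hasDerivWithinAt_const _ _ _) (fun _ _ => mem_univ _) h0

variable {h : ℝ → Plane → ℝ → Plane} {g : ℝ → Plane → Plane} {F : Plane → Plane} {D : Set Plane}
  {κ T η r ε₀ θ₀ : ℝ} {z₀ : Plane} {ζ : ℝ → ℝ × Plane × ℝ → Plane}

/-- The family of fields `h(·, ·, ε)` is a perturbation of `F`, to first order `F + ε g`. -/
structure IsPerturbation (h : ℝ → Plane → ℝ → Plane) (F : Plane → Plane) (g : ℝ → Plane → Plane)
    (D : Set Plane) (ε₀ : ℝ) : Prop where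
  contDiffOn : ContDiffOn ℝ 2 (fun e : ℝ × Plane × ℝ => h e.1 e.2.1 e.2.2)
    (univ ×ˢ D ×ˢ Ioo (-ε₀) ε₀)
  zero : ∀ t, ∀ z ∈ D, h t z 0 = F z
  first : ∀ t, ∀ z ∈ D, HasDerivAt (fun ε => h t z ε) (g t z) 0

lemma IsPerturbation.contDiffOn_field (hp : IsPerturbation h F g D ε₀) (hε₀ : 0 < ε₀) :
    ContDiffOn ℝ 2 F D := by
  have : ContDiffOn ℝ 2 (fun z => h 0 z 0) D :=
    hp.contDiffOn.comp (f := fun z : Plane => ((0 : ℝ), z, (0 : ℝ)))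
      (contDiff_const.prodMk (contDiff_id.prodMk contDiff_const)).contDiffOn
      (fun z hz => ⟨mem_univ _, hz, by simpa using hε₀⟩)
  exact this.congr fun z hz => (hp.zero 0 z hz).symm

lemma IsPerturbation.fderiv_apply (hp : IsPerturbation h F g D ε₀) (hD : IsOpen D) (hε₀ : 0 < ε₀)
    {t : ℝ} {z : Plane} (hz : z ∈ D) (w : Plane) (δ : ℝ) :
    fderiv ℝ (fun e : ℝ × Plane × ℝ => h e.1 e.2.1 e.2.2) (t, z, 0) (0, w, δ)
      = fderiv ℝ F z w + δ • g t z := by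
  have hd : HasFDerivAt (fun e : ℝ × Plane × ℝ => h e.1 e.2.1 e.2.2) _ (t, z, 0) :=
    ((hp.contDiffOn.contDiffAt (x := (t, z, 0))
      ((isOpen_univ.prod (hD.prod isOpen_Ioo)).mem_nhds
        ⟨mem_univ _, hz, by simpa using hε₀⟩)).differentiableAt two_ne_zero).hasFDerivAt
  set A := fderiv ℝ (fun e : ℝ × Plane × ℝ => h e.1 e.2.1 e.2.2) (t, z, 0)
  have h1 : HasFDerivAt F (A ∘L ContinuousLinearMap.inr ℝ ℝ (Plane × ℝ) ∘L
      ContinuousLinearMap.inl ℝ Plane ℝ) z := by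
    have h2 : HasFDerivAt (fun z : Plane => (t, z, (0 : ℝ)))
        (ContinuousLinearMap.inr ℝ ℝ (Plane × ℝ) ∘L ContinuousLinearMap.inl ℝ Plane ℝ) z :=
      (hasFDerivAt_prodMk_right t (z, (0 : ℝ))).comp z (hasFDerivAt_prodMk_left z (0 : ℝ))
    refine (hd.comp (f := fun z : Plane => (t, z, (0 : ℝ))) z h2).congr_of_eventuallyEq ?_
    filter_upwards [hD.mem_nhds hz] with y hy using (hp.zero t y hy).symm
  have h3 : HasDerivAt (fun ε => h t z ε) (A (0, 0, 1)) 0 :=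
    hd.comp_hasDerivAt (f := fun ε : ℝ => (t, z, ε)) 0
      ((hasDerivAt_const _ _).prodMk ((hasDerivAt_const _ _).prodMk (hasDerivAt_id _)))
  rw [h1.fderiv, (hp.first t z hz).unique h3, ← map_smul]
  simp only [ContinuousLinearMap.comp_apply]
  rw [← map_add]
  congr 1
  ext <;> simp

lemma IsPerturbation.continuousOn_first (hp : IsPerturbation h F g D ε₀) (hD : IsOpen D)
    (hε₀ : 0 < ε₀) : ContinuousOn (fun p : ℝ × Plane => g p.1 p.2) (univ ×ˢ D) := by
  have hU : IsOpen ((univ : Set ℝ) ×ˢ D ×ˢ Ioo (-ε₀) ε₀) := isOpen_univ.prod (hD.prod isOpen_Ioo)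
  have h1 : ContinuousOn (fun e => fderiv ℝ (fun e : ℝ × Plane × ℝ => h e.1 e.2.1 e.2.2) e (0, 0, 1))
      (univ ×ˢ D ×ˢ Ioo (-ε₀) ε₀) :=
    (hp.contDiffOn.continuousOn_fderiv_of_isOpen hU (by norm_num)).clm_apply continuousOn_const
  have h2 := h1.comp (f := fun p : ℝ × Plane => (p.1, p.2, (0 : ℝ))) (s := univ ×ˢ D)
    (by fun_prop) (fun p hp => ⟨mem_univ _, hp.2, by simpa using hε₀⟩)
  refine h2.congr fun p hq => ?_
  have := hp.fderiv_apply hD hε₀ (t := p.1) hq.2 0 1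
  simp only [map_zero, one_smul, zero_add] at this
  exact this.symm

/-- The derivative of an arc flow with respect to position and `ε` solves the linearised
equation. -/
lemma IsArcFlow.hasDerivAt_variation (hζ : IsArcFlow h D κ T η r (θ₀, z₀, 0) ζ)
    (hp : IsPerturbation h F g D ε₀) (hD : IsOpen D) (hε₀ : 0 < ε₀) {θ : ℝ}
    (hθ : |θ - θ₀| < r) {s : ℝ} (hs : s ∈ Ioo (-η) (T + η)) (w : Plane) (δ : ℝ) :
    HasDerivAt (fun s => fderiv ℝ (ζ s) (θ, z₀, 0) (0, w, δ))
      (fderiv ℝ F (ζ s (θ, z₀, 0)) (fderiv ℝ (ζ s) (θ, z₀, 0) (0, w, δ))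
        + δ • g (θ + κ * s) (ζ s (θ, z₀, 0))) s := by
  set e : ℝ × Plane × ℝ := (θ, z₀, 0) with he
  have heb : e ∈ Metric.ball ((θ₀, z₀, 0) : ℝ × Plane × ℝ) r := by
    rw [Metric.mem_ball, Prod.dist_eq]
    simpa [he, Real.dist_eq, hζ.r_pos] using hθ
  have h1 := hasDerivAt_fderiv_of_contDiff hζ.smooth
    (Θ := fun s e => h (e.1 + κ * s) (ζ s e) e.2.2) (s := s) (e := e) (by
      filter_upwards [prod_mem_nhds (isOpen_Ioo.mem_nhds hs) (Metric.isOpen_ball.mem_nhds heb)]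
        with p hp using hζ.deriv p.2 hp.2 p.1 hp.1) (0, w, δ)
  have hzD := hζ.mem e heb s hs
  have hd : HasFDerivAt (fun e : ℝ × Plane × ℝ => h e.1 e.2.1 e.2.2) _ (θ + κ * s, ζ s e, 0) :=
    ((hp.contDiffOn.contDiffAt (x := (θ + κ * s, ζ s e, 0))
      ((isOpen_univ.prod (hD.prod isOpen_Ioo)).mem_nhds
        ⟨mem_univ _, hzD, by simpa using hε₀⟩)).differentiableAt two_ne_zero).hasFDerivAt
  have hζd : DifferentiableAt ℝ (ζ s) e :=
    (hζ.smooth.differentiable two_ne_zero (s, e)).comp (f := fun e => (s, e)) e (by fun_prop)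
  have hin : HasFDerivAt (fun e : ℝ × Plane × ℝ => (e.1 + κ * s, ζ s e, e.2.2))
      ((ContinuousLinearMap.fst ℝ ℝ (Plane × ℝ)).prod ((fderiv ℝ (ζ s) e).prod
        (ContinuousLinearMap.snd ℝ Plane ℝ ∘L ContinuousLinearMap.snd ℝ ℝ (Plane × ℝ)))) e :=
    (hasFDerivAt_fst.add_const _).prodMk (hζd.hasFDerivAt.prodMk
      (hasFDerivAt_snd.comp e hasFDerivAt_snd))
  have hcomp := (hd.comp (f := fun e : ℝ × Plane × ℝ => (e.1 + κ * s, ζ s e, e.2.2)) e hin).fderiv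
  have h2 : fderiv ℝ (fun e : ℝ × Plane × ℝ => h (e.1 + κ * s) (ζ s e) e.2.2) e (0, w, δ) =
      fderiv ℝ F (ζ s e) (fderiv ℝ (ζ s) e (0, w, δ)) + δ • g (θ + κ * s) (ζ s e) := by
    rw [← hp.fderiv_apply hD hε₀ hzD]
    exact congrArg (fun A : ℝ × Plane × ℝ →L[ℝ] Plane => A (0, w, δ)) hcomp
  rw [← h2]
  exact h1

end ArcFlow

section Variation

variable {h : ℝ → Plane → ℝ → Plane} {g : ℝ → Plane → Plane} {F : Plane → Plane} {D : Set Plane}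
  {κ T η r ε₀ θ₀ θ t : ℝ} {z₀ z : Plane} {ζ : ℝ → ℝ × Plane × ℝ → Plane}

lemma mem_ball_triple {r : ℝ} (hr : 0 < r) {z z₀ : Plane} (hθ : |θ - θ₀| < r)
    (hz : dist z z₀ < r) : ((θ, z, 0) : ℝ × Plane × ℝ) ∈ Metric.ball (θ₀, z₀, 0) r := by
  rw [Metric.mem_ball, Prod.dist_eq, Prod.dist_eq, Real.dist_eq]
  simp only [dist_self]
  exact max_lt hθ (max_lt hz hr)

lemma IsArcFlow.isSolutionCurve (hζ : IsArcFlow h D κ T η r (θ₀, z₀, 0) ζ)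
    (hp : IsPerturbation h F g D ε₀) (hθ : |θ - θ₀| < r) (hz : dist z z₀ < r)
    (ht : t ∈ Ico 0 (T + η)) : IsSolutionCurve F D z t (fun s => ζ s (θ, z, 0)) := by
  have hmem := mem_ball_triple hζ.r_pos hθ hz
  refine ⟨hζ.zero _, fun s hs => ?_⟩
  rw [uIcc_of_le ht.1] at hs ⊢
  have hs' : s ∈ Ioo (-η) (T + η) := ⟨by linarith [hζ.η_pos, hs.1], hs.2.trans_lt ht.2⟩
  have hD := hζ.mem _ hmem s hs'
  refine ⟨hD, ?_⟩
  have := (hζ.deriv _ hmem s hs').hasDerivWithinAt (s := Icc 0 t)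
  rwa [hp.zero _ _ hD] at this

lemma IsArcFlow.flow_eq (hζ : IsArcFlow h D κ T η r (θ₀, z₀, 0) ζ)
    (hp : IsPerturbation h F g D ε₀) (hD : IsOpen D) (hε₀ : 0 < ε₀) (hθ : |θ - θ₀| < r)
    (hz : dist z z₀ < r) (ht : t ∈ Ico 0 (T + η)) : flow F D t z = ζ t (θ, z, 0) :=
  flow_eq_of_isSolutionCurve hD ((hp.contDiffOn_field hε₀).of_le one_le_two)
    (hζ.isSolutionCurve hp hθ hz ht) (right_mem_Icc.2 ht.1)

/-- The inclusion of positions into triples (time, position, parameter). -/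
def positionInclusion : Plane →L[ℝ] ℝ × Plane × ℝ :=
  ContinuousLinearMap.inr ℝ ℝ (Plane × ℝ) ∘L ContinuousLinearMap.inl ℝ Plane ℝ

lemma IsArcFlow.fderiv_slice (hζ : IsArcFlow h D κ T η r (θ₀, z₀, 0) ζ) (s : ℝ)
    (e : ℝ × Plane × ℝ) : HasFDerivAt (ζ s)
      (fderiv ℝ (fun p : ℝ × (ℝ × Plane × ℝ) => ζ p.1 p.2) (s, e)
        ∘L ContinuousLinearMap.inr ℝ ℝ (ℝ × Plane × ℝ)) e :=
  (hζ.smooth.differentiable two_ne_zero (s, e)).hasFDerivAt.comp e (hasFDerivAt_prodMk_right s e)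

lemma IsArcFlow.Y_eq (hζ : IsArcFlow h D κ T η r (θ₀, z₀, 0) ζ)
    (hp : IsPerturbation h F g D ε₀) (hD : IsOpen D) (hε₀ : 0 < ε₀) (hθ : |θ - θ₀| < r)
    (ht : t ∈ Ico 0 (T + η)) :
    Y F D t z₀ = fderiv ℝ (ζ t) (θ, z₀, 0) ∘L positionInclusion := by
  have h1 : HasFDerivAt (fun z : Plane => ((θ, z, 0) : ℝ × Plane × ℝ)) positionInclusion z₀ :=
    (hasFDerivAt_prodMk_right θ (z₀, (0 : ℝ))).comp z₀ (hasFDerivAt_prodMk_left z₀ (0 : ℝ))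
  have h2 : HasFDerivAt (fun z => flow F D t z) _ z₀ :=
    ((hζ.fderiv_slice t (θ, z₀, 0)).differentiableAt.hasFDerivAt.comp
      (f := fun z : Plane => ((θ, z, 0) : ℝ × Plane × ℝ)) z₀ h1).congr_of_eventuallyEq (by
        filter_upwards [Metric.ball_mem_nhds z₀ hζ.r_pos] with z hz
        exact hζ.flow_eq hp hD hε₀ hθ hz ht)
  exact h2.fderiv

lemma IsArcFlow.continuous_fderiv_slice (hζ : IsArcFlow h D κ T η r (θ₀, z₀, 0) ζ)
    (e : ℝ × Plane × ℝ) : Continuous fun s => fderiv ℝ (ζ s) e := by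
  simp_rw [fun s => (hζ.fderiv_slice s e).fderiv]
  have := (hζ.smooth.continuous_fderiv two_ne_zero).comp (f := fun s : ℝ => (s, e)) (by fun_prop)
  exact this.clm_comp continuous_const

lemma IsArcFlow.continuousOn_coefficient (hζ : IsArcFlow h D κ T η r (θ₀, z₀, 0) ζ)
    (hp : IsPerturbation h F g D ε₀) (hD : IsOpen D) (hε₀ : 0 < ε₀) (hθ : |θ - θ₀| < r)
    {b : ℝ} (hb : b ∈ Ico 0 (T + η)) :
    ContinuousOn (fun s => fderiv ℝ F (ζ s (θ, z₀, 0))) (Icc 0 b) := by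
  refine ((hp.contDiffOn_field hε₀).continuousOn_fderiv_of_isOpen hD (by norm_num)).comp ?_ ?_
  · exact (hζ.smooth.continuous.comp
      (f := fun s : ℝ => (s, ((θ, z₀, 0) : ℝ × Plane × ℝ))) (by fun_prop)).continuousOn
  · intro s hs
    exact hζ.mem _ (mem_ball_triple hζ.r_pos hθ (by simpa using hζ.r_pos)) s
      ⟨by linarith [hζ.η_pos, hs.1], hs.2.trans_lt hb.2⟩

lemma IsArcFlow.isInvertible_Y (hζ : IsArcFlow h D κ T η r (θ₀, z₀, 0) ζ)
    (hp : IsPerturbation h F g D ε₀) (hD : IsOpen D) (hε₀ : 0 < ε₀) (ht : t ∈ Ico 0 (T + η)) :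
    (Y F D t z₀).IsInvertible := by
  have hθ : |θ₀ - θ₀| < r := by simpa using hζ.r_pos
  have hinj : Function.Injective (Y F D t z₀) := by
    rw [injective_iff_map_eq_zero]
    intro u hu
    rw [hζ.Y_eq hp hD hε₀ hθ ht] at hu
    have hz := eqOn_zero_of_linear_ode (hζ.continuousOn_coefficient hp hD hε₀ hθ ht)
      (d := fun s => fderiv ℝ (ζ s) (θ₀, z₀, 0) (0, u, 0)) (fun s hs => by
        have := hζ.hasDerivAt_variation hp hD hε₀ hθ (s := s)
          ⟨by linarith [hζ.η_pos, hs.1], hs.2.trans_lt ht.2⟩ u 0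
        simpa using this.hasDerivWithinAt) (Or.inr hu) (left_mem_Icc.2 ht.1)
    have hid : HasFDerivAt (ζ 0)
        (ContinuousLinearMap.fst ℝ Plane ℝ ∘L ContinuousLinearMap.snd ℝ ℝ (Plane × ℝ))
        (θ₀, z₀, 0) := by
      have : ζ 0 = fun e => e.2.1 := funext hζ.zero
      rw [this]
      exact (ContinuousLinearMap.fst ℝ Plane ℝ ∘L
        ContinuousLinearMap.snd ℝ ℝ (Plane × ℝ)).hasFDerivAt
    simp only [hid.fderiv] at hz
    exact hz
  exact ⟨(LinearEquiv.ofInjectiveEndo (Y F D t z₀ : Plane →ₗ[ℝ] Plane) hinj).toContinuousLinearEquiv,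
    by ext <;> rfl⟩

lemma IsArcFlow.continuousOn_inverse_apply (hζ : IsArcFlow h D κ T η r (θ₀, z₀, 0) ζ)
    (hp : IsPerturbation h F g D ε₀) (hD : IsOpen D) (hε₀ : 0 < ε₀)
    (hθ : |θ - θ₀| < r) :
    ContinuousOn (fun t => (Y F D t z₀).inverse (g (θ + κ * t) (flow F D t z₀))) (Icc 0 T) := by
  have hz₀ : dist z₀ z₀ < r := by simpa using hζ.r_pos
  have hsub : ∀ t ∈ Icc 0 T, t ∈ Ico 0 (T + η) := fun t ht => ⟨ht.1, by linarith [ht.2, hζ.η_pos]⟩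
  have hYc : ContinuousOn (fun t => Y F D t z₀) (Icc 0 T) :=
    ((hζ.continuous_fderiv_slice (θ, z₀, 0)).clm_comp continuous_const).continuousOn.congr
      fun t ht => hζ.Y_eq hp hD hε₀ hθ (hsub t ht)
  have hYi : ContinuousOn (fun t => (Y F D t z₀).inverse) (Icc 0 T) := by
    intro t ht
    exact ((hζ.isInvertible_Y hp hD hε₀ (hsub t ht)).contDiffAt_map_inverse
      (n := 0)).continuousAt.comp_continuousWithinAt (f := fun t => Y F D t z₀) (hYc t ht)
  refine hYi.clm_apply ?_
  have hg := (hp.continuousOn_first hD hε₀).comp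
    (f := fun t => (θ + κ * t, ζ t (θ, z₀, 0))) (s := Icc 0 T) ?_ ?_
  · exact hg.congr fun t ht => by simp [hζ.flow_eq hp hD hε₀ hθ hz₀ (hsub t ht)]
  · have : Continuous fun t => ζ t (θ, z₀, 0) := hζ.smooth.continuous.comp
      (f := fun s : ℝ => (s, ((θ, z₀, 0) : ℝ × Plane × ℝ))) (by fun_prop)
    exact (by fun_prop : Continuous fun t => (θ + κ * t, ζ t (θ, z₀, 0))).continuousOn
  · intro t ht
    exact ⟨mem_univ _, hζ.mem _ (mem_ball_triple hζ.r_pos hθ hz₀) t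
      ⟨by linarith [hζ.η_pos, ht.1], (hsub t ht).2⟩⟩

/-- Variation of constants for the derivative of the perturbed flow with respect to `ε`. -/
lemma IsArcFlow.fderiv_parameter (hζ : IsArcFlow h D κ T η r (θ₀, z₀, 0) ζ)
    (hp : IsPerturbation h F g D ε₀) (hD : IsOpen D) (hε₀ : 0 < ε₀) (hT : 0 < T)
    (hθ : |θ - θ₀| < r) :
    fderiv ℝ (ζ T) (θ, z₀, 0) (0, 0, 1) = Y F D T z₀
      (∫ t in (0 : ℝ)..T, (Y F D t z₀).inverse (g (θ + κ * t) (flow F D t z₀))) := by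
  have hz₀ : dist z₀ z₀ < r := by simpa using hζ.r_pos
  have hsub : ∀ t ∈ Icc 0 T, t ∈ Ico 0 (T + η) := fun t ht => ⟨ht.1, by linarith [ht.2, hζ.η_pos]⟩
  have hsub' : ∀ t ∈ Icc 0 T, t ∈ Ioo (-η) (T + η) := fun t ht =>
    ⟨by linarith [hζ.η_pos, ht.1], (hsub t ht).2⟩
  set f := fun t => (Y F D t z₀).inverse (g (θ + κ * t) (flow F D t z₀)) with hf
  have hfc : ContinuousOn f (Icc 0 T) := hζ.continuousOn_inverse_apply hp hD hε₀ hθ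
  set J := fun t => ∫ s in (0 : ℝ)..t, f s with hJ
  have hJd : ∀ t ∈ Icc 0 T, HasDerivWithinAt J (f t) (Icc 0 T) t := by
    intro t ht
    have : Fact (t ∈ Icc 0 T) := ⟨ht⟩
    exact intervalIntegral.integral_hasDerivWithinAt_right
      ((hfc.mono (by rw [uIcc_of_le ht.1]; exact Icc_subset_Icc_right ht.2)).intervalIntegrable)
      (hfc.stronglyMeasurableAtFilter_nhdsWithin measurableSet_Icc t) (hfc t ht)
  set M := fun t => fderiv ℝ (ζ t) (θ, z₀, 0) with hM
  set A := fun t => fderiv ℝ F (ζ t (θ, z₀, 0)) with hA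
  set W := fun t => (J t).1 • M t (0, (1, 0), 0) + (J t).2 • M t (0, (0, 1), 0) with hW
  have hlin : ∀ t, ∀ u : Plane, u.1 • M t (0, (1, 0), 0) + u.2 • M t (0, (0, 1), 0)
      = M t (0, u, 0) := by
    intro t u
    rw [← map_smul, ← map_smul, ← map_add]
    congr 1
    ext <;> simp
  have hWd : ∀ t ∈ Icc 0 T, HasDerivWithinAt W (A t (W t) + g (θ + κ * t) (ζ t (θ, z₀, 0)))
      (Icc 0 T) t := by
    intro t ht
    have d1 : HasDerivWithinAt (fun t => (J t).1) (f t).1 (Icc 0 T) t := (hJd t ht).fst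
    have d2 : HasDerivWithinAt (fun t => (J t).2) (f t).2 (Icc 0 T) t := (hJd t ht).snd
    have m1 := (hζ.hasDerivAt_variation hp hD hε₀ hθ (hsub' t ht) (1, 0) 0).hasDerivWithinAt
      (s := Icc 0 T)
    have m2 := (hζ.hasDerivAt_variation hp hD hε₀ hθ (hsub' t ht) (0, 1) 0).hasDerivWithinAt
      (s := Icc 0 T)
    have := (d1.smul m1).add (d2.smul m2)
    convert! this using 1
    have e1 : g (θ + κ * t) (ζ t (θ, z₀, 0)) =
        (f t).1 • M t (0, (1, 0), 0) + (f t).2 • M t (0, (0, 1), 0) := by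
      rw [hlin, ← hζ.flow_eq hp hD hε₀ hθ hz₀ (hsub t ht)]
      have hinv := hζ.isInvertible_Y hp hD hε₀ (hsub t ht)
      have hY := hζ.Y_eq hp hD hε₀ hθ (hsub t ht)
      have : M t (0, f t, 0) = Y F D t z₀ (f t) := by rw [hY]; rfl
      rw [this, hf]
      exact (hinv.self_apply_inverse _).symm
    rw [e1, hW]
    simp only [map_add, map_smul, zero_smul, add_zero]
    abel
  have hdiff := eqOn_zero_of_linear_ode
    (hζ.continuousOn_coefficient hp hD hε₀ hθ (hsub T (right_mem_Icc.2 hT.le)))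
    (d := fun t => M t (0, 0, 1) - W t) (fun t ht => by
      have := (hζ.hasDerivAt_variation hp hD hε₀ hθ (hsub' t ht) 0 1).hasDerivWithinAt
        (s := Icc 0 T)
      convert! this.sub (hWd t ht) using 1
      rw [one_smul, map_sub]
      abel) (Or.inl (by
      have hid : HasFDerivAt (ζ 0)
          (ContinuousLinearMap.fst ℝ Plane ℝ ∘L ContinuousLinearMap.snd ℝ ℝ (Plane × ℝ))
          (θ, z₀, 0) := by
        have : ζ 0 = fun e => e.2.1 := funext hζ.zero
        rw [this]
        exact (ContinuousLinearMap.fst ℝ Plane ℝ ∘L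
          ContinuousLinearMap.snd ℝ ℝ (Plane × ℝ)).hasFDerivAt
      simp [hM, hW, hJ, hid.fderiv])) (right_mem_Icc.2 hT.le)
  have h1 : M T (0, 0, 1) = W T := sub_eq_zero.1 hdiff
  have h2 : W T = M T (0, J T, 0) := hlin T (J T)
  rw [h2] at h1
  rw [hζ.Y_eq hp hD hε₀ hθ (hsub T (right_mem_Icc.2 hT.le))]
  exact h1

end Variation

section ReturnArc

variable {h : ℝ → Plane → ℝ → Plane} {g : ℝ → Plane → Plane} {F : Plane → Plane} {D : Set Plane}
  {κ T η r ε₀ θ₀ x₀ : ℝ} {ζ : ℝ → ℝ × Plane × ℝ → Plane}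
  {Z : ℝ → ℝ × ℝ × ℝ → Plane} {τ : ℝ × ℝ × ℝ → ℝ}

/-- The initial data `(θ, (x, 0), ε)` of the arc with parameters `q = (ε, θ, x)`. -/
def arcData (q : ℝ × ℝ × ℝ) : ℝ × Plane × ℝ := (q.2.1, (q.2.2, 0), q.1)

lemma contDiff_arcData {n : WithTop ℕ∞} : ContDiff ℝ n arcData := by
  unfold arcData
  fun_prop

lemma arcData_mem_ball {q q₀ : ℝ × ℝ × ℝ} (hq : q ∈ Metric.ball q₀ r) :
    arcData q ∈ Metric.ball (arcData q₀) r := by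
  rw [Metric.mem_ball, Prod.dist_eq, Prod.dist_eq, max_lt_iff, max_lt_iff] at hq
  have hr : 0 < r := dist_nonneg.trans_lt hq.1
  simp only [arcData, Metric.mem_ball, Prod.dist_eq, dist_self]
  exact max_lt hq.2.1 (max_lt (max_lt hq.2.2 hr) hq.1)

/-- Arcs in the lower half plane: for parameters `q = (ε, θ, x)` near `(0, θ₀, x₀)` the curve `Z · q`
solves `u'(s) = h(θ + κ s, u(s), ε)`, starts at `(x, 0)` and returns transversely to the switching
line, for the first time, after time `τ q`. -/
structure IsReturnArc (h : ℝ → Plane → ℝ → Plane) (D : Set Plane) (κ T η r θ₀ x₀ : ℝ)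
    (Z : ℝ → ℝ × ℝ × ℝ → Plane) (τ : ℝ × ℝ × ℝ → ℝ) : Prop where
  η_pos : 0 < η
  r_pos : 0 < r
  zero : ∀ q, Z 0 q = (q.2.2, 0)
  mem : ∀ q ∈ Metric.ball (0, θ₀, x₀) r, ∀ s ∈ Ioo (-η) (T + η), Z s q ∈ D
  deriv : ∀ q ∈ Metric.ball (0, θ₀, x₀) r, ∀ s ∈ Ioo (-η) (T + η),
    HasDerivAt (fun s => Z s q) (h (q.2.1 + κ * s) (Z s q) q.1) s
  τ_pos : ∀ q ∈ Metric.ball (0, θ₀, x₀) r, 0 < τ q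
  τ_lt : ∀ q ∈ Metric.ball (0, θ₀, x₀) r, τ q < T + η
  below : ∀ q ∈ Metric.ball (0, θ₀, x₀) r, ∀ s ∈ Ioo 0 (τ q), (Z s q).2 < 0
  hits : ∀ q ∈ Metric.ball (0, θ₀, x₀) r, (Z (τ q) q).2 = 0
  unique : ∀ q ∈ Metric.ball (0, θ₀, x₀) r, ∀ s ∈ Ioo 0 (T + η), (Z s q).2 = 0 → s = τ q
  down : ∀ q ∈ Metric.ball (0, θ₀, x₀) r, (h q.2.1 (q.2.2, 0) q.1).2 < 0
  up : ∀ q ∈ Metric.ball (0, θ₀, x₀) r, 0 < (h (q.2.1 + κ * τ q) (Z (τ q) q) q.1).2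
  smooth : ContDiff ℝ 2 (fun p : ℝ × (ℝ × ℝ × ℝ) => Z p.1 p.2)
  contDiffAt_τ : ContDiffAt ℝ 2 τ (0, θ₀, x₀)

lemma IsArcFlow.exists_isReturnArc (hζ : IsArcFlow h D κ T η r (θ₀, (x₀, 0), 0) ζ)
    (hp : IsPerturbation h F g D ε₀) (hD : IsOpen D) (hε₀ : 0 < ε₀) (hT : 0 < T)
    (hdown : (F (x₀, 0)).2 < 0) (hup : 0 < (F (flow F D T (x₀, 0))).2)
    (hhit : (flow F D T (x₀, 0)).2 = 0) (hbelow : ∀ t ∈ Ioo 0 T, (flow F D t (x₀, 0)).2 < 0) :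
    ∃ τ η' r', η' ≤ η ∧ r' ≤ r ∧
      IsReturnArc h D κ T η' r' θ₀ x₀ (fun s q => ζ s (arcData q)) τ := by
  set q₀ : ℝ × ℝ × ℝ := (0, θ₀, x₀) with hq₀
  have hdata : arcData q₀ = (θ₀, (x₀, 0), 0) := rfl
  set Φ : ℝ × (ℝ × ℝ × ℝ) → Plane := fun p => ζ p.1 (arcData p.2) with hΦ
  have hΦs : ContDiff ℝ 2 Φ := hζ.smooth.comp
    (contDiff_fst.prodMk (contDiff_arcData.comp contDiff_snd))
  set y : ℝ × (ℝ × ℝ × ℝ) → ℝ := fun p => (Φ p).2 with hy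
  have hys : ContDiff ℝ 2 y := contDiff_snd.comp hΦs
  set Θ : ℝ × (ℝ × ℝ × ℝ) → ℝ := fun p => fderiv ℝ y p (1, 0) with hΘ
  have hΘc : Continuous Θ := (hys.continuous_fderiv two_ne_zero).clm_apply continuous_const
  have hyd : ∀ s q, HasDerivAt (fun s => y (s, q)) (Θ (s, q)) s := fun s q =>
    (hys.differentiable two_ne_zero (s, q)).hasFDerivAt.comp_hasDerivAt (f := fun s : ℝ => (s, q)) s
      ((hasDerivAt_id s).prodMk (hasDerivAt_const s q))
  have hΘeq : ∀ q ∈ Metric.ball q₀ r, ∀ s ∈ Ioo (-η) (T + η),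
      Θ (s, q) = (h (q.2.1 + κ * s) (ζ s (arcData q)) q.1).2 := fun q hq s hs =>
    (hyd s q).unique (hζ.deriv _ (arcData_mem_ball hq) s hs).snd
  have hq₀b : q₀ ∈ Metric.ball q₀ r := Metric.mem_ball_self hζ.r_pos
  have hflow : ∀ t ∈ Ico 0 (T + η), flow F D t (x₀, 0) = ζ t (arcData q₀) := fun t ht =>
    hζ.flow_eq hp hD hε₀ (by simpa [hq₀] using hζ.r_pos) (by simpa [hq₀] using hζ.r_pos) ht
  have hbaseD : ∀ t ∈ Ioo (-η) (T + η), ζ t (arcData q₀) ∈ D := fun t ht =>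
    hζ.mem _ (arcData_mem_ball hq₀b) t ht
  have h0mem : (0 : ℝ) ∈ Ioo (-η) (T + η) := ⟨by linarith [hζ.η_pos], by linarith [hζ.η_pos]⟩
  have hTmem : T ∈ Ioo (-η) (T + η) := ⟨by linarith [hζ.η_pos], by linarith [hζ.η_pos]⟩
  have hTmem' : T ∈ Ico 0 (T + η) := ⟨hT.le, hTmem.2⟩
  have hΘ0 : Θ (0, q₀) < 0 := by
    rw [hΘeq q₀ hq₀b 0 h0mem]
    have := hp.zero (q₀.2.1 + κ * 0) _ (hbaseD 0 h0mem)
    simp only [hq₀] at this ⊢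
    rw [this, hζ.zero]
    exact hdown
  have hΘT : 0 < Θ (T, q₀) := by
    rw [hΘeq q₀ hq₀b T hTmem]
    have := hp.zero (q₀.2.1 + κ * T) _ (hbaseD T hTmem)
    simp only [hq₀] at this ⊢
    rw [this, ← hflow T hTmem']
    exact hup
  obtain ⟨a₁, ha₁, hb₁⟩ := Metric.eventually_nhds_iff_ball.1
    (hΘc.continuousAt.eventually (gt_mem_nhds hΘ0))
  obtain ⟨a₂, ha₂, hb₂⟩ := Metric.eventually_nhds_iff_ball.1
    (hΘc.continuousAt.eventually (lt_mem_nhds hΘT))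
  obtain ⟨a, ha, ha1, ha2, haη, haT⟩ : ∃ a > 0, a < a₁ ∧ a < a₂ ∧ a < η ∧ a < T / 2 := by
    have : 0 < min (min a₁ a₂) (min η (T / 2)) :=
      lt_min (lt_min ha₁ ha₂) (lt_min hζ.η_pos (by linarith))
    obtain ⟨a, h0, h1⟩ := exists_between this
    simp only [lt_min_iff] at h1
    exact ⟨a, h0, h1.1.1, h1.1.2, h1.2.1, h1.2.2⟩
  obtain ⟨η₃, hη₃, r₃, hr₃, hb₃⟩ := exists_tube (O := {p | y p < 0})
    (isOpen_lt hys.continuous continuous_const) (a := a) (b := T - a) (by linarith) (y := q₀)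
    (fun s hs => by
      change y (s, q₀) < 0
      have := hbelow s ⟨by linarith [hs.1], by linarith [hs.2]⟩
      rwa [hflow s ⟨by linarith [hs.1], by linarith [hs.2, hζ.η_pos]⟩] at this)
  set f : (ℝ × ℝ × ℝ) × ℝ → ℝ := fun v => y (v.2, v.1) with hf
  have hfs : ContDiff ℝ 2 f := hys.comp (contDiff_snd.prodMk contDiff_fst)
  have hfd : fderiv ℝ f (q₀, T) ∘L ContinuousLinearMap.inr ℝ (ℝ × ℝ × ℝ) ℝ =
      ContinuousLinearMap.toSpanSingleton ℝ (Θ (T, q₀)) := by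
    have h1 : HasFDerivAt (fun s : ℝ => f (q₀, s))
        (fderiv ℝ f (q₀, T) ∘L ContinuousLinearMap.inr ℝ (ℝ × ℝ × ℝ) ℝ) T :=
      (hfs.differentiable two_ne_zero (q₀, T)).hasFDerivAt.comp T (hasFDerivAt_prodMk_right q₀ T)
    exact h1.unique (hyd T q₀).hasFDerivAt
  have hinv : (fderiv ℝ f (q₀, T) ∘L ContinuousLinearMap.inr ℝ (ℝ × ℝ × ℝ) ℝ).IsInvertible := by
    rw [hfd]
    refine ⟨ContinuousLinearEquiv.unitsEquivAut ℝ (Units.mk0 _ hΘT.ne'), ?_⟩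
    ext
    simp
  have hcd : ContDiffAt ℝ 2 f (q₀, T) := hfs.contDiffAt
  have hτs := hcd.contDiffAt_implicitFunction two_ne_zero hinv
  have hτz := hcd.eventually_apply_implicitFunction two_ne_zero hinv
  have hτ0 := hcd.implicitFunction_apply_self two_ne_zero hinv
  set τ := hcd.implicitFunction two_ne_zero hinv
  have hfT : f (q₀, T) = 0 := by
    change (ζ T (arcData q₀)).2 = 0
    rw [← hflow T hTmem']
    exact hhit
  have hτc : ∀ᶠ q in 𝓝 q₀, |τ q - T| < a := by
    have h1 : Tendsto τ (𝓝 q₀) (𝓝 T) := by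
      have := hτs.continuousAt.tendsto
      rwa [hτ0] at this
    exact h1.eventually (Metric.ball_mem_nhds T ha)
  obtain ⟨r₄, hr₄, hb₄⟩ := Metric.eventually_nhds_iff_ball.1 (hτz.and hτc)
  set r' := min (min r a) (min r₃ r₄) with hr'
  have hr'0 : 0 < r' := lt_min (lt_min hζ.r_pos ha) (lt_min hr₃ hr₄)
  have hsub : ∀ q ∈ Metric.ball q₀ r', q ∈ Metric.ball q₀ r ∧ dist q q₀ < a ∧
      q ∈ Metric.ball q₀ r₃ ∧ q ∈ Metric.ball q₀ r₄ := by
    intro q hq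
    rw [Metric.mem_ball, hr', lt_min_iff, lt_min_iff, lt_min_iff] at hq
    exact ⟨hq.1.1, hq.1.2, hq.2.1, hq.2.2⟩
  have hneg : ∀ q ∈ Metric.ball q₀ r', ∀ s, |s| ≤ a → Θ (s, q) < 0 := by
    intro q hq s hs
    refine hb₁ _ ?_
    rw [Metric.mem_ball, Prod.dist_eq, max_lt_iff, Real.dist_eq, sub_zero]
    exact ⟨hs.trans_lt ha1, (hsub q hq).2.1.trans ha1⟩
  have hpos : ∀ q ∈ Metric.ball q₀ r', ∀ s, |s - T| ≤ a → 0 < Θ (s, q) := by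
    intro q hq s hs
    refine hb₂ _ ?_
    rw [Metric.mem_ball, Prod.dist_eq, max_lt_iff, Real.dist_eq]
    exact ⟨hs.trans_lt ha2, (hsub q hq).2.1.trans ha2⟩
  have hanti : ∀ q ∈ Metric.ball q₀ r', StrictAntiOn (fun s => y (s, q)) (Icc 0 a) := by
    intro q hq
    refine strictAntiOn_of_deriv_neg (convex_Icc 0 a)
      (fun s _ => (hyd s q).continuousAt.continuousWithinAt) fun s hs => ?_
    rw [interior_Icc] at hs
    rw [(hyd s q).deriv]
    exact hneg q hq s (by rw [abs_of_pos hs.1]; exact hs.2.le)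
  have hmono : ∀ q ∈ Metric.ball q₀ r', StrictMonoOn (fun s => y (s, q)) (Icc (T - a) (T + a)) := by
    intro q hq
    refine strictMonoOn_of_deriv_pos (convex_Icc _ _)
      (fun s _ => (hyd s q).continuousAt.continuousWithinAt) fun s hs => ?_
    rw [interior_Icc] at hs
    rw [(hyd s q).deriv]
    exact hpos q hq s (abs_le.2 ⟨by linarith [hs.1], by linarith [hs.2]⟩)
  have hτmem : ∀ q ∈ Metric.ball q₀ r', τ q ∈ Ioo (T - a) (T + a) := by
    intro q hq
    have := abs_lt.1 (hb₄ q (hsub q hq).2.2.2).2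
    exact ⟨by linarith [this.1], by linarith [this.2]⟩
  have hτhit : ∀ q ∈ Metric.ball q₀ r', y (τ q, q) = 0 := fun q hq =>
    ((hb₄ q (hsub q hq).2.2.2).1).trans hfT
  have hy0 : ∀ q, y (0, q) = 0 := by
    intro q
    simp only [hy, hΦ, hζ.zero]
    rfl
  have hearly : ∀ q ∈ Metric.ball q₀ r', ∀ s ∈ Ioc 0 (T - a), y (s, q) < 0 := by
    intro q hq s hs
    rcases le_total s a with h1 | h1
    · have := hanti q hq (left_mem_Icc.2 ha.le) ⟨hs.1.le, h1⟩ hs.1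
      simp only [hy0] at this
      exact this
    · exact hb₃ s ⟨by linarith, by linarith [hs.2]⟩ q (hsub q hq).2.2.1
  refine ⟨τ, a, r', haη.le, (min_le_left _ _).trans (min_le_left _ _), ⟨ha, hr'0, ?_, ?_, ?_, ?_,
    ?_, ?_, ?_, ?_, ?_, ?_, hΦs, hτs⟩⟩
  · intro q; simp only [hζ.zero]; rfl
  · intro q hq s hs
    exact hζ.mem _ (arcData_mem_ball (hsub q hq).1) s ⟨by linarith [hs.1], by linarith [hs.2]⟩
  · intro q hq s hs
    exact hζ.deriv _ (arcData_mem_ball (hsub q hq).1) s ⟨by linarith [hs.1], by linarith [hs.2]⟩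
  · intro q hq; linarith [(hτmem q hq).1]
  · intro q hq; exact (hτmem q hq).2
  · intro q hq s hs
    rcases le_total s (T - a) with h1 | h1
    · exact hearly q hq s ⟨hs.1, h1⟩
    · have := hmono q hq ⟨h1, hs.2.le.trans (hτmem q hq).2.le⟩ (Ioo_subset_Icc_self (hτmem q hq)) hs.2
      simp only [hτhit q hq] at this
      exact this
  · exact hτhit
  · intro q hq s hs hs0
    rcases le_total s (T - a) with h1 | h1
    · exact absurd hs0 (hearly q hq s ⟨hs.1, h1⟩).ne
    · exact (hmono q hq).injOn ⟨h1, hs.2.le⟩ (Ioo_subset_Icc_self (hτmem q hq))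
        (hs0.trans (hτhit q hq).symm)
  · intro q hq
    have h1 := hneg q hq 0 (by simpa using ha.le)
    rw [hΘeq q (hsub q hq).1 0 h0mem, hζ.zero, mul_zero, add_zero] at h1
    exact h1
  · intro q hq
    have h2 := hτmem q hq
    have h1 := hpos q hq (τ q) (abs_le.2 ⟨by linarith [h2.1], by linarith [h2.2]⟩)
    rwa [hΘeq q (hsub q hq).1 (τ q) ⟨by linarith [h2.1, hζ.η_pos], by linarith [h2.2]⟩] at h1

/-- The position at which the arc returns to the switching line. -/
def exitPoint (Z : ℝ → ℝ × ℝ × ℝ → Plane) (τ : ℝ × ℝ × ℝ → ℝ) (q : ℝ × ℝ × ℝ) : ℝ := (Z (τ q) q).1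

lemma IsReturnArc.contDiffAt_exitPoint (hZ : IsReturnArc h D κ T η r θ₀ x₀ Z τ) :
    ContDiffAt ℝ 2 (exitPoint Z τ) (0, θ₀, x₀) :=
  contDiffAt_fst.comp _ (hZ.smooth.contDiffAt.comp (f := fun q => (τ q, q)) _
    (hZ.contDiffAt_τ.prodMk contDiffAt_id))

lemma IsReturnArc.isSolutionCurve (hZ : IsReturnArc h D κ T η r θ₀ x₀ Z τ)
    (hp : IsPerturbation h F g D ε₀) {θ x t : ℝ}
    (hq : ((0, θ, x) : ℝ × ℝ × ℝ) ∈ Metric.ball (0, θ₀, x₀) r) (ht : t ∈ Ico 0 (T + η)) :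
    IsSolutionCurve F D (x, 0) t (fun s => Z s (0, θ, x)) := by
  refine ⟨hZ.zero _, fun s hs => ?_⟩
  rw [uIcc_of_le ht.1] at hs ⊢
  have hs' : s ∈ Ioo (-η) (T + η) := ⟨by linarith [hZ.η_pos, hs.1], hs.2.trans_lt ht.2⟩
  have hD := hZ.mem _ hq s hs'
  refine ⟨hD, ?_⟩
  have := (hZ.deriv _ hq s hs').hasDerivWithinAt (s := Icc 0 t)
  rwa [hp.zero _ _ hD] at this

lemma IsReturnArc.flow_eq (hZ : IsReturnArc h D κ T η r θ₀ x₀ Z τ)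
    (hp : IsPerturbation h F g D ε₀) (hD : IsOpen D) (hε₀ : 0 < ε₀) {θ x t : ℝ}
    (hq : ((0, θ, x) : ℝ × ℝ × ℝ) ∈ Metric.ball (0, θ₀, x₀) r) (ht : t ∈ Ico 0 (T + η)) :
    flow F D t (x, 0) = Z t (0, θ, x) :=
  flow_eq_of_isSolutionCurve hD ((hp.contDiffOn_field hε₀).of_le one_le_two)
    (hZ.isSolutionCurve hp hq ht) (right_mem_Icc.2 ht.1)

/-- For `ε = 0` the return time of the arc is the half-return time. -/
lemma IsReturnArc.τ_eq (hZ : IsReturnArc h D κ T η r θ₀ x₀ Z τ)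
    (hp : IsPerturbation h F g D ε₀) (hD : IsOpen D) (hε₀ : 0 < ε₀) {θ x : ℝ}
    (hq : ((0, θ, x) : ℝ × ℝ × ℝ) ∈ Metric.ball (0, θ₀, x₀) r) :
    τ (0, θ, x) = halfReturnTime F D x := by
  have hτ := hZ.τ_pos _ hq
  have hτ' := hZ.τ_lt _ hq
  symm
  refine IsLeast.csInf_eq ⟨⟨hτ, ⟨_, hZ.isSolutionCurve hp hq ⟨hτ.le, hτ'⟩⟩, ?_⟩, ?_⟩
  · rw [hZ.flow_eq hp hD hε₀ hq ⟨hτ.le, hτ'⟩]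
    exact hZ.hits _ hq
  · rintro t ⟨ht0, -, ht⟩
    by_contra! hlt
    rw [hZ.flow_eq hp hD hε₀ hq ⟨ht0.le, hlt.trans hτ'⟩] at ht
    exact (hZ.below _ hq t ⟨ht0, hlt⟩).ne ht

lemma IsReturnArc.exitPoint_eq (hZ : IsReturnArc h D κ T η r θ₀ x₀ Z τ)
    (hp : IsPerturbation h F g D ε₀) (hD : IsOpen D) (hε₀ : 0 < ε₀) {θ x : ℝ}
    (hq : ((0, θ, x) : ℝ × ℝ × ℝ) ∈ Metric.ball (0, θ₀, x₀) r) :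
    exitPoint Z τ (0, θ, x) = (flow F D (halfReturnTime F D x) (x, 0)).1 := by
  have h1 := hZ.τ_eq hp hD hε₀ hq
  rw [exitPoint, h1, hZ.flow_eq hp hD hε₀ hq ⟨?_, ?_⟩]
  · rw [← h1]; exact (hZ.τ_pos _ hq).le
  · rw [← h1]; exact hZ.τ_lt _ hq

/-- First order expansion of the exit point in `ε`. -/
lemma IsReturnArc.fderiv_exitPoint
    (hZ : IsReturnArc h D κ T η r θ₀ x₀ (fun s q => ζ s (arcData q)) τ) {η' r' : ℝ}
    (hζ : IsArcFlow h D κ T η' r' (θ₀, (x₀, 0), 0) ζ) (hr : r ≤ r')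
    (hp : IsPerturbation h F g D ε₀) (hD : IsOpen D) (hε₀ : 0 < ε₀) (hT : 0 < T)
    (hTx : halfReturnTime F D x₀ = T) :
    ∀ᶠ θ in 𝓝 θ₀, fderiv ℝ (exitPoint (fun s q => ζ s (arcData q)) τ) (0, θ, x₀) (1, 0, 0) =
      -wedge (F (flow F D T (x₀, 0))) (Y F D T (x₀, 0)
        (∫ t in (0 : ℝ)..T, (Y F D t (x₀, 0)).inverse (g (θ + κ * t) (flow F D t (x₀, 0)))))
        / (F (flow F D T (x₀, 0))).2 := by
  have hcd : ∀ᶠ θ in 𝓝 θ₀, ContDiffAt ℝ 2 τ (0, θ, x₀) :=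
    ((by fun_prop : Continuous fun θ : ℝ => ((0, θ, x₀) : ℝ × ℝ × ℝ)).tendsto θ₀).eventually
      (hZ.contDiffAt_τ.eventually (by simp))
  filter_upwards [hcd, Metric.ball_mem_nhds θ₀ hZ.r_pos] with θ hθs hθ
  set q : ℝ × ℝ × ℝ := (0, θ, x₀) with hq
  have hqb : q ∈ Metric.ball ((0, θ₀, x₀) : ℝ × ℝ × ℝ) r := by
    rw [Metric.mem_ball, Prod.dist_eq, Prod.dist_eq, max_lt_iff, max_lt_iff]
    exact ⟨by simpa [hq] using hZ.r_pos, hθ, by simpa [hq] using hZ.r_pos⟩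
  have hτq : τ q = T := by rw [hq, hZ.τ_eq hp hD hε₀ hqb, hTx]
  set Φ : ℝ × (ℝ × ℝ × ℝ) → Plane := fun p => ζ p.1 (arcData p.2) with hΦ
  have hTη : T ∈ Ico 0 (T + η) := ⟨hT.le, by linarith [hZ.η_pos]⟩
  have hflow := hZ.flow_eq hp hD hε₀ hqb hTη
  have hΦd := (hZ.smooth.differentiable two_ne_zero (T, q)).hasFDerivAt
  have hG : HasFDerivAt (fun q => Φ (τ q, q)) (fderiv ℝ Φ (T, q) ∘L
      ((fderiv ℝ τ q).prod (ContinuousLinearMap.id ℝ _))) q :=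
    HasFDerivAt.comp (g := Φ) (g' := fderiv ℝ Φ (T, q)) (f := fun q => (τ q, q)) q
      (by rw [hτq]; exact hΦd)
      ((hθs.differentiableAt two_ne_zero).hasFDerivAt.prodMk (hasFDerivAt_id q))
  have h1 : fderiv ℝ Φ (T, q) (1, 0) = F (flow F D T (x₀, 0)) := by
    have ha : HasDerivAt (fun s => Φ (s, q)) (fderiv ℝ Φ (T, q) (1, 0)) T :=
      hΦd.comp_hasDerivAt (f := fun s : ℝ => (s, q)) T
        ((hasDerivAt_id T).prodMk (hasDerivAt_const T q))
    have hTm : T ∈ Ioo (-η) (T + η) := ⟨by linarith [hZ.η_pos], hTη.2⟩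
    have hb := hZ.deriv q hqb T hTm
    rw [ha.unique hb, hflow]
    exact hp.zero _ _ (hZ.mem q hqb T hTm)
  set v := Y F D T (x₀, 0)
    (∫ t in (0 : ℝ)..T, (Y F D t (x₀, 0)).inverse (g (θ + κ * t) (flow F D t (x₀, 0)))) with hv
  have h2 : fderiv ℝ Φ (T, q) (0, (1, 0, 0)) = v := by
    rw [hv, ← hζ.fderiv_parameter hp hD hε₀ hT (lt_of_lt_of_le hθ hr)]
    have ha : HasDerivAt (fun ε : ℝ => Φ (T, (ε, θ, x₀))) (fderiv ℝ Φ (T, q) (0, (1, 0, 0))) 0 :=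
      HasFDerivAt.comp_hasDerivAt (f := fun ε : ℝ => (T, ((ε, θ, x₀) : ℝ × ℝ × ℝ))) 0 hΦd
        ((hasDerivAt_const _ _).prodMk ((hasDerivAt_id _).prodMk (hasDerivAt_const _ _)))
    have hb : HasDerivAt (fun ε : ℝ => ζ T (θ, (x₀, 0), ε))
        (fderiv ℝ (ζ T) (θ, (x₀, 0), 0) (0, 0, 1)) 0 :=
      HasFDerivAt.comp_hasDerivAt (f := fun ε : ℝ => ((θ, (x₀, 0), ε) : ℝ × Plane × ℝ)) 0
        (hζ.fderiv_slice T (θ, (x₀, 0), 0)).differentiableAt.hasFDerivAt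
        ((hasDerivAt_const _ _).prodMk ((hasDerivAt_const _ _).prodMk (hasDerivAt_id _)))
    exact ha.unique hb
  set d := fderiv ℝ τ q (1, 0, 0)
  have h3 : (fderiv ℝ Φ (T, q) ∘L ((fderiv ℝ τ q).prod (ContinuousLinearMap.id ℝ _))) (1, 0, 0) =
      d • F (flow F D T (x₀, 0)) + v := by
    rw [← h1, ← h2, ← map_smul, ← map_add]
    simp only [ContinuousLinearMap.comp_apply, ContinuousLinearMap.prod_apply,
      ContinuousLinearMap.id_apply]
    congr 1
    simp [d]
  have h4 : fderiv ℝ (exitPoint (fun s q => ζ s (arcData q)) τ) q (1, 0, 0) =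
      d * (F (flow F D T (x₀, 0))).1 + v.1 := by
    have : HasFDerivAt (exitPoint (fun s q => ζ s (arcData q)) τ) _ q := hG.fst
    rw [this.fderiv, ContinuousLinearMap.comp_apply, h3]
    simp
  have h5 : d * (F (flow F D T (x₀, 0))).2 + v.2 = 0 := by
    have ha : HasFDerivAt (fun q => (Φ (τ q, q)).2) _ q := hG.snd
    have hb : HasFDerivAt (fun q => (Φ (τ q, q)).2) 0 q :=
      (hasFDerivAt_const (𝕜 := ℝ) (0 : ℝ) q).congr_of_eventuallyEq (by
        filter_upwards [Metric.isOpen_ball.mem_nhds hqb] with p hp using hZ.hits p hp)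
    have := congrArg (fun A : ℝ × ℝ × ℝ →L[ℝ] ℝ => A (1, 0, 0)) (ha.unique hb)
    rw [ContinuousLinearMap.comp_apply, h3] at this
    simpa using this
  have hF2 : (F (flow F D T (x₀, 0))).2 ≠ 0 := by
    have := hZ.up q hqb
    rw [hτq] at this
    have hTm : T ∈ Ioo (-η) (T + η) := ⟨by linarith [hZ.η_pos], hTη.2⟩
    rw [hflow]
    have hz := hp.zero (q.2.1 + κ * T) _ (hZ.mem q hqb T hTm)
    rw [← hz]
    exact this.ne'
  rw [h4, wedge, eq_div_iff hF2]
  linear_combination (F (flow F D T (x₀, 0))).1 * h5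

end ReturnArc

section Filippov

variable {Xp Xm A B X : ℝ → Plane → Plane} {D : Set Plane} {u w : ℝ → Plane}
  {a b e K m : ℝ}

/-- `u` is an absolutely continuous solution of the Filippov inclusion of `(Xp, Xm)`. -/
def IsFilippovCurve (Xp Xm : ℝ → Plane → Plane) (u : ℝ → Plane) : Prop :=
  ∃ v : ℝ → Plane, (∀ a b : ℝ, IntervalIntegrable v volume a b) ∧
    (∀ a b : ℝ, u b - u a = ∫ t in a..b, v t) ∧
    ∀ᵐ t : ℝ, v t ∈ filippovSet Xp Xm t (u t)

lemma filippovSet_subset {S : Set Plane} (hS : Convex ℝ S) {t : ℝ} {z : Plane} (hp : Xp t z ∈ S)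
    (hm : Xm t z ∈ S) : filippovSet Xp Xm t z ⊆ S := by
  rintro v (⟨-, rfl⟩ | ⟨-, rfl⟩ | ⟨-, hv⟩)
  exacts [hp, hm, hS.segment_subset hp hm hv]

lemma IsFilippovCurve.continuous (hu : IsFilippovCurve Xp Xm u) : Continuous u := by
  obtain ⟨v, hv, hint, -⟩ := hu
  have : u = fun t => u 0 + ∫ s in (0 : ℝ)..t, v s := by
    funext t
    rw [← hint 0 t]
    abel
  rw [this]
  exact continuous_const.add (intervalIntegral.continuous_primitive hv 0)

lemma IsFilippovCurve.dist_le (hu : IsFilippovCurve Xp Xm u) (hab : a ≤ b)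
    (hK : ∀ t ∈ Icc a b, ‖Xp t (u t)‖ ≤ K ∧ ‖Xm t (u t)‖ ≤ K) :
    dist (u a) (u b) ≤ K * (b - a) := by
  obtain ⟨v, hv, hint, hae⟩ := hu
  rw [dist_comm, dist_eq_norm, hint]
  have hle : ∀ᵐ t, t ∈ uIoc a b → ‖v t‖ ≤ K := by
    filter_upwards [hae] with t ht htab
    rw [uIoc_of_le hab] at htab
    have h1 := hK t (Ioc_subset_Icc_self htab)
    have := filippovSet_subset (convex_closedBall (0 : Plane) K) (by simpa using h1.1)
      (by simpa using h1.2) ht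
    simpa using this
  have := intervalIntegral.norm_integral_le_of_norm_le_const_ae hle
  rwa [abs_of_nonneg (sub_nonneg.2 hab)] at this

lemma IsFilippovCurve.mul_sub_le (hu : IsFilippovCurve Xp Xm u) (hab : a ≤ b)
    (hm : ∀ t ∈ Icc a b, m ≤ e * (Xp t (u t)).2 ∧ m ≤ e * (Xm t (u t)).2) :
    m * (b - a) ≤ e * (u b).2 - e * (u a).2 := by
  obtain ⟨v, hv, hint, hae⟩ := hu
  have hconv : Convex ℝ {z : Plane | m ≤ e * z.2} := by
    have : IsLinearMap ℝ (fun z : Plane => e * z.2) :=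
      ⟨fun x y => by simp [mul_add], fun c x => by simp; ring⟩
    exact convex_halfSpace_ge this m
  have hsnd : ∫ t in a..b, (v t).2 = (u b).2 - (u a).2 := by
    have h1 := (ContinuousLinearMap.snd ℝ ℝ ℝ).intervalIntegral_comp_comm (hv a b)
    rw [← hint] at h1
    exact h1
  have hi : IntervalIntegrable (fun t => e * (v t).2) volume a b := by
    have : IntervalIntegrable (fun t => (v t).2) volume a b :=
      ⟨(ContinuousLinearMap.snd ℝ ℝ ℝ).integrable_comp (hv a b).1,
        (ContinuousLinearMap.snd ℝ ℝ ℝ).integrable_comp (hv a b).2⟩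
    exact this.const_mul e
  have hle := intervalIntegral.integral_mono_ae_restrict hab (intervalIntegrable_const (c := m)) hi
    (by
      rw [EventuallyLE, ae_restrict_iff' measurableSet_Icc]
      filter_upwards [hae] with t ht htab
      have h1 := hm t htab
      exact filippovSet_subset hconv h1.1 h1.2 ht)
  rw [intervalIntegral.integral_const_mul, hsnd, intervalIntegral.integral_const, smul_eq_mul] at hle
  linarith

lemma hasDerivWithinAt_of_integral {v f : ℝ → Plane} (hint : ∀ a b : ℝ, u b - u a = ∫ t in a..b, v t)
    (hae : ∀ᵐ t : ℝ, t ∈ Ioo a b → v t = f t) (hf : ContinuousOn f (Icc a b)) :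
    ∀ t ∈ Icc a b, HasDerivWithinAt u (f t) (Icc a b) t := by
  intro t ht
  have : Fact (t ∈ Icc a b) := ⟨ht⟩
  have h1 : HasDerivWithinAt (fun t => ∫ s in a..t, f s) (f t) (Icc a b) t :=
    intervalIntegral.integral_hasDerivWithinAt_right
      ((hf.mono (by rw [uIcc_of_le ht.1]; exact Icc_subset_Icc_right ht.2)).intervalIntegrable)
      (hf.stronglyMeasurableAtFilter_nhdsWithin measurableSet_Icc t) (hf t ht)
  have h2 : ∀ s ∈ Icc a b, u s = u a + ∫ r in a..s, f r := by
    intro s hs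
    have : ∫ r in a..s, v r = ∫ r in a..s, f r := by
      refine intervalIntegral.integral_congr_ae ?_
      have hb : ∀ᵐ r : ℝ, r ≠ b := by
        simp [ae_iff]
      filter_upwards [hae, hb] with r hr hrb hrs
      rw [uIoc_of_le hs.1] at hrs
      exact hr ⟨hrs.1, lt_of_le_of_ne (hrs.2.trans hs.2) hrb⟩
    rw [← this, ← hint]
    abel
  exact (h1.const_add (u a)).congr h2 (h2 t ht)

lemma continuousOn_field_comp (hX : ContDiffOn ℝ 1 (fun p : ℝ × Plane => X p.1 p.2) (univ ×ˢ D))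
    (hu : Continuous u) (huD : ∀ t ∈ Icc a b, u t ∈ D) :
    ContinuousOn (fun t => X t (u t)) (Icc a b) :=
  hX.continuousOn.comp (f := fun t => (t, u t)) (by fun_prop) fun t ht => ⟨mem_univ _, huD t ht⟩

lemma IsFilippovCurve.hasDerivWithinAt_lower (hu : IsFilippovCurve Xp Xm u)
    (hX : ContDiffOn ℝ 1 (fun p : ℝ × Plane => Xm p.1 p.2) (univ ×ˢ D))
    (huD : ∀ t ∈ Icc a b, u t ∈ D) (hneg : ∀ t ∈ Ioo a b, (u t).2 < 0) :
    ∀ t ∈ Icc a b, HasDerivWithinAt u (Xm t (u t)) (Icc a b) t := by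
  have hc := hu.continuous
  obtain ⟨v, -, hint, hae⟩ := hu
  refine hasDerivWithinAt_of_integral hint ?_ (continuousOn_field_comp hX hc huD)
  filter_upwards [hae] with t ht htab
  have := hneg t htab
  rcases ht with ⟨h, -⟩ | ⟨-, h⟩ | ⟨h, -⟩
  exacts [absurd h this.not_gt, h, absurd h this.ne]

lemma IsFilippovCurve.hasDerivWithinAt_upper (hu : IsFilippovCurve Xp Xm u)
    (hX : ContDiffOn ℝ 1 (fun p : ℝ × Plane => Xp p.1 p.2) (univ ×ˢ D))
    (huD : ∀ t ∈ Icc a b, u t ∈ D) (hpos : ∀ t ∈ Ioo a b, 0 < (u t).2) :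
    ∀ t ∈ Icc a b, HasDerivWithinAt u (Xp t (u t)) (Icc a b) t := by
  have hc := hu.continuous
  obtain ⟨v, -, hint, hae⟩ := hu
  refine hasDerivWithinAt_of_integral hint ?_ (continuousOn_field_comp hX hc huD)
  filter_upwards [hae] with t ht htab
  have := hpos t htab
  rcases ht with ⟨-, h⟩ | ⟨h, -⟩ | ⟨h, -⟩
  exacts [h, absurd h this.not_gt, absurd h this.ne']

/-- A curve that starts well inside a ball in which the fields are bounded stays inside for a
short time. -/
lemma IsFilippovCurve.mem_ball (hu : IsFilippovCurve Xp Xm u) {z₀ : Plane} {ρ : ℝ}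
    (hK : ∀ t ∈ Icc a b, ∀ z ∈ Metric.ball z₀ ρ, ‖Xp t z‖ ≤ K ∧ ‖Xm t z‖ ≤ K)
    (hK0 : 0 ≤ K) (hstart : dist (u a) z₀ + K * (b - a) < ρ) :
    ∀ t ∈ Icc a b, u t ∈ Metric.ball z₀ ρ := by
  have hc := hu.continuous
  have key : Icc a b ⊆ {t | dist (u a) (u t) ≤ K * (t - a)} := by
    refine IsClosed.Icc_subset_of_forall_exists_gt ?_ (by simp) ?_
    · exact (isClosed_le (continuous_const.dist hc) (by fun_prop)).inter isClosed_Icc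
    · rintro x ⟨hx, hxab⟩ y hy
      have hxb : dist (u x) z₀ < ρ := by
        have h1 := dist_triangle_left (u x) z₀ (u a)
        have h2 : K * (x - a) ≤ K * (b - a) :=
          mul_le_mul_of_nonneg_left (by linarith [hxab.2]) hK0
        rw [mem_ofPred_eq] at hx
        linarith
      have hev : ∀ᶠ t in 𝓝 x, u t ∈ Metric.ball z₀ ρ :=
        hc.continuousAt.eventually (Metric.isOpen_ball.mem_nhds hxb)
      obtain ⟨δ, hδ, hball⟩ := Metric.eventually_nhds_iff_ball.1 hev
      set t := min (x + δ / 2) (min y b) with ht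
      have hxt : x < t := lt_min (by linarith) (lt_min hy hxab.2)
      refine ⟨t, ?_, hxt, (min_le_right _ _).trans (min_le_left _ _)⟩
      have htb : t ≤ b := (min_le_right _ _).trans (min_le_right _ _)
      have h1 : dist (u x) (u t) ≤ K * (t - x) := by
        refine hu.dist_le hxt.le fun s hs => hK s ⟨hxab.1.trans hs.1, hs.2.trans htb⟩ _ (hball s ?_)
        rw [Metric.mem_ball, Real.dist_eq, abs_of_nonneg (by linarith [hs.1])]
        have : t ≤ x + δ / 2 := min_le_left _ _
        linarith [hs.2]
      have h2 := dist_triangle (u a) (u x) (u t)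
      rw [mem_ofPred_eq] at hx ⊢
      linarith
  intro t ht
  have h1 := key ht
  have h2 := dist_triangle_left (u t) z₀ (u a)
  have h3 : K * (t - a) ≤ K * (b - a) := mul_le_mul_of_nonneg_left (by linarith [ht.2]) hK0
  rw [mem_ofPred_eq] at h1
  rw [Metric.mem_ball]
  linarith

lemma dist_le_of_solutions {S : Set Plane} {L : ℝ≥0}
    (hL : ∀ t ∈ Icc a b, LipschitzOnWith L (X t) S)
    (hu : ∀ t ∈ Icc a b, HasDerivWithinAt u (X t (u t)) (Icc a b) t) (huS : ∀ t ∈ Icc a b, u t ∈ S)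
    (hw : ∀ t ∈ Icc a b, HasDerivWithinAt w (X t (w t)) (Icc a b) t) (hwS : ∀ t ∈ Icc a b, w t ∈ S) :
    ∀ t ∈ Icc a b, dist (u t) (w t) ≤ dist (u a) (w a) * Real.exp (L * (t - a)) :=
  dist_le_of_trajectories_ODE_of_mem (v := X) (s := fun _ => S)
    (fun t ht => hL t (Ico_subset_Icc_self ht)) (fun t ht => (hu t ht).continuousWithinAt)
    (fun t ht => (hu t (Ico_subset_Icc_self ht)).mono_of_mem_nhdsWithin (Icc_mem_nhdsGE_of_mem ht))
    (fun t ht => huS t (Ico_subset_Icc_self ht)) (fun t ht => (hw t ht).continuousWithinAt)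
    (fun t ht => (hw t (Ico_subset_Icc_self ht)).mono_of_mem_nhdsWithin (Icc_mem_nhdsGE_of_mem ht))
    (fun t ht => hwS t (Ico_subset_Icc_self ht)) le_rfl

/-- During `[a, b]` the curve `u` moves transversely to the switching line, with `e y` increasing at
rate at least `m`; it solves `u' = A(t, u)` while `e y < 0` and `u' = B(t, u)` while `e y > 0`. -/
structure IsTransit (A B : ℝ → Plane → Plane) (e K m a b : ℝ) (u : ℝ → Plane) : Prop where
  continuous : Continuous u
  mono : ∀ s ∈ Icc a b, ∀ t ∈ Icc a b, s ≤ t → m * (t - s) ≤ e * (u t).2 - e * (u s).2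
  lip : ∀ s ∈ Icc a b, ∀ t ∈ Icc a b, s ≤ t → dist (u s) (u t) ≤ K * (t - s)
  before : ∀ a' b', a ≤ a' → b' ≤ b → (∀ t ∈ Ioo a' b', e * (u t).2 < 0) →
    ∀ t ∈ Icc a' b', HasDerivWithinAt u (A t (u t)) (Icc a' b') t
  after : ∀ a' b', a ≤ a' → b' ≤ b → (∀ t ∈ Ioo a' b', 0 < e * (u t).2) →
    ∀ t ∈ Icc a' b', HasDerivWithinAt u (B t (u t)) (Icc a' b') t

lemma IsTransit.exists_switch (hu : IsTransit A B e K m a b u) (hm : 0 < m) (hab : a ≤ b) :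
    ∃ c ∈ Icc a b, (∀ t ∈ Ico a c, e * (u t).2 < 0) ∧ (∀ t ∈ Ioc c b, 0 < e * (u t).2) ∧
      (c < b → 0 ≤ e * (u c).2) ∧ (a < c → e * (u c).2 ≤ 0) := by
  have hmono : ∀ s ∈ Icc a b, ∀ t ∈ Icc a b, s < t → e * (u s).2 < e * (u t).2 := by
    intro s hs t ht hst
    have := hu.mono s hs t ht hst.le
    nlinarith [mul_pos hm (sub_pos.2 hst)]
  have hzero : ∀ c ∈ Icc a b, e * (u c).2 = 0 → (∀ t ∈ Ico a c, e * (u t).2 < 0) ∧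
      (∀ t ∈ Ioc c b, 0 < e * (u t).2) := fun c hc h0 =>
    ⟨fun t ht => h0 ▸ hmono t ⟨ht.1, ht.2.le.trans hc.2⟩ c hc ht.2,
      fun t ht => h0 ▸ hmono c hc t ⟨hc.1.trans ht.1.le, ht.2⟩ ht.1⟩
  rcases le_or_gt 0 (e * (u a).2) with ha | ha
  · refine ⟨a, left_mem_Icc.2 hab, by simp, fun t ht => ?_, fun _ => ha, fun h => absurd h (lt_irrefl _)⟩
    exact ha.trans_lt (hmono a (left_mem_Icc.2 hab) t (Ioc_subset_Icc_self ht) ht.1)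
  rcases le_or_gt (e * (u b).2) 0 with hb | hb
  · refine ⟨b, right_mem_Icc.2 hab, fun t ht => ?_, by simp, fun h => absurd h (lt_irrefl _), fun _ => hb⟩
    exact (hmono t (Ico_subset_Icc_self ht) b (right_mem_Icc.2 hab) ht.2).trans_le hb
  · have hc : ContinuousOn (fun t => e * (u t).2) (Icc a b) :=
      (continuous_const.mul (continuous_snd.comp hu.continuous)).continuousOn
    obtain ⟨c, hc, h0⟩ := intermediate_value_Icc hab hc ⟨ha.le, hb.le⟩
    exact ⟨c, hc, (hzero c hc h0).1, (hzero c hc h0).2, fun _ => h0.ge, fun _ => h0.le⟩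

lemma IsTransit.dist_le_of_switch_le {S : Set Plane} {L : ℝ≥0}
    (hu : IsTransit A B e K m a b u) (hw : IsTransit A B e K m a b w) (hm : 0 < m) (hK : 0 ≤ K)
    (he : |e| = 1)
    (hLA : ∀ t ∈ Icc a b, LipschitzOnWith L (A t) S) (hLB : ∀ t ∈ Icc a b, LipschitzOnWith L (B t) S)
    (huS : ∀ t ∈ Icc a b, u t ∈ S) (hwS : ∀ t ∈ Icc a b, w t ∈ S) {c d : ℝ} (hc : c ∈ Icc a b)
    (hd : d ∈ Icc a b) (hcd : c ≤ d)
    (hu1 : ∀ t ∈ Ico a c, e * (u t).2 < 0) (hu2 : ∀ t ∈ Ioc c b, 0 < e * (u t).2)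
    (hu3 : c < b → 0 ≤ e * (u c).2)
    (hw1 : ∀ t ∈ Ico a d, e * (w t).2 < 0) (hw2 : ∀ t ∈ Ioc d b, 0 < e * (w t).2)
    (hw3 : a < d → e * (w d).2 ≤ 0) :
    ∀ t ∈ Icc a b, dist (u t) (w t) ≤
      Real.exp (L * (b - a)) * (1 + 2 * K / m) * Real.exp (L * (b - a)) * dist (u a) (w a) := by
  set E := Real.exp (L * (b - a)) with hE
  have hE1 : 1 ≤ E := Real.one_le_exp (mul_nonneg L.2 (by linarith [hc.1, hc.2]))
  have hexp : ∀ s t, a ≤ s → s ≤ t → t ≤ b → Real.exp (L * (t - s)) ≤ E := fun s t h1 h2 h3 =>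
    Real.exp_le_exp.2 (mul_le_mul_of_nonneg_left (by linarith) L.2)
  have hQ : 1 ≤ 1 + 2 * K / m := le_add_of_nonneg_right (by positivity)
  have s1 : ∀ t ∈ Icc a c, dist (u t) (w t) ≤ E * dist (u a) (w a) := by
    intro t ht
    have hsub : ∀ t ∈ Icc a c, t ∈ Icc a b := fun t ht => ⟨ht.1, ht.2.trans hc.2⟩
    have := dist_le_of_solutions (fun t ht => hLA t (hsub t ht))
      (hu.before a c le_rfl hc.2 fun t ht => hu1 t ⟨ht.1.le, ht.2⟩) (fun t ht => huS t (hsub t ht))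
      (hw.before a c le_rfl hc.2 fun t ht => hw1 t ⟨ht.1.le, ht.2.trans_le hcd⟩)
      (fun t ht => hwS t (hsub t ht)) t ht
    refine this.trans ?_
    rw [mul_comm]
    exact mul_le_mul_of_nonneg_right (hexp a t le_rfl ht.1 (ht.2.trans hc.2)) dist_nonneg
  have hgap : m * (d - c) ≤ dist (u c) (w c) := by
    rcases hcd.eq_or_lt with rfl | hlt
    · simp
    · have h1 := hu3 (hlt.trans_le hd.2)
      have h2 := hw3 (hc.1.trans_lt hlt)
      have h3 := hw.mono c hc d hd hcd
      have h4 : e * (u c).2 - e * (w c).2 ≤ dist (u c) (w c) := by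
        rw [← mul_sub]
        refine (le_abs_self _).trans ?_
        rw [abs_mul, he, one_mul, Prod.dist_eq]
        exact le_max_right _ _
      linarith
  have s2 : ∀ t ∈ Icc c d, dist (u t) (w t) ≤ (1 + 2 * K / m) * (E * dist (u a) (w a)) := by
    intro t ht
    have htab : t ∈ Icc a b := ⟨hc.1.trans ht.1, ht.2.trans hd.2⟩
    have h1 := hu.lip c hc t htab ht.1
    have h2 := hw.lip c hc t htab ht.1
    have h3 : K * (t - c) ≤ K / m * dist (u c) (w c) := by
      rw [div_mul_eq_mul_div, le_div_iff₀ hm]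
      have : m * (t - c) ≤ dist (u c) (w c) :=
        (mul_le_mul_of_nonneg_left (by linarith [ht.2]) hm.le).trans hgap
      nlinarith
    have h4 := dist_triangle4 (u t) (u c) (w c) (w t)
    rw [dist_comm (u t) (u c)] at h4
    have h5 := s1 c ⟨hc.1, le_rfl⟩
    calc dist (u t) (w t) ≤ (1 + 2 * K / m) * dist (u c) (w c) := by
          rw [add_mul, one_mul, mul_div_assoc, mul_assoc]
          linarith
      _ ≤ _ := mul_le_mul_of_nonneg_left h5 (by linarith)
  have s3 : ∀ t ∈ Icc d b, dist (u t) (w t) ≤ E * ((1 + 2 * K / m) * (E * dist (u a) (w a))) := by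
    intro t ht
    have hsub : ∀ t ∈ Icc d b, t ∈ Icc a b := fun t ht => ⟨hd.1.trans ht.1, ht.2⟩
    have := dist_le_of_solutions (fun t ht => hLB t (hsub t ht))
      (hu.after d b hd.1 le_rfl fun t ht => hu2 t ⟨hcd.trans_lt ht.1, ht.2.le⟩)
      (fun t ht => huS t (hsub t ht))
      (hw.after d b hd.1 le_rfl fun t ht => hw2 t ⟨ht.1, ht.2.le⟩)
      (fun t ht => hwS t (hsub t ht)) t ht
    refine this.trans ?_
    rw [mul_comm]
    exact mul_le_mul (hexp d t hd.1 ht.1 ht.2) (s2 d ⟨hcd, le_rfl⟩) dist_nonneg (by linarith)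
  have hnn : 0 ≤ E * dist (u a) (w a) := mul_nonneg (by linarith) dist_nonneg
  have hnn2 : E * dist (u a) (w a) ≤ (1 + 2 * K / m) * (E * dist (u a) (w a)) :=
    le_mul_of_one_le_left hnn hQ
  have hnn3 : (1 + 2 * K / m) * (E * dist (u a) (w a)) ≤
      E * ((1 + 2 * K / m) * (E * dist (u a) (w a))) :=
    le_mul_of_one_le_left (hnn.trans hnn2) hE1
  intro t ht
  have hrw : E * (1 + 2 * K / m) * E * dist (u a) (w a) =
      E * ((1 + 2 * K / m) * (E * dist (u a) (w a))) := by ring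
  rw [hrw]
  rcases le_total t c with h1 | h1
  · exact (s1 t ⟨ht.1, h1⟩).trans (hnn2.trans hnn3)
  rcases le_total t d with h2 | h2
  · exact (s2 t ⟨h1, h2⟩).trans hnn3
  · exact s3 t ⟨h2, ht.2⟩

/-- Two curves that cross the switching line transversely in the same direction stay close. -/
lemma IsTransit.dist_le {S : Set Plane} {L : ℝ≥0}
    (hu : IsTransit A B e K m a b u) (hw : IsTransit A B e K m a b w) (hm : 0 < m) (hK : 0 ≤ K)
    (he : |e| = 1) (hab : a ≤ b)
    (hLA : ∀ t ∈ Icc a b, LipschitzOnWith L (A t) S) (hLB : ∀ t ∈ Icc a b, LipschitzOnWith L (B t) S)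
    (huS : ∀ t ∈ Icc a b, u t ∈ S) (hwS : ∀ t ∈ Icc a b, w t ∈ S) :
    ∀ t ∈ Icc a b, dist (u t) (w t) ≤
      Real.exp (L * (b - a)) * (1 + 2 * K / m) * Real.exp (L * (b - a)) * dist (u a) (w a) := by
  obtain ⟨c, hc, hu1, hu2, hu3, hu4⟩ := hu.exists_switch hm hab
  obtain ⟨d, hd, hw1, hw2, hw3, hw4⟩ := hw.exists_switch hm hab
  rcases le_total c d with hcd | hcd
  · exact hu.dist_le_of_switch_le hw hm hK he hLA hLB huS hwS hc hd hcd hu1 hu2 hu3 hw1 hw2 hw4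
  · intro t ht
    rw [dist_comm, dist_comm (u a)]
    exact hw.dist_le_of_switch_le hu hm hK he hLA hLB hwS huS hd hc hcd hw1 hw2 hw3 hu1 hu2 hu4 t ht

/-- The field below (for `e = 1`) or above (for `e = -1`) the switching line. -/
def beforeField (Xp Xm : ℝ → Plane → Plane) (e : ℝ) : ℝ → Plane → Plane := if 0 < e then Xm else Xp

lemma IsFilippovCurve.isTransit (hu : IsFilippovCurve Xp Xm u)
    (hXp : ContDiffOn ℝ 1 (fun p : ℝ × Plane => Xp p.1 p.2) (univ ×ˢ D))
    (hXm : ContDiffOn ℝ 1 (fun p : ℝ × Plane => Xm p.1 p.2) (univ ×ˢ D))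
    (huD : ∀ t ∈ Icc a b, u t ∈ D) (he : e ≠ 0)
    (hK : ∀ t ∈ Icc a b, ‖Xp t (u t)‖ ≤ K ∧ ‖Xm t (u t)‖ ≤ K)
    (hm : ∀ t ∈ Icc a b, m ≤ e * (Xp t (u t)).2 ∧ m ≤ e * (Xm t (u t)).2) :
    IsTransit (beforeField Xp Xm e) (beforeField Xm Xp e) e K m a b u := by
  have hsub : ∀ a' b', a ≤ a' → b' ≤ b → ∀ t ∈ Icc a' b', t ∈ Icc a b := fun a' b' h1 h2 t ht =>
    ⟨h1.trans ht.1, ht.2.trans h2⟩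
  refine ⟨hu.continuous, fun s hs t ht hst => hu.mul_sub_le hst fun r hr =>
      hm r ⟨hs.1.trans hr.1, hr.2.trans ht.2⟩,
    fun s hs t ht hst => hu.dist_le hst fun r hr => hK r ⟨hs.1.trans hr.1, hr.2.trans ht.2⟩,
    fun a' b' ha' hb' hneg => ?_, fun a' b' ha' hb' hpos => ?_⟩
  · unfold beforeField
    split_ifs with h
    · exact hu.hasDerivWithinAt_lower hXm (fun t ht => huD t (hsub a' b' ha' hb' t ht)) fun t ht =>
        (pos_iff_neg_of_mul_neg (hneg t ht)).1 h
    · exact hu.hasDerivWithinAt_upper hXp (fun t ht => huD t (hsub a' b' ha' hb' t ht)) fun t ht =>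
        (neg_iff_pos_of_mul_neg (hneg t ht)).1 (lt_of_le_of_ne (not_lt.1 h) he)
  · unfold beforeField
    split_ifs with h
    · exact hu.hasDerivWithinAt_upper hXp (fun t ht => huD t (hsub a' b' ha' hb' t ht)) fun t ht =>
        pos_of_mul_pos_right (hpos t ht) h.le
    · exact hu.hasDerivWithinAt_lower hXm (fun t ht => huD t (hsub a' b' ha' hb' t ht)) fun t ht =>
        neg_of_mul_pos_right (hpos t ht) (not_lt.1 h)

end Filippov

section Stability

variable {Xp Xm X : ℝ → Plane → Plane} {D : Set Plane} {u w : ℝ → Plane} {T : ℝ}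

lemma eventually_norm_le_of_contDiffOn (hD : IsOpen D)
    (hX : ContDiffOn ℝ 1 (fun p : ℝ × Plane => X p.1 p.2) (univ ×ˢ D)) {p₀ : ℝ × Plane}
    (hp₀ : p₀.2 ∈ D) : ∀ᶠ p in 𝓝 p₀, ‖X p.1 p.2‖ ≤ ‖X p₀.1 p₀.2‖ + 1 := by
  have h1 : ContinuousAt (fun p : ℝ × Plane => X p.1 p.2) p₀ :=
    hX.continuousOn.continuousAt ((isOpen_univ.prod hD).mem_nhds ⟨mem_univ _, hp₀⟩)
  exact (h1.norm.eventually (gt_mem_nhds (lt_add_one _))).mono fun p hp => le_of_lt hp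

lemma exists_lipschitz_ball (hD : IsOpen D)
    (hX : ContDiffOn ℝ 1 (fun p : ℝ × Plane => X p.1 p.2) (univ ×ˢ D)) {s : ℝ} {z : Plane}
    (hz : z ∈ D) : ∃ L : ℝ≥0, ∃ ρ > 0, ∀ t ∈ Metric.ball s ρ,
      LipschitzOnWith L (X t) (Metric.ball z ρ) := by
  have h1 : ContDiffAt ℝ 1 (fun p : ℝ × Plane => X p.1 p.2) (s, z) :=
    hX.contDiffAt ((isOpen_univ.prod hD).mem_nhds ⟨mem_univ _, hz⟩)
  obtain ⟨L, S, hS, hL⟩ := h1.exists_lipschitzOnWith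
  obtain ⟨ρ, hρ, hball⟩ := Metric.mem_nhds_iff.1 hS
  refine ⟨L, ρ, hρ, fun t ht => LipschitzOnWith.of_dist_le_mul fun x hx y hy => ?_⟩
  have hmem : ∀ x ∈ Metric.ball z ρ, (t, x) ∈ S := fun x hx => hball (by
    rw [← ball_prod_same]
    exact ⟨ht, hx⟩)
  have h2 : dist ((t, x) : ℝ × Plane) (t, y) = dist x y := by
    rw [Prod.dist_eq, dist_self, max_eq_right dist_nonneg]
  rw [← h2]
  exact hL.dist_le_mul (t, x) (hmem x hx) (t, y) (hmem y hy)

lemma exists_common_ball (hD : IsOpen D)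
    (hXp : ContDiffOn ℝ 1 (fun p : ℝ × Plane => Xp p.1 p.2) (univ ×ˢ D))
    (hXm : ContDiffOn ℝ 1 (fun p : ℝ × Plane => Xm p.1 p.2) (univ ×ˢ D)) {s : ℝ} {z : Plane}
    (hz : z ∈ D) {P : ℝ × Plane → Prop} (hP : ∀ᶠ p in 𝓝 (s, z), P p) :
    ∃ L : ℝ≥0, ∃ K ≥ 0, ∃ ρ > 0, ∀ t ∈ Metric.ball s ρ, LipschitzOnWith L (Xp t) (Metric.ball z ρ) ∧
      LipschitzOnWith L (Xm t) (Metric.ball z ρ) ∧ ∀ x ∈ Metric.ball z ρ, x ∈ D ∧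
        (‖Xp t x‖ ≤ K ∧ ‖Xm t x‖ ≤ K) ∧ P (t, x) := by
  obtain ⟨L₁, ρ₁, hρ₁, hL₁⟩ := exists_lipschitz_ball (s := s) hD hXp hz
  obtain ⟨L₂, ρ₂, hρ₂, hL₂⟩ := exists_lipschitz_ball (s := s) hD hXm hz
  have hDe : ∀ᶠ p in 𝓝 (s, z), p.2 ∈ D := continuous_snd.continuousAt.eventually (hD.mem_nhds hz)
  have hb := (eventually_norm_le_of_contDiffOn hD hXp (p₀ := (s, z)) hz).and
    (eventually_norm_le_of_contDiffOn hD hXm (p₀ := (s, z)) hz)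
  obtain ⟨ρ₃, hρ₃, h₃⟩ := Metric.eventually_nhds_iff_ball.1 ((hDe.and hb).and hP)
  refine ⟨max L₁ L₂, max (‖Xp s z‖ + 1) (‖Xm s z‖ + 1), le_max_of_le_left (by positivity),
    min (min ρ₁ ρ₂) ρ₃, lt_min (lt_min hρ₁ hρ₂) hρ₃, fun t ht => ?_⟩
  simp only [Metric.mem_ball, lt_min_iff] at ht
  have hs₁ : Metric.ball z (min (min ρ₁ ρ₂) ρ₃) ⊆ Metric.ball z ρ₁ :=
    Metric.ball_subset_ball ((min_le_left _ _).trans (min_le_left _ _))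
  have hs₂ : Metric.ball z (min (min ρ₁ ρ₂) ρ₃) ⊆ Metric.ball z ρ₂ :=
    Metric.ball_subset_ball ((min_le_left _ _).trans (min_le_right _ _))
  refine ⟨((hL₁ t ht.1.1).mono hs₁).weaken (le_max_left _ _),
    ((hL₂ t ht.1.2).mono hs₂).weaken (le_max_right _ _), fun x hx => ?_⟩
  have h := h₃ (t, x) (by
    rw [← ball_prod_same]
    exact ⟨ht.2, Metric.ball_subset_ball (min_le_right _ _) hx⟩)
  exact ⟨h.1.1, ⟨h.1.2.1.trans (le_max_left _ _), h.1.2.2.trans (le_max_right _ _)⟩, h.2⟩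

/-- Curves that start close to `w` near the time `s` stay in a small ball for a short time. -/
lemma exists_forall_mem_ball (hw : Continuous w) {s K ρ : ℝ} (hK : 0 ≤ K) (hρ : 0 < ρ)
    (hball : ∀ t ∈ Metric.ball s ρ, ∀ x ∈ Metric.ball (w s) ρ, ‖Xp t x‖ ≤ K ∧ ‖Xm t x‖ ≤ K) :
    ∃ η > 0, ∃ δ > 0, Icc (s - η) (s + η) ⊆ Metric.ball s ρ ∧
      (∀ t ∈ Icc (s - η) (s + η), w t ∈ Metric.ball (w s) ρ) ∧
      ∀ u, IsFilippovCurve Xp Xm u → ∀ a ∈ Icc (s - η) (s + η), dist (u a) (w a) < δ →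
        ∀ t ∈ Icc a (s + η), u t ∈ Metric.ball (w s) ρ := by
  obtain ⟨η₁, hη₁, h₁⟩ := Metric.eventually_nhds_iff_ball.1
    (hw.continuousAt.eventually (Metric.ball_mem_nhds (w s) (by linarith : 0 < ρ / 4)))
  obtain ⟨η, hη, hη1, hη2, hη3⟩ : ∃ η > 0, η < η₁ ∧ η < ρ ∧ η < ρ / (8 * (K + 1)) := by
    obtain ⟨η, h0, h1⟩ := exists_between
      (lt_min hη₁ (lt_min hρ (by positivity : 0 < ρ / (8 * (K + 1)))))
    simp only [lt_min_iff] at h1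
    exact ⟨η, h0, h1⟩
  have hη4 : K * (2 * η) ≤ ρ / 4 := by
    rw [lt_div_iff₀ (by positivity)] at hη3
    nlinarith
  have hsub : Icc (s - η) (s + η) ⊆ Metric.ball s ρ := fun t ht => by
    rw [Metric.mem_ball, Real.dist_eq, abs_lt]
    exact ⟨by linarith [ht.1], by linarith [ht.2]⟩
  have hwb : ∀ t ∈ Icc (s - η) (s + η), dist (w t) (w s) < ρ / 4 := fun t ht => by
    refine h₁ t ?_
    rw [Metric.mem_ball, Real.dist_eq, abs_lt]
    exact ⟨by linarith [ht.1], by linarith [ht.2]⟩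
  refine ⟨η, hη, ρ / 4, by linarith, hsub, fun t ht => ?_, fun u hu a ha hdist => ?_⟩
  · rw [Metric.mem_ball]
    linarith [hwb t ht]
  · refine hu.mem_ball (K := K) (fun t ht z hz => hball t (hsub ⟨ha.1.trans ht.1, ht.2⟩) z hz) hK ?_
    have h2 := dist_triangle (u a) (w a) (w s)
    have h3 : K * (s + η - a) ≤ K * (2 * η) := mul_le_mul_of_nonneg_left (by linarith [ha.1]) hK
    linarith [hwb a ha]

/-- Locally in time, the distance to a crossing solution grows at most by a constant factor. -/
lemma exists_local_stability (hD : IsOpen D)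
    (hXp : ContDiffOn ℝ 1 (fun p : ℝ × Plane => Xp p.1 p.2) (univ ×ˢ D))
    (hXm : ContDiffOn ℝ 1 (fun p : ℝ × Plane => Xm p.1 p.2) (univ ×ˢ D))
    (hw : IsFilippovCurve Xp Xm w) (hwD : ∀ t, w t ∈ D) (hcr : IsCrossing Xp Xm w) (s : ℝ) :
    ∃ η > 0, ∃ C ≥ 1, ∃ δ > 0, ∀ u, IsFilippovCurve Xp Xm u → ∀ a ∈ Icc (s - η) (s + η),
      dist (u a) (w a) < δ → ∀ b ∈ Icc a (s + η), dist (u b) (w b) ≤ C * dist (u a) (w a) := by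
  have hwc := hw.continuous
  by_cases hs : (w s).2 = 0
  · have hpos := hcr s hs
    obtain ⟨e, he, m, hm, hmp, hmm⟩ : ∃ e : ℝ, |e| = 1 ∧ ∃ m > 0, m < e * (Xp s (w s)).2 ∧
        m < e * (Xm s (w s)).2 := by
      rcases mul_pos_iff.1 hpos with ⟨h1, h2⟩ | ⟨h1, h2⟩
      · obtain ⟨m, hm0, hm⟩ := exists_between (lt_min h1 h2)
        exact ⟨1, abs_one, m, hm0, by simpa using (lt_min_iff.1 hm).1, by simpa using (lt_min_iff.1 hm).2⟩
      · obtain ⟨m, hm0, hm⟩ := exists_between (lt_min (neg_pos.2 h1) (neg_pos.2 h2))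
        exact ⟨-1, by simp, m, hm0, by simpa using (lt_min_iff.1 hm).1,
          by simpa using (lt_min_iff.1 hm).2⟩
    have hev : ∀ {X : ℝ → Plane → Plane},
        ContDiffOn ℝ 1 (fun p : ℝ × Plane => X p.1 p.2) (univ ×ˢ D) → m < e * (X s (w s)).2 →
        ∀ᶠ p : ℝ × Plane in 𝓝 (s, w s), m ≤ e * (X p.1 p.2).2 := by
      intro X hX h
      have h1 : ContinuousAt (fun p : ℝ × Plane => X p.1 p.2) (s, w s) :=
        hX.continuousOn.continuousAt ((isOpen_univ.prod hD).mem_nhds ⟨mem_univ _, hwD s⟩)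
      have h2 : ContinuousAt (fun p : ℝ × Plane => e * (X p.1 p.2).2) (s, w s) :=
        continuousAt_const.mul (continuous_snd.continuousAt.comp h1)
      exact (h2.eventually (lt_mem_nhds h)).mono fun p hp => le_of_lt hp
    obtain ⟨L, K, hK, ρ, hρ, hb⟩ := exists_common_ball hD hXp hXm (hwD s)
      ((hev hXp hmp).and (hev hXm hmm))
    obtain ⟨η, hη, δ, hδ, hsub, hwb, hub⟩ := exists_forall_mem_ball (Xp := Xp) (Xm := Xm) hwc hK hρ
      (fun t ht x hx => ((hb t ht).2.2 x hx).2.1)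
    have he0 : e ≠ 0 := by
      rintro rfl
      simp at he
    refine ⟨η, hη, max 1 (Real.exp (L * (2 * η)) * (1 + 2 * K / m) * Real.exp (L * (2 * η))),
      le_max_left _ _, δ, hδ, fun u hu a ha hdist b hbb => ?_⟩
    have hsub' : ∀ t ∈ Icc a (s + η), t ∈ Icc (s - η) (s + η) := fun t ht => ⟨ha.1.trans ht.1, ht.2⟩
    have htr : ∀ u, IsFilippovCurve Xp Xm u → (∀ t ∈ Icc a (s + η), u t ∈ Metric.ball (w s) ρ) →
        IsTransit (beforeField Xp Xm e) (beforeField Xm Xp e) e K m a (s + η) u := by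
      intro u hu hub
      have h := fun t ht => (hb t (hsub (hsub' t ht))).2.2 (u t) (hub t ht)
      exact hu.isTransit hXp hXm (fun t ht => (h t ht).1) he0 (fun t ht => (h t ht).2.1)
        fun t ht => (h t ht).2.2
    have hLA : ∀ t ∈ Icc a (s + η), LipschitzOnWith L (beforeField Xp Xm e t) (Metric.ball (w s) ρ) := by
      intro t ht
      have := hb t (hsub (hsub' t ht))
      unfold beforeField
      split_ifs
      exacts [this.2.1, this.1]
    have hLB : ∀ t ∈ Icc a (s + η), LipschitzOnWith L (beforeField Xm Xp e t) (Metric.ball (w s) ρ) := by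
      intro t ht
      have := hb t (hsub (hsub' t ht))
      unfold beforeField
      split_ifs
      exacts [this.1, this.2.1]
    have hu' := hub u hu a ha hdist
    have hw' := fun t ht => hwb t (hsub' t ht)
    refine ((htr u hu hu').dist_le (htr w hw hw') hm hK he ha.2 hLA hLB hu' hw' b hbb).trans ?_
    refine mul_le_mul_of_nonneg_right (le_max_of_le_right ?_) dist_nonneg
    have h2 : s + η - a ≤ 2 * η := by linarith [ha.1]
    gcongr
  · rcases lt_or_gt_of_ne hs with hneg | hpos
    · have hev : ∀ᶠ p : ℝ × Plane in 𝓝 (s, w s), p.2.2 < 0 :=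
        (continuous_snd.comp continuous_snd).continuousAt.eventually (gt_mem_nhds hneg)
      obtain ⟨L, K, hK, ρ, hρ, hb⟩ := exists_common_ball hD hXp hXm (hwD s) hev
      obtain ⟨η, hη, δ, hδ, hsub, hwb, hub⟩ := exists_forall_mem_ball (Xp := Xp) (Xm := Xm) hwc hK hρ
        (fun t ht x hx => ((hb t ht).2.2 x hx).2.1)
      refine ⟨η, hη, Real.exp (L * (2 * η)), Real.one_le_exp (by positivity), δ, hδ,
        fun u hu a ha hdist b hbb => ?_⟩
      have hsub' : ∀ t ∈ Icc a (s + η), t ∈ Icc (s - η) (s + η) :=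
        fun t ht => ⟨ha.1.trans ht.1, ht.2⟩
      have hd : ∀ u, IsFilippovCurve Xp Xm u → (∀ t ∈ Icc a (s + η), u t ∈ Metric.ball (w s) ρ) →
          ∀ t ∈ Icc a (s + η), HasDerivWithinAt u (Xm t (u t)) (Icc a (s + η)) t := by
        intro u hu hub
        have h := fun t ht => (hb t (hsub (hsub' t ht))).2.2 (u t) (hub t ht)
        exact hu.hasDerivWithinAt_lower hXm (fun t ht => (h t ht).1)
          fun t ht => (h t (Ioo_subset_Icc_self ht)).2.2
      have hu' := hub u hu a ha hdist
      have hw' := fun t ht => hwb t (hsub' t ht)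
      refine (dist_le_of_solutions (fun t ht => (hb t (hsub (hsub' t ht))).2.1) (hd u hu hu') hu'
        (hd w hw hw') hw' b hbb).trans ?_
      rw [mul_comm]
      have h2 : b - a ≤ 2 * η := by linarith [ha.1, hbb.2]
      gcongr
    · have hev : ∀ᶠ p : ℝ × Plane in 𝓝 (s, w s), 0 < p.2.2 :=
        (continuous_snd.comp continuous_snd).continuousAt.eventually (lt_mem_nhds hpos)
      obtain ⟨L, K, hK, ρ, hρ, hb⟩ := exists_common_ball hD hXp hXm (hwD s) hev
      obtain ⟨η, hη, δ, hδ, hsub, hwb, hub⟩ := exists_forall_mem_ball (Xp := Xp) (Xm := Xm) hwc hK hρ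
        (fun t ht x hx => ((hb t ht).2.2 x hx).2.1)
      refine ⟨η, hη, Real.exp (L * (2 * η)), Real.one_le_exp (by positivity), δ, hδ,
        fun u hu a ha hdist b hbb => ?_⟩
      have hsub' : ∀ t ∈ Icc a (s + η), t ∈ Icc (s - η) (s + η) :=
        fun t ht => ⟨ha.1.trans ht.1, ht.2⟩
      have hd : ∀ u, IsFilippovCurve Xp Xm u → (∀ t ∈ Icc a (s + η), u t ∈ Metric.ball (w s) ρ) →
          ∀ t ∈ Icc a (s + η), HasDerivWithinAt u (Xp t (u t)) (Icc a (s + η)) t := by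
        intro u hu hub
        have h := fun t ht => (hb t (hsub (hsub' t ht))).2.2 (u t) (hub t ht)
        exact hu.hasDerivWithinAt_upper hXp (fun t ht => (h t ht).1)
          fun t ht => (h t (Ioo_subset_Icc_self ht)).2.2
      have hu' := hub u hu a ha hdist
      have hw' := fun t ht => hwb t (hsub' t ht)
      refine (dist_le_of_solutions (fun t ht => (hb t (hsub (hsub' t ht))).1) (hd u hu hu') hu'
        (hd w hw hw') hw' b hbb).trans ?_
      rw [mul_comm]
      have h2 : b - a ≤ 2 * η := by linarith [ha.1, hbb.2]
      gcongr

/-- A periodic solution that is close to a crossing periodic solution at one time is close to it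
at all times. -/
lemma exists_uniform_stability (hD : IsOpen D) (hT : 0 < T)
    (hXp : ContDiffOn ℝ 1 (fun p : ℝ × Plane => Xp p.1 p.2) (univ ×ˢ D))
    (hXm : ContDiffOn ℝ 1 (fun p : ℝ × Plane => Xm p.1 p.2) (univ ×ˢ D))
    (hw : IsPeriodicSolution Xp Xm D T w) (hcr : IsCrossing Xp Xm w) {ρ : ℝ} (hρ : 0 < ρ) :
    ∃ δ > 0, ∀ u, IsPeriodicSolution Xp Xm D T u → (∃ t, dist (u t) (w t) < δ) →
      ∀ t, dist (u t) (w t) < ρ := by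
  have hloc : ∃ η > 0, ∃ C ≥ 1, ∃ δ > 0, ∀ u, IsFilippovCurve Xp Xm u → ∀ a ∈ Icc 0 T,
      dist (u a) (w a) < δ → ∀ b ∈ Icc a (a + η), dist (u b) (w b) ≤ C * dist (u a) (w a) := by
    refine isCompact_Icc.induction_on (p := fun S : Set ℝ => ∃ η > 0, ∃ C ≥ 1, ∃ δ > 0,
      ∀ u, IsFilippovCurve Xp Xm u → ∀ a ∈ S,
        dist (u a) (w a) < δ → ∀ b ∈ Icc a (a + η), dist (u b) (w b) ≤ C * dist (u a) (w a)) ?_ ?_ ?_ ?_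
    · exact ⟨1, one_pos, 1, le_rfl, 1, one_pos, fun u _ a ha => absurd ha (notMem_empty a)⟩
    · rintro S S' hSS' ⟨η, hη, C, hC, δ, hδ, h⟩
      exact ⟨η, hη, C, hC, δ, hδ, fun u hu a ha => h u hu a (hSS' ha)⟩
    · rintro S S' ⟨η, hη, C, hC, δ, hδ, h⟩ ⟨η', hη', C', hC', δ', hδ', h'⟩
      refine ⟨min η η', lt_min hη hη', max C C', le_max_of_le_left hC, min δ δ', lt_min hδ hδ', ?_⟩
      rintro u hu a (ha | ha) hd b hb
      · refine (h u hu a ha (lt_min_iff.1 hd).1 b ⟨hb.1, hb.2.trans ?_⟩).trans ?_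
        · gcongr
          exact min_le_left _ _
        · gcongr
          exact le_max_left _ _
      · refine (h' u hu a ha (lt_min_iff.1 hd).2 b ⟨hb.1, hb.2.trans ?_⟩).trans ?_
        · gcongr
          exact min_le_right _ _
        · gcongr
          exact le_max_right _ _
    · intro s _
      obtain ⟨η, hη, C, hC, δ, hδ, h⟩ :=
        exists_local_stability hD hXp hXm hw.inclusion hw.mem hcr s
      refine ⟨Icc (s - η / 2) (s + η / 2), mem_nhdsWithin_of_mem_nhds
        (Icc_mem_nhds (by linarith) (by linarith)), η / 2, by linarith, C, hC, δ, hδ,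
        fun u hu a ha hd b hb => h u hu a ⟨by linarith [ha.1], by linarith [ha.2]⟩ hd b
          ⟨hb.1, by linarith [ha.2, hb.2]⟩⟩
  obtain ⟨η, hη, C, hC, δ, hδ, h⟩ := hloc
  obtain ⟨n, hn⟩ := exists_nat_gt (T / η)
  rw [div_lt_iff₀ hη] at hn
  have hCn : 0 < C ^ n := by positivity
  refine ⟨min δ ρ / C ^ n, div_pos (lt_min hδ hρ) hCn, fun u hu ht₀ => ?_⟩
  obtain ⟨t₀, ht₀⟩ := ht₀
  have hstep : ∀ a, dist (u a) (w a) < δ → ∀ b ∈ Icc a (a + η),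
      dist (u b) (w b) ≤ C * dist (u a) (w a) := by
    intro a hd b hb
    obtain ⟨k, hk, -⟩ := existsUnique_sub_zsmul_mem_Ico hT a 0
    have hup : ∀ t, u (t - k • T) = u t := fun t => Function.Periodic.sub_zsmul_eq hu.periodic k
    have hwp : ∀ t, w (t - k • T) = w t := fun t => Function.Periodic.sub_zsmul_eq hw.periodic k
    have := h u hu.inclusion (a - k • T) ⟨hk.1, by linarith [hk.2]⟩ (by rwa [hup, hwp]) (b - k • T)
      ⟨by linarith [hb.1], by linarith [hb.2]⟩
    rwa [hup, hwp, hup, hwp] at this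
  have hiter : ∀ k : ℕ, C ^ k * dist (u t₀) (w t₀) < δ → ∀ t ∈ Icc t₀ (t₀ + k * η),
      dist (u t) (w t) ≤ C ^ k * dist (u t₀) (w t₀) := by
    intro k
    induction k with
    | zero =>
      intro _ t ht
      obtain rfl : t = t₀ := le_antisymm (by simpa using ht.2) ht.1
      simp
    | succ k ih =>
      intro hlt t ht
      have hle : C ^ k * dist (u t₀) (w t₀) ≤ C ^ (k + 1) * dist (u t₀) (w t₀) := by
        gcongr
        omega
      have ih' := ih (hle.trans_lt hlt)
      rcases le_total t (t₀ + k * η) with h1 | h1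
      · exact (ih' t ⟨ht.1, h1⟩).trans hle
      · have h2 := ih' (t₀ + k * η) ⟨le_add_of_nonneg_right (by positivity), le_rfl⟩
        have h3 := hstep _ ((h2.trans hle).trans_lt hlt) t
          ⟨h1, by have := ht.2; push_cast at this; linarith⟩
        refine h3.trans ?_
        rw [pow_succ', mul_assoc]
        gcongr
  rw [lt_div_iff₀ hCn, mul_comm, lt_min_iff] at ht₀
  intro t
  obtain ⟨k, hk, -⟩ := existsUnique_sub_zsmul_mem_Ico hT t t₀
  have h1 := hiter n ht₀.1 (t - k • T) ⟨hk.1, by linarith [hk.2]⟩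
  rw [Function.Periodic.sub_zsmul_eq hu.periodic, Function.Periodic.sub_zsmul_eq hw.periodic] at h1
  exact h1.trans_lt ht₀.2

end Stability

section Gluing

variable {Xp Xm X : ℝ → Plane → Plane} {D : Set Plane} {u w c₁ c₂ : ℝ → Plane} {T θ τm τp : ℝ}

lemma integral_eq_sub_of_eqOn_Ioo {v f c : ℝ → Plane} {a b : ℝ} (hab : a ≤ b) (hv : EqOn v f (Ioo a b))
    (hf : ContinuousOn f (Icc a b)) (hc : ∀ t ∈ Icc a b, HasDerivAt c (f t) t) :
    IntervalIntegrable v volume a b ∧ ∀ t ∈ Icc a b, ∫ s in a..t, v s = c t - c a := by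
  constructor
  · rw [← uIcc_of_le hab] at hf
    rw [← uIoo_of_le hab] at hv
    exact hf.intervalIntegrable.congr_uIoo hv.symm
  · intro t ht
    rw [intervalIntegral.integral_congr_Ioo_of_le ht.1 (hv.mono (Ioo_subset_Ioo_right ht.2))]
    have hsub : uIcc a t ⊆ Icc a b := by
      rw [uIcc_of_le ht.1]
      exact Icc_subset_Icc_right ht.2
    exact intervalIntegral.integral_eq_sub_of_hasDerivAt (fun s hs => hc s (hsub hs))
      (hf.mono hsub).intervalIntegrable

lemma field_sub_zsmul (hX : ∀ t, ∀ z ∈ D, X (t + T) z = X t z) {z : Plane} (hz : z ∈ D) (t : ℝ)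
    (k : ℤ) : X (t - k • T) z = X t z :=
  Function.Periodic.sub_zsmul_eq (f := fun t => X t z) (fun t => hX t z hz) k

/-- An arc `c₂` above the switching line followed by an arc `c₁` below it form a periodic solution. -/
lemma exists_periodic_glue (hτm : 0 < τm) (hτp : 0 < τp) (hT : τm + τp = T)
    (hXp : ContDiffOn ℝ 1 (fun p : ℝ × Plane => Xp p.1 p.2) (univ ×ˢ D))
    (hXm : ContDiffOn ℝ 1 (fun p : ℝ × Plane => Xm p.1 p.2) (univ ×ˢ D))
    (hperp : ∀ t, ∀ z ∈ D, Xp (t + T) z = Xp t z) (hperm : ∀ t, ∀ z ∈ D, Xm (t + T) z = Xm t z)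
    (h₁ : ∀ t ∈ Icc θ (θ + τm), c₁ t ∈ D ∧ HasDerivAt c₁ (Xm t (c₁ t)) t)
    (h₂ : ∀ t ∈ Icc (θ - τp) θ, c₂ t ∈ D ∧ HasDerivAt c₂ (Xp t (c₂ t)) t)
    (h12 : c₁ θ = c₂ θ) (h21 : c₁ (θ + τm) = c₂ (θ - τp))
    (hneg : ∀ t ∈ Ioo θ (θ + τm), (c₁ t).2 < 0) (hpos : ∀ t ∈ Ioo (θ - τp) θ, 0 < (c₂ t).2)
    (h0 : (c₁ θ).2 = 0) (h0' : (c₁ (θ + τm)).2 = 0) :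
    ∃ w, IsPeriodicSolution Xp Xm D T w ∧ EqOn w c₁ (Icc θ (θ + τm)) ∧ EqOn w c₂ (Icc (θ - τp) θ) := by
  set a := θ - τp with ha
  have haT : a + T = θ + τm := by linarith
  have hT0 : 0 < T := by linarith
  set π := toIcoMod hT0 a with hπ
  have hπper : Function.Periodic π T := toIcoMod_periodic hT0 a
  have hπself : ∀ t ∈ Ico a (a + T), π t = t := fun t ht => (toIcoMod_eq_self hT0).2 ht
  have hπmem : ∀ t, π t ∈ Ico a (a + T) := toIcoMod_mem_Ico hT0 a
  have hπb : π (a + T) = a := by rw [hπper, hπself a ⟨le_rfl, by linarith⟩]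
  set w : ℝ → Plane := fun t => if π t < θ then c₂ (π t) else c₁ (π t) with hw
  set v : ℝ → Plane := fun t => if π t < θ then Xp (π t) (c₂ (π t)) else Xm (π t) (c₁ (π t)) with hv
  have hw₁ : EqOn w c₁ (Icc θ (θ + τm)) := by
    intro t ht
    rcases ht.2.lt_or_eq with hlt | rfl
    · have := hπself t ⟨by linarith [ht.1], by linarith⟩
      simp [hw, this, ht.1.not_gt]
    · rw [← haT] at h21 ⊢
      have haθ : a < θ := by linarith
      simp only [hw, hπb, if_pos haθ, h21]
  have hw₂ : EqOn w c₂ (Icc a θ) := by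
    intro t ht
    have := hπself t ⟨ht.1, by linarith [ht.2]⟩
    rcases ht.2.lt_or_eq with hlt | rfl
    · simp [hw, this, hlt]
    · simp [hw, this, h12]
  have hwper : Function.Periodic w T := fun t => by simp only [hw, hπper t]
  have hvper : Function.Periodic v T := fun t => by simp only [hv, hπper t]
  have hcont : ∀ {X : ℝ → Plane → Plane} {c : ℝ → Plane} {p q : ℝ},
      ContDiffOn ℝ 1 (fun p : ℝ × Plane => X p.1 p.2) (univ ×ˢ D) →
      (∀ t ∈ Icc p q, c t ∈ D ∧ HasDerivAt c (X t (c t)) t) →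
      ContinuousOn (fun t => X t (c t)) (Icc p q) := by
    intro X c p q hX hc
    have hcc : ContinuousOn c (Icc p q) := fun t ht => (hc t ht).2.continuousAt.continuousWithinAt
    exact hX.continuousOn.comp (f := fun t => (t, c t)) (continuousOn_id.prodMk hcc)
      fun t ht => ⟨mem_univ _, (hc t ht).1⟩
  obtain ⟨hi₂, hint₂⟩ := integral_eq_sub_of_eqOn_Ioo (v := v) (by linarith : a ≤ θ)
    (fun t ht => by
      have := hπself t ⟨ht.1.le, by linarith [ht.2]⟩
      simp [hv, this, ht.2]) (hcont hXp h₂) fun t ht => (h₂ t ht).2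
  obtain ⟨hi₁, hint₁⟩ := integral_eq_sub_of_eqOn_Ioo (v := v) (by linarith : θ ≤ θ + τm)
    (fun t ht => by
      have := hπself t ⟨by linarith [ht.1], by linarith [ht.2]⟩
      simp [hv, this, ht.1.not_gt]) (hcont hXm h₁) fun t ht => (h₁ t ht).2
  have hi : ∀ p q : ℝ, IntervalIntegrable v volume p q :=
    hvper.intervalIntegrable hT0.ne' (by
      rw [haT]
      exact hi₂.trans hi₁)
  have hwint : ∀ t ∈ Icc a (a + T), w t - w a = ∫ s in a..t, v s := by
    intro t ht
    have hwa : w a = c₂ a := hw₂ ⟨le_rfl, by linarith⟩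
    rcases le_total t θ with h | h
    · rw [hint₂ t ⟨ht.1, h⟩, hw₂ ⟨ht.1, h⟩, hwa]
    · have ht' : t ∈ Icc θ (θ + τm) := ⟨h, by linarith [ht.2]⟩
      rw [← intervalIntegral.integral_add_adjacent_intervals (hi a θ) (hi θ t),
        hint₂ θ ⟨by linarith, le_rfl⟩, hint₁ t ht', hw₁ ht', hwa, h12]
      abel
  have hzero : ∫ s in a..a + T, v s = 0 := by
    rw [← hwint _ ⟨by linarith, le_rfl⟩, hwper, sub_self]
  have hWper : Function.Periodic (fun t => ∫ s in a..t, v s) T := by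
    intro t
    change ∫ s in a..t + T, v s = _
    rw [hvper.intervalIntegral_add_eq_add a t hi, hzero, add_zero]
  have hwint' : ∀ t, w t - w a = ∫ s in a..t, v s := by
    intro t
    have h1 := hwint (π t) (Ico_subset_Icc_self (hπmem t))
    have h2 : w (π t) = w t := by
      rw [hπ, ← self_sub_toIcoDiv_zsmul]
      exact hwper.sub_zsmul_eq _
    have h3 : ∫ s in a..π t, v s = ∫ s in a..t, v s := by
      have := hWper.sub_zsmul_eq (x := t) (toIcoDiv hT0 a t)
      rwa [self_sub_toIcoDiv_zsmul] at this
    rw [← h2, h1, h3]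
  have hmem : ∀ t, w t ∈ D := by
    intro t
    by_cases h : π t < θ
    · simp only [hw, if_pos h]
      exact (h₂ _ ⟨(hπmem t).1, h.le⟩).1
    · simp only [hw, if_neg h]
      exact (h₁ _ ⟨not_lt.1 h, by linarith [(hπmem t).2]⟩).1
  have hshift : ∀ {X : ℝ → Plane → Plane}, (∀ t, ∀ z ∈ D, X (t + T) z = X t z) → ∀ t,
      X (π t) (w t) = X t (w t) := by
    intro X hX t
    rw [hπ, ← self_sub_toIcoDiv_zsmul]
    exact field_sub_zsmul hX (hmem t) t _
  refine ⟨w, ⟨hmem, hwper, v, hi, fun p q => ?_, Eventually.of_forall fun t => ?_⟩, hw₁, hw₂⟩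
  · rw [← intervalIntegral.integral_interval_sub_left (hi a q) (hi a p), ← hwint', ← hwint']
    abel
  · have hp := hshift hperp t
    have hm := hshift hperm t
    by_cases h : π t < θ
    · have hwt : w t = c₂ (π t) := by simp only [hw, if_pos h]
      have hvt : v t = Xp t (w t) := by
        rw [← hp, hwt]
        simp only [hv, if_pos h]
      rcases (hπmem t).1.lt_or_eq with h' | h'
      · left
        rw [hwt]
        exact ⟨hpos _ ⟨h', h⟩, by rw [hvt, hwt]⟩
      · right; right
        refine ⟨?_, ?_⟩
        · rw [hwt, ← h', ← h21, h0']
        · rw [hvt]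
          exact left_mem_segment ℝ _ _
    · have hwt : w t = c₁ (π t) := by simp only [hw, if_neg h]
      have hvt : v t = Xm t (w t) := by
        rw [← hm, hwt]
        simp only [hv, if_neg h]
      rcases (not_lt.1 h).lt_or_eq with h' | h'
      · right; left
        rw [hwt]
        exact ⟨hneg _ ⟨h', by linarith [(hπmem t).2]⟩, by rw [hvt, hwt]⟩
      · right; right
        refine ⟨?_, ?_⟩
        · rw [hwt, ← h', h0]
        · rw [hvt]
          exact right_mem_segment ℝ _ _

end Gluing

lemma IsPeriodicSolution.isFilippovCurve {Xp Xm : ℝ → Plane → Plane} {D : Set Plane} {T : ℝ}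
    {w : ℝ → Plane} (hw : IsPeriodicSolution Xp Xm D T w) : IsFilippovCurve Xp Xm w :=
  hw.inclusion

section Window

variable {Xp Xm X : ℝ → Plane → Plane} {D : Set Plane} {u w : ℝ → Plane} {T θ τm τp : ℝ}

/-- A curve close to one that crosses the switching line transversely also crosses it, exactly
once in a small window. -/
lemma exists_crossing_window (hD : IsOpen D)
    (hXp : ContDiffOn ℝ 1 (fun p : ℝ × Plane => Xp p.1 p.2) (univ ×ˢ D))
    (hXm : ContDiffOn ℝ 1 (fun p : ℝ × Plane => Xm p.1 p.2) (univ ×ˢ D))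
    (hw : Continuous w) {s e : ℝ} (hs : w s ∈ D) (hp : 0 < e * (Xp s (w s)).2)
    (hm : 0 < e * (Xm s (w s)).2) :
    ∃ ρ > 0, ∀ u, IsFilippovCurve Xp Xm u → (∀ t, dist (u t) (w t) < ρ) → ∀ r ∈ Ioo 0 ρ,
      e * (u (s - r)).2 < 0 → 0 < e * (u (s + r)).2 → ∃ c ∈ Ioo (s - r) (s + r), (u c).2 = 0 ∧
        (∀ t ∈ Ico (s - r) c, e * (u t).2 < 0) ∧ ∀ t ∈ Ioc c (s + r), 0 < e * (u t).2 := by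
  obtain ⟨m, hm0, hmlt⟩ := exists_between (lt_min hp hm)
  rw [lt_min_iff] at hmlt
  have hev : ∀ {X : ℝ → Plane → Plane},
      ContDiffOn ℝ 1 (fun p : ℝ × Plane => X p.1 p.2) (univ ×ˢ D) → m < e * (X s (w s)).2 →
      ∀ᶠ p : ℝ × Plane in 𝓝 (s, w s), m ≤ e * (X p.1 p.2).2 := by
    intro X hX h
    have h1 : ContinuousAt (fun p : ℝ × Plane => X p.1 p.2) (s, w s) :=
      hX.continuousOn.continuousAt ((isOpen_univ.prod hD).mem_nhds ⟨mem_univ _, hs⟩)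
    have h2 : ContinuousAt (fun p : ℝ × Plane => e * (X p.1 p.2).2) (s, w s) :=
      continuousAt_const.mul (continuous_snd.continuousAt.comp h1)
    exact (h2.eventually (lt_mem_nhds h)).mono fun p hp => le_of_lt hp
  obtain ⟨L, K, hK, ρ, hρ, hb⟩ := exists_common_ball hD hXp hXm hs
    ((hev hXp hmlt.1).and (hev hXm hmlt.2))
  obtain ⟨η, hη, hwη⟩ := Metric.eventually_nhds_iff_ball.1
    (hw.continuousAt.eventually (Metric.ball_mem_nhds (w s) (half_pos hρ)))
  refine ⟨min (ρ / 2) η, lt_min (half_pos hρ) hη, fun u hu hd r hr h1 h2 => ?_⟩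
  have hr' := lt_min_iff.1 hr.2
  have hX : ∀ t ∈ Icc (s - r) (s + r), m ≤ e * (Xp t (u t)).2 ∧ m ≤ e * (Xm t (u t)).2 := by
    intro t ht
    have hts : |t - s| ≤ r := abs_le.2 ⟨by linarith [ht.1], by linarith [ht.2]⟩
    have ha : t ∈ Metric.ball s ρ := by
      rw [Metric.mem_ball, Real.dist_eq]
      linarith
    have hb' : dist (w t) (w s) < ρ / 2 := hwη t (by
      rw [Metric.mem_ball, Real.dist_eq]
      linarith)
    have hc : u t ∈ Metric.ball (w s) ρ := by
      have := dist_triangle (u t) (w t) (w s)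
      have := (lt_min_iff.1 (hd t)).1
      rw [Metric.mem_ball]
      linarith
    exact ((hb t ha).2.2 _ hc).2.2
  have hmono : ∀ p ∈ Icc (s - r) (s + r), ∀ q ∈ Icc (s - r) (s + r), p < q →
      e * (u p).2 < e * (u q).2 := by
    intro p hp q hq hpq
    have := hu.mul_sub_le hpq.le fun t ht => hX t ⟨hp.1.trans ht.1, ht.2.trans hq.2⟩
    nlinarith [mul_pos hm0 (sub_pos.2 hpq)]
  have hle : s - r ≤ s + r := by linarith [hr.1]
  obtain ⟨c, hc, h0⟩ := intermediate_value_Icc hle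
    (continuous_const.mul (continuous_snd.comp hu.continuous) : Continuous fun t => e * (u t).2).continuousOn
    ⟨h1.le, h2.le⟩
  change e * (u c).2 = 0 at h0
  have he : e ≠ 0 := by
    rintro rfl
    simp at hp
  refine ⟨c, ⟨lt_of_le_of_ne hc.1 ?_, lt_of_le_of_ne hc.2 ?_⟩, (mul_eq_zero.1 h0).resolve_left he,
    fun t ht => h0 ▸ hmono t ⟨ht.1, ht.2.le.trans hc.2⟩ c hc ht.2,
    fun t ht => h0 ▸ hmono c hc t ⟨hc.1.trans ht.1.le, ht.2⟩ ht.1⟩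
  · rintro rfl
    exact h1.ne h0
  · rintro rfl
    exact h2.ne' h0

/-- Periodic solutions close to a crossing periodic solution with two crossings per period have
the same pattern of crossings. -/
lemma exists_crossing_pattern (hD : IsOpen D) (hτm : 0 < τm) (hτp : 0 < τp) (hT : τm + τp = T)
    (hXp : ContDiffOn ℝ 1 (fun p : ℝ × Plane => Xp p.1 p.2) (univ ×ˢ D))
    (hXm : ContDiffOn ℝ 1 (fun p : ℝ × Plane => Xm p.1 p.2) (univ ×ˢ D))
    (hw : IsPeriodicSolution Xp Xm D T w) (hcr : IsCrossing Xp Xm w)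
    (hneg : ∀ t ∈ Ioo θ (θ + τm), (w t).2 < 0) (hpos : ∀ t ∈ Ioo (θ - τp) θ, 0 < (w t).2)
    (hdown : (Xp θ (w θ)).2 < 0 ∧ (Xm θ (w θ)).2 < 0)
    (hup : 0 < (Xp (θ + τm) (w (θ + τm))).2 ∧ 0 < (Xm (θ + τm) (w (θ + τm))).2)
    {ρ : ℝ} (hρ : 0 < ρ) :
    ∃ δ > 0, ∀ u, IsPeriodicSolution Xp Xm D T u → (∃ t, dist (u t) (w t) < δ) →
      ∃ θ' θ'', |θ' - θ| < ρ ∧ |θ'' - (θ + τm)| < ρ ∧ dist (u θ') (w θ) < ρ ∧ θ' < θ'' ∧ θ'' - T < θ' ∧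
        (u θ').2 = 0 ∧ (u θ'').2 = 0 ∧ (∀ t ∈ Ioo θ' θ'', (u t).2 < 0) ∧
        ∀ t ∈ Ioo (θ'' - T) θ', 0 < (u t).2 := by
  have hT0 : 0 < T := by linarith
  have hwc := hw.isFilippovCurve.continuous
  obtain ⟨ρ₁, hρ₁, hwin₁⟩ := exists_crossing_window (e := -1) hD hXp hXm hwc (hw.mem θ)
    (by linarith [hdown.1]) (by linarith [hdown.2])
  obtain ⟨ρ₂, hρ₂, hwin₂⟩ := exists_crossing_window (e := 1) hD hXp hXm hwc (hw.mem (θ + τm))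
    (by linarith [hup.1]) (by linarith [hup.2])
  obtain ⟨η, hη, hwη⟩ := Metric.eventually_nhds_iff_ball.1
    (hwc.continuousAt.eventually (Metric.ball_mem_nhds (w θ) (half_pos hρ)))
  obtain ⟨r, hr0, hr1, hr2, hrη, hrρ, hrm, hrp⟩ : ∃ r > 0, r < ρ₁ ∧ r < ρ₂ ∧ r < η ∧ r < ρ ∧
      r < τm / 2 ∧ r < τp / 2 := by
    obtain ⟨r, h0, h1⟩ := exists_between (lt_min (lt_min (lt_min hρ₁ hρ₂) (lt_min hη hρ))
      (lt_min (half_pos hτm) (half_pos hτp)))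
    simp only [lt_min_iff] at h1
    exact ⟨r, h0, h1.1.1.1, h1.1.1.2, h1.1.2.1, h1.1.2.2, h1.2.1, h1.2.2⟩
  have hw2 : Continuous fun t => (w t).2 := continuous_snd.comp hwc
  obtain ⟨κ₁, hκ₁, hlow⟩ := (isCompact_Icc (a := θ + r) (b := θ + τm - r)).exists_forall_le'
    (f := fun t => -(w t).2) hw2.neg.continuousOn (a := 0)
    fun t ht => neg_pos.2 (hneg t ⟨by linarith [ht.1], by linarith [ht.2]⟩)
  obtain ⟨κ₂, hκ₂, hupp⟩ := (isCompact_Icc (a := θ - τp + r) (b := θ - r)).exists_forall_le'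
    (f := fun t => (w t).2) hw2.continuousOn (a := 0)
    fun t ht => hpos t ⟨by linarith [ht.1], by linarith [ht.2]⟩
  obtain ⟨δ, hδ, hstab⟩ := exists_uniform_stability hD hT0 hXp hXm hw hcr
    (lt_min (lt_min (lt_min hρ₁ hρ₂) (half_pos hρ)) (lt_min hκ₁ hκ₂))
  refine ⟨δ, hδ, fun u hu hex => ?_⟩
  have hclose := hstab u hu hex
  simp only [lt_min_iff] at hclose
  have hy : ∀ t, |(u t).2 - (w t).2| ≤ dist (u t) (w t) := fun t => by
    rw [Prod.dist_eq]
    exact le_max_right _ _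
  have hlow' : ∀ t ∈ Icc (θ + r) (θ + τm - r), (u t).2 < 0 := fun t ht => by
    have h1 := hlow t ht
    have h2 := (le_abs_self _).trans (hy t)
    have h3 := (hclose t).2.1
    linarith
  have hupp' : ∀ t ∈ Icc (θ - τp + r) (θ - r), 0 < (u t).2 := fun t ht => by
    have h1 := hupp t ht
    have h2 := (neg_abs_le _).trans' (neg_le_neg (hy t))
    have h3 := (hclose t).2.2
    linarith
  have hper : ∀ t, (u (t - T)).2 = (u t).2 := fun t => by
    have := hu.periodic (t - T)
    rw [sub_add_cancel] at this
    rw [this]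
  obtain ⟨θ', hθ', hz', hb', ha'⟩ := hwin₁ u hu.isFilippovCurve (fun t => (hclose t).1.1.1) r ⟨hr0, hr1⟩
    (by linarith [hupp' (θ - r) ⟨by linarith, le_rfl⟩])
    (by linarith [hlow' (θ + r) ⟨le_rfl, by linarith⟩])
  obtain ⟨θ'', hθ'', hz'', hb'', ha''⟩ := hwin₂ u hu.isFilippovCurve (fun t => (hclose t).1.1.2) r ⟨hr0, hr2⟩
    (by linarith [hlow' (θ + τm - r) ⟨by linarith, le_rfl⟩])
    (by
      have h1 := hupp' (θ - τp + r) ⟨le_rfl, by linarith⟩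
      have h2 := hper (θ + τm + r)
      rw [show θ + τm + r - T = θ - τp + r by linarith] at h2
      linarith)
  have hθ'd : |θ' - θ| < r := abs_lt.2 ⟨by linarith [hθ'.1], by linarith [hθ'.2]⟩
  refine ⟨θ', θ'', by linarith, abs_lt.2 ⟨by linarith [hθ''.1], by linarith [hθ''.2]⟩, ?_,
    by linarith [hθ'.2, hθ''.1], by linarith [hθ'.1, hθ''.2], hz', hz'', fun t ht => ?_, fun t ht => ?_⟩
  · have h1 := dist_triangle (u θ') (w θ') (w θ)
    have h2 : dist (w θ') (w θ) < ρ / 2 := hwη θ' (by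
      rw [Metric.mem_ball, Real.dist_eq]
      linarith)
    linarith [(hclose θ').1.2]
  · rcases le_total t (θ + r) with h | h
    · linarith [ha' t ⟨ht.1, h⟩]
    rcases le_total t (θ + τm - r) with h' | h'
    · exact hlow' t ⟨h, h'⟩
    · linarith [hb'' t ⟨h', ht.2⟩]
  · rcases le_total t (θ - τp + r) with h | h
    · have h1 := ha'' (t + T) ⟨by linarith [ht.1], by linarith⟩
      have h2 := hper (t + T)
      rw [add_sub_cancel_right] at h2
      linarith
    rcases le_total t (θ - r) with h' | h'
    · exact hupp' t ⟨h, h'⟩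
    · linarith [hb' t ⟨h', ht.2⟩]

end Window

section Orbit

variable {Xp Xm X : ℝ → Plane → Plane} {hp hm : ℝ → Plane → ℝ → Plane} {D : Set Plane}
  {u w : ℝ → Plane} {σ η r ηm ηp rm rp θ₀ x₀ ε θ x : ℝ} {Z Zp Zm : ℝ → ℝ × ℝ × ℝ → Plane}
  {τ τp τm : ℝ × ℝ × ℝ → ℝ} {q : ℝ × ℝ × ℝ}

@[simp] lemma R_R (z : Plane) : R (R z) = z := by
  simp [R]

lemma R_eq_self {z : Plane} (hz : z.2 = 0) : R z = z := by
  ext <;> simp [R, hz]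

lemma _root_.HasDerivAt.planeReflection {f : ℝ → Plane} {f' : Plane} {t : ℝ} (h : HasDerivAt f f' t) :
    HasDerivAt (fun t => R (f t)) (R f') t :=
  ((ContinuousLinearMap.fst ℝ ℝ ℝ).prod
    (-(ContinuousLinearMap.snd ℝ ℝ ℝ))).hasFDerivAt.comp_hasDerivAt t h

lemma eqOn_Icc_of_solution_right {a b : ℝ} (hD : IsOpen D)
    (hX : ContDiffOn ℝ 1 (fun p : ℝ × Plane => X p.1 p.2) (univ ×ˢ D))
    (hu : ∀ t ∈ Icc a b, u t ∈ D ∧ HasDerivWithinAt u (X t (u t)) (Icc a b) t)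
    (hw : ∀ t ∈ Icc a b, w t ∈ D ∧ HasDerivWithinAt w (X t (w t)) (Icc a b) t)
    (h : u b = w b) : EqOn u w (Icc a b) := by
  have hX' : ContDiffOn ℝ 1 (fun p : ℝ × Plane => -X (-p.1) p.2) (univ ×ˢ D) :=
    (hX.comp (f := fun p : ℝ × Plane => (-p.1, p.2)) (by fun_prop)
      fun p hp => ⟨mem_univ _, hp.2⟩).neg
  have hmaps : MapsTo (fun t : ℝ => -t) (Icc (-b) (-a)) (Icc a b) := fun t ht =>
    ⟨by linarith [ht.2], by linarith [ht.1]⟩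
  have hrev : ∀ {v : ℝ → Plane}, (∀ t ∈ Icc a b, v t ∈ D ∧
      HasDerivWithinAt v (X t (v t)) (Icc a b) t) → ∀ t ∈ Icc (-b) (-a), v (-t) ∈ D ∧
      HasDerivWithinAt (fun t => v (-t)) (-X (-t) (v (-t))) (Icc (-b) (-a)) t := by
    intro v hv t ht
    obtain ⟨h1, h2⟩ := hv (-t) (hmaps ht)
    have h3 := h2.scomp t (hasDerivAt_neg t).hasDerivWithinAt hmaps
    rw [neg_one_smul] at h3
    exact ⟨h1, h3⟩
  have := eqOn_Icc_of_solution (X := fun t z => -X (-t) z) hD hX' (hrev hu) (hrev hw)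
    (by simpa using h)
  intro t ht
  have h1 := this (x := -t) ⟨by linarith [ht.2], by linarith [ht.1]⟩
  simpa using h1

lemma IsReturnArc.hasDerivAt_lower (hZ : IsReturnArc hm D 1 σ η r θ₀ x₀ Z τ)
    (hq : q ∈ Metric.ball (0, θ₀, x₀) r) (hX : ∀ t, ∀ z ∈ D, X t z = hm t z q.1) {t : ℝ}
    (ht : t - q.2.1 ∈ Ioo (-η) (σ + η)) : Z (t - q.2.1) q ∈ D ∧
      HasDerivAt (fun t => Z (t - q.2.1) q) (X t (Z (t - q.2.1) q)) t := by
  have hD := hZ.mem q hq _ ht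
  have h1 := (hZ.deriv q hq _ ht).comp_sub_const t q.2.1
  rw [one_mul, add_sub_cancel] at h1
  rw [hX t _ hD]
  exact ⟨hD, h1⟩

lemma IsReturnArc.hasDerivAt_upper (hZ : IsReturnArc hp D (-1) σ η r θ₀ x₀ Z τ)
    (hDR : ∀ z ∈ D, R z ∈ D)
    (hq : q ∈ Metric.ball (0, θ₀, x₀) r) (hX : ∀ t, ∀ z ∈ D, X t z = -R (hp t (R z) q.1)) {t : ℝ}
    (ht : q.2.1 - t ∈ Ioo (-η) (σ + η)) : R (Z (q.2.1 - t) q) ∈ D ∧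
      HasDerivAt (fun t => R (Z (q.2.1 - t) q)) (X t (R (Z (q.2.1 - t) q))) t := by
  have hD := hDR _ (hZ.mem q hq _ ht)
  have h1 := ((hZ.deriv q hq _ ht).comp_const_sub q.2.1 t).planeReflection
  rw [show q.2.1 + -1 * (q.2.1 - t) = t by ring] at h1
  rw [hX t _ hD, R_R]
  refine ⟨hD, ?_⟩
  convert h1 using 1
  simp [R]

/-- A zero of the return time and exit point equations gives a crossing periodic solution, which is
isolated if the zero is. -/
lemma exists_isolated_periodicSolution (hD : IsOpen D) (hDR : ∀ z ∈ D, R z ∈ D)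
    (hZm : IsReturnArc hm D 1 σ ηm rm θ₀ x₀ Zm τm) (hZp : IsReturnArc hp D (-1) σ ηp rp θ₀ x₀ Zp τp)
    (hXp : ContDiffOn ℝ 1 (fun p : ℝ × Plane => Xp p.1 p.2) (univ ×ˢ D))
    (hXm : ContDiffOn ℝ 1 (fun p : ℝ × Plane => Xm p.1 p.2) (univ ×ˢ D))
    (hperp : ∀ t, ∀ z ∈ D, Xp (t + 2 * σ) z = Xp t z)
    (hperm : ∀ t, ∀ z ∈ D, Xm (t + 2 * σ) z = Xm t z)
    (hXm_eq : ∀ t, ∀ z ∈ D, Xm t z = hm t z ε) (hXp_eq : ∀ t, ∀ z ∈ D, Xp t z = -R (hp t (R z) ε))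
    (hqm : (ε, θ, x) ∈ Metric.ball (0, θ₀, x₀) rm) (hqp : (ε, θ, x) ∈ Metric.ball (0, θ₀, x₀) rp)
    (hS : τm (ε, θ, x) + τp (ε, θ, x) = 2 * σ)
    (hP : exitPoint Zm τm (ε, θ, x) = exitPoint Zp τp (ε, θ, x))
    (huniq : ∀ᶠ p in 𝓝 (θ, x), τm (ε, p) + τp (ε, p) = 2 * σ →
      exitPoint Zm τm (ε, p) = exitPoint Zp τp (ε, p) → p = (θ, x)) :
    ∃ w, w θ = (x, 0) ∧ IsPeriodicSolution Xp Xm D (2 * σ) w ∧ IsCrossing Xp Xm w ∧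
      IsIsolated Xp Xm D (2 * σ) w := by
  set q : ℝ × ℝ × ℝ := (ε, θ, x) with hq
  have hτm := hZm.τ_pos q hqm
  have hτp := hZp.τ_pos q hqp
  have hτm' := hZm.τ_lt q hqm
  have hτp' := hZp.τ_lt q hqp
  have hηm := hZm.η_pos
  have hηp := hZp.η_pos
  have hT0 : 0 < 2 * σ := by linarith
  have hc₁ : ∀ t ∈ Icc θ (θ + τm q), Zm (t - θ) q ∈ D ∧
      HasDerivAt (fun t => Zm (t - θ) q) (Xm t (Zm (t - θ) q)) t := fun t ht =>
    hZm.hasDerivAt_lower hqm hXm_eq ⟨by simp only [hq]; linarith [ht.1], by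
      simp only [hq] at hτm' ht ⊢; linarith [ht.2]⟩
  have hc₂ : ∀ t ∈ Icc (θ - τp q) θ, R (Zp (θ - t) q) ∈ D ∧
      HasDerivAt (fun t => R (Zp (θ - t) q)) (Xp t (R (Zp (θ - t) q))) t := fun t ht =>
    hZp.hasDerivAt_upper hDR hqp hXp_eq ⟨by simp only [hq]; linarith [ht.2], by
      simp only [hq] at hτp' ht ⊢; linarith [ht.1]⟩
  have hhitm := hZm.hits q hqm
  have hhitp := hZp.hits q hqp
  have hexit : Zm (τm q) q = R (Zp (τp q) q) := by
    rw [R_eq_self hhitp]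
    exact Prod.ext hP (hhitm.trans hhitp.symm)
  have hzm : Zm 0 q = (x, 0) := hZm.zero q
  have hzp : Zp 0 q = (x, 0) := hZp.zero q
  obtain ⟨w, hw, hw₁, hw₂⟩ := exists_periodic_glue (c₁ := fun t => Zm (t - θ) q)
    (c₂ := fun t => R (Zp (θ - t) q)) hτm hτp hS hXp hXm hperp hperm hc₁ hc₂
    (by simp [hzm, hzp, R]) (by simpa using hexit)
    (fun t ht => hZm.below q hqm _ ⟨by linarith [ht.1], by linarith [ht.2]⟩)
    (fun t ht => by
      have := hZp.below q hqp (θ - t) ⟨by linarith [ht.2], by linarith [ht.1]⟩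
      simpa [R] using this) (by simp [hzm]) (by simpa using hhitm)
  have hwθ : w θ = (x, 0) := by
    rw [hw₁ ⟨le_rfl, by linarith⟩]
    simp [hzm]
  have hwb : w (θ + τm q) = Zm (τm q) q := by
    rw [hw₁ ⟨by linarith, le_rfl⟩]
    simp
  have hneg : ∀ t ∈ Ioo θ (θ + τm q), (w t).2 < 0 := fun t ht => by
    rw [hw₁ (Ioo_subset_Icc_self ht)]
    exact hZm.below q hqm _ ⟨by linarith [ht.1], by linarith [ht.2]⟩
  have hpos : ∀ t ∈ Ioo (θ - τp q) θ, 0 < (w t).2 := fun t ht => by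
    rw [hw₂ (Ioo_subset_Icc_self ht)]
    have := hZp.below q hqp (θ - t) ⟨by linarith [ht.2], by linarith [ht.1]⟩
    simpa [R] using this
  have hdown : (Xp θ (w θ)).2 < 0 ∧ (Xm θ (w θ)).2 < 0 := by
    rw [hXm_eq _ _ (hw.mem θ), hXp_eq _ _ (hw.mem θ), hwθ, R_eq_self (z := (x, 0)) rfl]
    refine ⟨?_, hZm.down q hqm⟩
    have := hZp.down q hqp
    simpa [R] using this
  have hup : 0 < (Xp (θ + τm q) (w (θ + τm q))).2 ∧ 0 < (Xm (θ + τm q) (w (θ + τm q))).2 := by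
    constructor
    · have h1 := hZp.up q hqp
      have h2 : θ + τm q = q.2.1 + -1 * τp q + 2 * σ := by
        rw [← hS]
        simp only [hq]
        ring
      have h3 := hw.mem (θ + τm q)
      rw [hwb] at h3 ⊢
      rw [h2, hperp _ _ h3, hXp_eq _ _ h3, hexit, R_R]
      simpa [R] using h1
    · have h1 := hZm.up q hqm
      rw [hXm_eq _ _ (hw.mem _), hwb]
      simpa [hq] using h1
  have hcr : IsCrossing Xp Xm w := by
    intro t ht
    obtain ⟨k, hk, -⟩ := existsUnique_sub_zsmul_mem_Ioc hT0 t (θ - τp q)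
    have hwk : w (t - k • (2 * σ)) = w t := Function.Periodic.sub_zsmul_eq hw.periodic k
    rw [← field_sub_zsmul hperp (hw.mem t) t k, ← field_sub_zsmul hperm (hw.mem t) t k]
    rw [← hwk] at ht ⊢
    set s := t - k • (2 * σ)
    rcases lt_trichotomy s θ with h | h | h
    · exact absurd ht (hpos s ⟨hk.1, h⟩).ne'
    · rw [h]
      exact mul_pos_of_neg_of_neg hdown.1 hdown.2
    · have hsle : s ≤ θ + τm q := by linarith [hk.2]
      rcases hsle.lt_or_eq with h' | h'
      · exact absurd ht (hneg s ⟨h, h'⟩).ne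
      · rw [h']
        exact mul_pos hup.1 hup.2
  refine ⟨w, hwθ, hw, hcr, ?_⟩
  have hcont : Continuous fun p : ℝ × ℝ => (ε, p) := by fun_prop
  have hevm : ∀ᶠ p in 𝓝 (θ, x), (ε, p) ∈ Metric.ball (0, θ₀, x₀) rm :=
    hcont.continuousAt.eventually (Metric.isOpen_ball.mem_nhds hqm)
  have hevp : ∀ᶠ p in 𝓝 (θ, x), (ε, p) ∈ Metric.ball (0, θ₀, x₀) rp :=
    hcont.continuousAt.eventually (Metric.isOpen_ball.mem_nhds hqp)
  obtain ⟨ρ₁, hρ₁, hb⟩ := Metric.eventually_nhds_iff_ball.1 (huniq.and (hevm.and hevp))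
  obtain ⟨ρ, hρ, hρ1, hρm, hρp⟩ : ∃ ρ > 0, ρ < ρ₁ ∧ ρ < (σ + ηm - τm q) / 2 ∧
      ρ < (σ + ηp - τp q) / 2 := by
    obtain ⟨ρ, h0, h1⟩ := exists_between (lt_min hρ₁ (lt_min
      (by linarith : 0 < (σ + ηm - τm q) / 2) (by linarith : 0 < (σ + ηp - τp q) / 2)))
    simp only [lt_min_iff] at h1
    exact ⟨ρ, h0, h1.1, h1.2.1, h1.2.2⟩
  obtain ⟨δ, hδ, hpat⟩ := exists_crossing_pattern hD hτm hτp hS hXp hXm hw hcr hneg hpos hdown hup hρ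
  refine ⟨δ, hδ, fun u hu hex => ?_⟩
  obtain ⟨θ', θ'', hθ', hθ'', hdist, hlt, hlt', hz', hz'', hneg', hpos'⟩ := hpat u hu hex
  rw [abs_lt] at hθ' hθ''
  set x' := (u θ').1 with hx'
  have huθ' : u θ' = (x', 0) := Prod.ext rfl hz'
  have hmem : (θ', x') ∈ Metric.ball (θ, x) ρ₁ := by
    rw [← ball_prod_same]
    refine ⟨?_, ?_⟩
    · rw [Metric.mem_ball, Real.dist_eq]
      exact (abs_lt.2 hθ').trans hρ1
    · have : dist x' x ≤ dist (u θ') (w θ) := by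
        rw [hwθ, Prod.dist_eq]
        exact le_max_left _ _
      rw [Metric.mem_ball]
      linarith
  obtain ⟨huq, hqm', hqp'⟩ := hb _ hmem
  set q' : ℝ × ℝ × ℝ := (ε, θ', x') with hq'
  have heqm : EqOn u (fun t => Zm (t - θ') q') (Icc θ' θ'') := by
    refine eqOn_Icc_of_solution hD hXm (fun t ht => ⟨hu.mem t,
      hu.isFilippovCurve.hasDerivWithinAt_lower hXm (fun t _ => hu.mem t) hneg' t ht⟩)
      (fun t ht => ?_) (by simp [huθ', hZm.zero, hq'])
    have := hZm.hasDerivAt_lower (t := t) hqm' hXm_eq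
      ⟨by simp only [hq']; linarith [ht.1], by simp only [hq']; linarith [ht.2]⟩
    exact ⟨this.1, this.2.hasDerivWithinAt⟩
  have heqp : EqOn u (fun t => R (Zp (θ' - t) q')) (Icc (θ'' - 2 * σ) θ') := by
    refine eqOn_Icc_of_solution_right hD hXp (fun t ht => ⟨hu.mem t,
      hu.isFilippovCurve.hasDerivWithinAt_upper hXp (fun t _ => hu.mem t) hpos' t ht⟩)
      (fun t ht => ?_) (by simp [huθ', hZp.zero, hq', R])
    have := hZp.hasDerivAt_upper (t := t) hDR hqp' hXp_eq
      ⟨by simp only [hq']; linarith [ht.2], by simp only [hq']; linarith [ht.1]⟩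
    exact ⟨this.1, this.2.hasDerivWithinAt⟩
  have hum : u θ'' = Zm (θ'' - θ') q' := heqm ⟨hlt.le, le_rfl⟩
  have hup' : u θ'' = R (Zp (θ' - (θ'' - 2 * σ)) q') := by
    have := hu.periodic (θ'' - 2 * σ)
    rw [sub_add_cancel] at this
    exact this.trans (heqp ⟨le_rfl, hlt'.le⟩)
  have htm : θ'' - θ' = τm q' := hZm.unique q' hqm' _ ⟨by linarith, by linarith⟩ (hum ▸ hz'')
  have htp : θ' - (θ'' - 2 * σ) = τp q' := by
    refine hZp.unique q' hqp' _ ⟨by linarith, by linarith⟩ ?_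
    rw [hup'] at hz''
    simpa [R] using hz''
  have hsol := huq (by
      rw [← htm, ← htp]
      ring) (by
    simp only [exitPoint, ← htm, ← htp]
    rw [← hum, hup', R])
  have hqq : q' = q := by rw [hq', hq, hsol]
  obtain ⟨hθθ, hxx⟩ := Prod.ext_iff.1 hsol
  change θ' = θ at hθθ
  rw [hqq, hθθ] at heqm heqp
  rw [hqq, hθθ] at htm htp
  funext t
  obtain ⟨k, hk, -⟩ := existsUnique_sub_zsmul_mem_Ico hT0 t (θ - τp q)
  rw [← Function.Periodic.sub_zsmul_eq hw.periodic k, ← Function.Periodic.sub_zsmul_eq hu.periodic k]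
  set s := t - k • (2 * σ)
  rcases le_total s θ with h | h
  · rw [hw₂ ⟨hk.1, h⟩, heqp ⟨by linarith [hk.1], h⟩]
  · rw [hw₁ ⟨h, by linarith [hk.2]⟩, heqm ⟨h, by linarith [hk.2]⟩]

end Orbit

section Setup

variable {F : Plane → Plane} {G g : ℝ → Plane → Plane} {H h : ℝ → Plane → ℝ → Plane} {D : Set Plane}
  {ε₀ : ℝ}

lemma contDiff_R {n : WithTop ℕ∞} : ContDiff ℝ n R := by
  unfold R
  fun_prop

lemma isPerturbation_perturbedField (hε₀ : 0 < ε₀) (hF : ContDiffOn ℝ 2 F D)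
    (hG : ContDiffOn ℝ ∞ (fun p : ℝ × Plane => G p.1 p.2) (univ ×ˢ D))
    (hH : ContDiffOn ℝ ∞ (fun p : ℝ × Plane × ℝ => H p.1 p.2.1 p.2.2)
      (univ ×ˢ D ×ˢ Ioo (-ε₀) ε₀)) :
    IsPerturbation (fun t z ε => perturbedField F G H ε t z) F G D ε₀ := by
  have h2 : (2 : WithTop ℕ∞) ≤ ∞ := WithTop.coe_le_coe.2 (le_top (a := (2 : ℕ∞)))
  refine ⟨?_, fun t z _ => by simp [perturbedField], fun t z hz => ?_⟩
  · have h1 : ContDiffOn ℝ 2 (fun e : ℝ × Plane × ℝ => F e.2.1) (univ ×ˢ D ×ˢ Ioo (-ε₀) ε₀) :=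
      hF.comp (f := fun e : ℝ × Plane × ℝ => e.2.1) (by fun_prop) fun e he => he.2.1
    have h3 : ContDiffOn ℝ 2 (fun e : ℝ × Plane × ℝ => G e.1 e.2.1) (univ ×ˢ D ×ˢ Ioo (-ε₀) ε₀) :=
      (hG.of_le h2).comp (f := fun e : ℝ × Plane × ℝ => (e.1, e.2.1)) (by fun_prop)
        fun e he => ⟨mem_univ _, he.2.1⟩
    have hε : ContDiffOn ℝ 2 (fun e : ℝ × Plane × ℝ => e.2.2) (univ ×ˢ D ×ˢ Ioo (-ε₀) ε₀) := by
      fun_prop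
    exact (h1.add (hε.smul h3)).add ((hε.pow 2).smul (hH.of_le h2))
  · have hHd : DifferentiableAt ℝ (fun ε => H t z ε) 0 := by
      have h3 : ContDiffOn ℝ ∞ (fun ε => H t z ε) (Ioo (-ε₀) ε₀) :=
        hH.comp (f := fun ε : ℝ => (t, z, ε)) (by fun_prop) fun ε hε => ⟨mem_univ _, hz, hε⟩
      exact (h3.contDiffAt (Ioo_mem_nhds (by linarith) hε₀)).differentiableAt (by simp)
    have := (((hasDerivAt_id (0 : ℝ)).smul_const (G t z)).const_add (F z)).add
      (((hasDerivAt_id (0 : ℝ)).pow 2).smul hHd.hasDerivAt)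
    exact this.congr_deriv (by simp)

lemma IsPerturbation.contDiffOn_slice (hp : IsPerturbation h F g D ε₀) {ε : ℝ}
    (hε : ε ∈ Ioo (-ε₀) ε₀) :
    ContDiffOn ℝ 1 (fun p : ℝ × Plane => h p.1 p.2 ε) (univ ×ˢ D) :=
  (hp.contDiffOn.of_le one_le_two).comp (f := fun p : ℝ × Plane => (p.1, p.2, ε)) (by fun_prop)
    fun p hp => ⟨mem_univ _, hp.2, hε⟩

/-- The reflection `-R G(t, R z)` of a field. -/
def reflectField (G : ℝ → Plane → Plane) (t : ℝ) (z : Plane) : Plane := -R (G t (R z))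

lemma contDiffOn_upperField {n : WithTop ℕ∞} (hDR : ∀ z ∈ D, R z ∈ D) (hF : ContDiffOn ℝ n F D) :
    ContDiffOn ℝ n (upperField F) D :=
  (contDiff_R.comp_contDiffOn (hF.comp contDiff_R.contDiffOn hDR)).neg

lemma contDiffOn_reflectField {n : WithTop ℕ∞} (hDR : ∀ z ∈ D, R z ∈ D)
    (hG : ContDiffOn ℝ n (fun p : ℝ × Plane => G p.1 p.2) (univ ×ˢ D)) :
    ContDiffOn ℝ n (fun p : ℝ × Plane => reflectField G p.1 p.2) (univ ×ˢ D) :=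
  (contDiff_R.comp_contDiffOn (hG.comp (f := fun p : ℝ × Plane => (p.1, R p.2))
    (contDiff_fst.prodMk (contDiff_R.comp contDiff_snd)).contDiffOn
      fun _ hp => ⟨mem_univ _, hDR _ hp.2⟩)).neg

lemma contDiffOn_reflectField_parameter {n : WithTop ℕ∞} {J : Set ℝ} (hDR : ∀ z ∈ D, R z ∈ D)
    (hH : ContDiffOn ℝ n (fun p : ℝ × Plane × ℝ => H p.1 p.2.1 p.2.2) (univ ×ˢ D ×ˢ J)) :
    ContDiffOn ℝ n (fun p : ℝ × Plane × ℝ => reflectField (fun t z => H t z p.2.2) p.1 p.2.1)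
      (univ ×ˢ D ×ˢ J) :=
  (contDiff_R.comp_contDiffOn (hH.comp (f := fun p : ℝ × Plane × ℝ => (p.1, R p.2.1, p.2.2))
    (contDiff_fst.prodMk ((contDiff_R.comp (contDiff_fst.comp contDiff_snd)).prodMk
      (contDiff_snd.comp contDiff_snd))).contDiffOn
      fun _ hp => ⟨mem_univ _, hDR _ hp.2.1, hp.2.2⟩)).neg

lemma perturbedField_upperField (ε t : ℝ) (z : Plane) :
    perturbedField (upperField F) G H ε t z =
      -R (perturbedField F (reflectField G) (fun t z ε => reflectField (fun t z => H t z ε) t z)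
        ε t (R z)) := by
  ext
  · simp [perturbedField, upperField, reflectField, R]
    ring
  · simp [perturbedField, upperField, reflectField, R]

lemma perturbedField_add_period {T ε : ℝ} (hε : ε ∈ Ioo (-ε₀) ε₀)
    (hG : ∀ t, ∀ z ∈ D, G (t + T) z = G t z)
    (hH : ∀ t, ∀ z ∈ D, ∀ ε ∈ Ioo (-ε₀) ε₀, H (t + T) z ε = H t z ε) (t : ℝ) (z : Plane) (hz : z ∈ D) :
    perturbedField F G H ε (t + T) z = perturbedField F G H ε t z := by
  simp only [perturbedField, hG t z hz, hH t z hz ε hε]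

lemma nonpos_of_hasDerivWithinAt_left {y : ℝ → ℝ} {y' T : ℝ} (hT : 0 < T)
    (hy : HasDerivWithinAt y y' (Icc 0 T) 0) (h0 : y 0 = 0) (hneg : ∀ t ∈ Ioo 0 T, y t < 0) :
    y' ≤ 0 := by
  have h1 := (hasDerivWithinAt_iff_tendsto_slope' (s := Ioo 0 T) (by simp)).1
    (hy.mono Ioo_subset_Icc_self)
  have := left_nhdsWithin_Ioo_neBot hT
  refine le_of_tendsto h1 (eventually_nhdsWithin_of_forall fun t ht => ?_)
  rw [slope_def_field, h0, sub_zero, sub_zero]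
  exact (div_neg_of_neg_of_pos (hneg t ht) ht.1).le

lemma nonneg_of_hasDerivWithinAt_right {y : ℝ → ℝ} {y' T : ℝ} (hT : 0 < T)
    (hy : HasDerivWithinAt y y' (Icc 0 T) T) (h0 : y T = 0) (hneg : ∀ t ∈ Ioo 0 T, y t < 0) :
    0 ≤ y' := by
  have h1 := (hasDerivWithinAt_iff_tendsto_slope' (s := Ioo 0 T) (by simp)).1
    (hy.mono Ioo_subset_Icc_self)
  have := right_nhdsWithin_Ioo_neBot hT
  refine ge_of_tendsto h1 (eventually_nhdsWithin_of_forall fun t ht => ?_)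
  rw [slope_def_field, h0, sub_zero]
  exact (div_pos_of_neg_of_neg (hneg t ht) (by linarith [ht.2])).le

lemma exists_arcs_of_returnCondition {κ θ₀ xi xv x : ℝ} (hp : IsPerturbation h F g D ε₀)
    (hD : IsOpen D) (hε₀ : 0 < ε₀) (h1 : FoldCondition F D xi xv) (h2 : ReturnCondition F D xi xv)
    (hx : x ∈ Ioo xi xv) :
    ∃ ζ τ η η' r r', IsArcFlow h D κ (halfReturnTime F D x) η r (θ₀, (x, 0), 0) ζ ∧ r' ≤ r ∧
      IsReturnArc h D κ (halfReturnTime F D x) η' r' θ₀ x (fun s q => ζ s (arcData q)) τ ∧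
      0 < (F (flow F D (halfReturnTime F D x) (x, 0))).2 := by
  have hx' : x ∈ Ioc xi xv := Ioo_subset_Ioc_self hx
  have hT := h2.pos x hx'
  have hbelow := h2.below x hx'
  have hhit := h2.hits x hx'
  have htr := h2.transverse x hx'
  obtain ⟨c, hc⟩ := h2.exists_solution x hx'
  have hflow : ∀ t ∈ Icc 0 (halfReturnTime F D x), flow F D t (x, 0) = c t := fun t ht =>
    flow_eq_of_isSolutionCurve hD ((hp.contDiffOn_field hε₀).of_le one_le_two) hc ht
  set T := halfReturnTime F D x
  have hTm : T ∈ Icc 0 T := ⟨hT.le, le_rfl⟩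
  obtain ⟨hc0, hcs⟩ := hc
  rw [uIcc_of_le hT.le] at hcs
  have hcb : ∀ t ∈ Ioo 0 T, (c t).2 < 0 := fun t ht => by
    rw [← hflow t (Ioo_subset_Icc_self ht)]
    exact hbelow t ht
  have hcy : ∀ t ∈ Icc 0 T, HasDerivWithinAt (fun t => (c t).2) (F (c t)).2 (Icc 0 T) t :=
    fun t ht => (ContinuousLinearMap.snd ℝ ℝ ℝ).hasFDerivAt.comp_hasDerivWithinAt t (hcs t ht).2
  have hdown : (F (x, 0)).2 < 0 := by
    have := nonpos_of_hasDerivWithinAt_left hT (hcy 0 ⟨le_rfl, hT.le⟩) (by simp [hc0]) hcb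
    rw [hc0] at this
    exact lt_of_le_of_ne this (h1.ne_zero x hx)
  have hup : 0 < (F (flow F D T (x, 0))).2 := by
    have := nonneg_of_hasDerivWithinAt_right hT (hcy T hTm) (by rw [← hflow T hTm, hhit]) hcb
    rw [← hflow T hTm] at this
    exact lt_of_le_of_ne this htr.symm
  obtain ⟨ζ, η, r, hζ, -⟩ := exists_isArcFlow (h := h) (κ := κ) (θ₀ := θ₀) hD hε₀ hT.le hp.contDiffOn
    (fun t ht => ⟨(hcs t ht).1, by
      have := (hcs t ht).2
      rwa [← hp.zero (θ₀ + κ * t) _ (hcs t ht).1] at this⟩)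
  rw [hc0] at hζ
  obtain ⟨τ, η', r', -, hr', hZ⟩ := hζ.exists_isReturnArc hp hD hε₀ hT hdown hup hhit hbelow
  exact ⟨ζ, τ, η, η', r, r', hζ, hr', hZ, hup⟩

end Setup

section Melnikov

variable {F : Plane → Plane} {Gp Gm : ℝ → Plane → Plane} {hm hp : ℝ → Plane → ℝ → Plane}
  {D : Set Plane} {ε₀ σ ηm ηp rm rp ηm' ηp' rm' rp' θ₀ x₀ : ℝ} {ζm ζp : ℝ → ℝ × Plane × ℝ → Plane}
  {τm τp : ℝ × ℝ × ℝ → ℝ}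

/-- To first order in `ε`, the Melnikov function measures the distance between the two exit points. -/
lemma fderiv_exitPoint_sub
    (hζm : IsArcFlow hm D 1 σ ηm rm (θ₀, (x₀, 0), 0) ζm) (hrm : rm' ≤ rm)
    (hZm : IsReturnArc hm D 1 σ ηm' rm' θ₀ x₀ (fun s q => ζm s (arcData q)) τm)
    (hpm : IsPerturbation hm F Gm D ε₀)
    (hζp : IsArcFlow hp D (-1) σ ηp rp (θ₀, (x₀, 0), 0) ζp) (hrp : rp' ≤ rp)
    (hZp : IsReturnArc hp D (-1) σ ηp' rp' θ₀ x₀ (fun s q => ζp s (arcData q)) τp)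
    (hpp : IsPerturbation hp F (reflectField Gp) D ε₀)
    (hD : IsOpen D) (hε₀ : 0 < ε₀) (hσ0 : 0 < σ) (hσ : halfReturnTime F D x₀ = σ) :
    ∀ᶠ θ in 𝓝 θ₀, fderiv ℝ (fun q => exitPoint (fun s q => ζm s (arcData q)) τm q -
        exitPoint (fun s q => ζp s (arcData q)) τp q) (0, θ, x₀) (1, 0, 0) =
      -melnikov F D Gp Gm θ x₀ / (F (flow F D σ (x₀, 0))).2 := by
  have htend : Tendsto (fun θ : ℝ => ((0, θ, x₀) : ℝ × ℝ × ℝ)) (𝓝 θ₀) (𝓝 (0, θ₀, x₀)) :=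
    (by fun_prop : Continuous fun θ : ℝ => ((0, θ, x₀) : ℝ × ℝ × ℝ)).tendsto θ₀
  filter_upwards [htend.eventually (hZm.contDiffAt_exitPoint.eventually (by simp)),
    htend.eventually (hZp.contDiffAt_exitPoint.eventually (by simp)),
    hZm.fderiv_exitPoint hζm hrm hpm hD hε₀ hσ0 hσ, hZp.fderiv_exitPoint hζp hrp hpp hD hε₀ hσ0 hσ,
    Metric.ball_mem_nhds θ₀ hζm.r_pos, Metric.ball_mem_nhds θ₀ hζp.r_pos]
    with θ hdm hdp hfm hfp hθm hθp
  have hsub := fderiv_fun_sub (hdm.differentiableAt two_ne_zero) (hdp.differentiableAt two_ne_zero)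
  rw [hsub, sub_apply, hfm, hfp, ← sub_div]
  congr 1
  have hint : ∀ {κ η r : ℝ} {h : ℝ → Plane → ℝ → Plane} {g : ℝ → Plane → Plane}
      {ζ : ℝ → ℝ × Plane × ℝ → Plane}, IsArcFlow h D κ σ η r (θ₀, (x₀, 0), 0) ζ →
      IsPerturbation h F g D ε₀ → θ ∈ Metric.ball θ₀ r → IntervalIntegrable (fun t =>
        (Y F D t (x₀, 0)).inverse (g (θ + κ * t) (flow F D t (x₀, 0)))) volume 0 σ := by
    intro κ η r h g ζ hζ hp hθ
    have := hζ.continuousOn_inverse_apply hp hD hε₀ hθ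
    rw [← uIcc_of_le hσ0.le] at this
    exact this.intervalIntegrable
  have hI : ∫ t in (0 : ℝ)..σ, (Y F D t (x₀, 0)).inverse
        (reversibilityDefect Gp Gm θ t (orbit F D t x₀)) =
      (∫ t in (0 : ℝ)..σ, (Y F D t (x₀, 0)).inverse (Gm (θ + 1 * t) (flow F D t (x₀, 0)))) -
      ∫ t in (0 : ℝ)..σ, (Y F D t (x₀, 0)).inverse
        (reflectField Gp (θ + -1 * t) (flow F D t (x₀, 0))) := by
    rw [← intervalIntegral.integral_sub (hint hζm hpm hθm) (hint hζp hpp hθp)]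
    refine intervalIntegral.integral_congr fun t ht => ?_
    rw [uIcc_of_le hσ0.le] at ht
    rw [← map_sub, orbit, if_pos ht.1, reversibilityDefect, reflectField, sub_neg_eq_add, one_mul,
      neg_one_mul, add_comm t, add_comm (-t)]
  rw [melnikov, hσ, hI, map_sub, orbit, if_pos hσ0.le]
  simp only [wedge, Prod.fst_sub, Prod.snd_sub]
  ring

/-- The return time and exit point equations have a unique solution near the base point for
small `ε > 0`. -/
lemma exists_branch_of_melnikov
    (hζm : IsArcFlow hm D 1 σ ηm rm (θ₀, (x₀, 0), 0) ζm) (hrm : rm' ≤ rm)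
    (hZm : IsReturnArc hm D 1 σ ηm' rm' θ₀ x₀ (fun s q => ζm s (arcData q)) τm)
    (hpm : IsPerturbation hm F Gm D ε₀)
    (hζp : IsArcFlow hp D (-1) σ ηp rp (θ₀, (x₀, 0), 0) ζp) (hrp : rp' ≤ rp)
    (hZp : IsReturnArc hp D (-1) σ ηp' rp' θ₀ x₀ (fun s q => ζp s (arcData q)) τp)
    (hpp : IsPerturbation hp F (reflectField Gp) D ε₀)
    (hD : IsOpen D) (hε₀ : 0 < ε₀) (hσ0 : 0 < σ) (hσ : halfReturnTime F D x₀ = σ)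
    (hσ' : deriv (halfReturnTime F D) x₀ ≠ 0) (hF2 : (F (flow F D σ (x₀, 0))).2 ≠ 0)
    (hM : melnikov F D Gp Gm θ₀ x₀ = 0)
    (hM' : deriv (fun θ : ℝ => melnikov F D Gp Gm θ x₀) θ₀ ≠ 0) :
    ∃ C > 0, ∃ ρ > 0, ∃ ε₁ > 0, ∀ ε ∈ Ioo 0 ε₁, ∃ θ x, |θ - θ₀| ≤ C * ε ∧ |x - x₀| ≤ C * ε ∧
      τm (ε, θ, x) + τp (ε, θ, x) - 2 * σ = 0 ∧
      exitPoint (fun s q => ζm s (arcData q)) τm (ε, θ, x) -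
        exitPoint (fun s q => ζp s (arcData q)) τp (ε, θ, x) = 0 ∧
      ∀ θ' x', |θ' - θ₀| < ρ → |x' - x₀| < ρ → τm (ε, θ', x') + τp (ε, θ', x') - 2 * σ = 0 →
        exitPoint (fun s q => ζm s (arcData q)) τm (ε, θ', x') -
          exitPoint (fun s q => ζp s (arcData q)) τp (ε, θ', x') = 0 → θ' = θ ∧ x' = x := by
  have hS : ContDiffAt ℝ 2 (fun q => τm q + τp q - 2 * σ) (0, θ₀, x₀) :=
    (hZm.contDiffAt_τ.add hZp.contDiffAt_τ).sub contDiffAt_const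
  have hcont : Continuous fun p : ℝ × ℝ => ((0, p) : ℝ × ℝ × ℝ) := by fun_prop
  have hev : ∀ᶠ p : ℝ × ℝ in 𝓝 (θ₀, x₀), (0, p) ∈ Metric.ball ((0, θ₀, x₀) : ℝ × ℝ × ℝ) rm' ∧
      (0, p) ∈ Metric.ball ((0, θ₀, x₀) : ℝ × ℝ × ℝ) rp' := by
    filter_upwards [hcont.tendsto (θ₀, x₀) (Metric.ball_mem_nhds _ hZm.r_pos),
      hcont.tendsto (θ₀, x₀) (Metric.ball_mem_nhds _ hZp.r_pos)] with p h1 h2 using ⟨h1, h2⟩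
  have hSeq : ∀ᶠ p : ℝ × ℝ in 𝓝 (θ₀, x₀),
      τm (0, p) + τp (0, p) - 2 * σ = 2 * halfReturnTime F D p.2 - 2 * σ := by
    filter_upwards [hev] with p hp
    rw [hZm.τ_eq hpm hD hε₀ hp.1, hZp.τ_eq hpp hD hε₀ hp.2]
    ring
  have hSd := (hS.differentiableAt two_ne_zero).hasFDerivAt
  have hmel := fderiv_exitPoint_sub hζm hrm hZm hpm hζp hrp hZp hpp hD hε₀ hσ0 hσ
  refine exists_branch (S := fun q => τm q + τp q - 2 * σ) (hS.of_le one_le_two)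
    (hZm.contDiffAt_exitPoint.sub hZp.contDiffAt_exitPoint) ?_ ?_ ?_ ?_ ?_ ?_
  · rw [hSeq.self_of_nhds, hσ, sub_self]
  · have h1 : HasDerivAt (fun θ : ℝ => τm (0, θ, x₀) + τp (0, θ, x₀) - 2 * σ) _ θ₀ :=
      hSd.comp_hasDerivAt (f := fun θ : ℝ => ((0, θ, x₀) : ℝ × ℝ × ℝ)) θ₀
        ((hasDerivAt_const _ _).prodMk ((hasDerivAt_id _).prodMk (hasDerivAt_const _ _)))
    refine h1.unique ((hasDerivAt_const θ₀ (0 : ℝ)).congr_of_eventuallyEq ?_)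
    have : Tendsto (fun θ : ℝ => (θ, x₀)) (𝓝 θ₀) (𝓝 (θ₀, x₀)) :=
      (by fun_prop : Continuous fun θ : ℝ => (θ, x₀)).tendsto θ₀
    filter_upwards [this.eventually hSeq] with θ hθ
    rw [hθ, hσ, sub_self]
  · have h1 : HasDerivAt (fun x : ℝ => τm (0, θ₀, x) + τp (0, θ₀, x) - 2 * σ) _ x₀ :=
      hSd.comp_hasDerivAt (f := fun x : ℝ => ((0, θ₀, x) : ℝ × ℝ × ℝ)) x₀
        ((hasDerivAt_const _ _).prodMk ((hasDerivAt_const _ _).prodMk (hasDerivAt_id _)))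
    have h2 : HasDerivAt (fun x => 2 * halfReturnTime F D x - 2 * σ)
        (2 * deriv (halfReturnTime F D) x₀) x₀ :=
      ((differentiableAt_of_deriv_ne_zero hσ').hasDerivAt.const_mul 2).sub_const _
    have : Tendsto (fun x : ℝ => (θ₀, x)) (𝓝 x₀) (𝓝 (θ₀, x₀)) :=
      (by fun_prop : Continuous fun x : ℝ => (θ₀, x)).tendsto x₀
    rw [h1.unique (h2.congr_of_eventuallyEq (this.eventually hSeq))]
    exact mul_ne_zero two_ne_zero hσ'
  · filter_upwards [hev] with p hp
    rw [hZm.exitPoint_eq hpm hD hε₀ hp.1, hZp.exitPoint_eq hpp hD hε₀ hp.2, sub_self]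
  · rw [hmel.self_of_nhds, hM, neg_zero, zero_div]
  · rw [EventuallyEq.deriv_eq hmel, deriv_div_const, deriv.fun_neg]
    exact div_ne_zero (neg_ne_zero.2 hM') hF2

end Melnikov

end TwoFold

end

open TwoFold
theorem theoremA
    (D : Set Plane) (hD_open : IsOpen D) (hD_bdd : Bornology.IsBounded D)
    (hD_symm : ∀ z ∈ D, R z ∈ D)
    (F : Plane → Plane) (hF : ContDiffOn ℝ 2 F D)
    (xi xv : ℝ) (h1 : FoldCondition F D xi xv) (h2 : ReturnCondition F D xi xv)
    (xσ σ : ℝ) (hxσ : xσ ∈ Ioo xi xv) (hσ : halfReturnTime F D xσ = σ)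
    (hσ' : deriv (halfReturnTime F D) xσ ≠ 0)
    (ε₀ : ℝ) (hε₀ : 0 < ε₀)
    (Gp Gm : ℝ → Plane → Plane)
    (hGp : ContDiffOn ℝ ∞ (fun p : ℝ × Plane => Gp p.1 p.2) (univ ×ˢ D))
    (hGm : ContDiffOn ℝ ∞ (fun p : ℝ × Plane => Gm p.1 p.2) (univ ×ˢ D))
    (Hp Hm : ℝ → Plane → ℝ → Plane)
    (hHp : ContDiffOn ℝ ∞ (fun p : ℝ × Plane × ℝ => Hp p.1 p.2.1 p.2.2)
      (univ ×ˢ D ×ˢ Ioo (-ε₀) ε₀))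
    (hHm : ContDiffOn ℝ ∞ (fun p : ℝ × Plane × ℝ => Hm p.1 p.2.1 p.2.2)
      (univ ×ˢ D ×ˢ Ioo (-ε₀) ε₀))
    (hGp_per : ∀ t, ∀ z ∈ D, Gp (t + 2 * σ) z = Gp t z)
    (hGm_per : ∀ t, ∀ z ∈ D, Gm (t + 2 * σ) z = Gm t z)
    (hHp_per : ∀ t, ∀ z ∈ D, ∀ ε ∈ Ioo (-ε₀) ε₀, Hp (t + 2 * σ) z ε = Hp t z ε)
    (hHm_per : ∀ t, ∀ z ∈ D, ∀ ε ∈ Ioo (-ε₀) ε₀, Hm (t + 2 * σ) z ε = Hm t z ε)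
    (θstar : ℝ) (hM : melnikov F D Gp Gm θstar xσ = 0)
    (hM' : deriv (fun θ : ℝ => melnikov F D Gp Gm θ xσ) θstar ≠ 0) :
    ∃ C > 0, ∃ ε₁ > 0, ε₁ ≤ ε₀ ∧ ∀ ε ∈ Ioo 0 ε₁,
      ∃ (θ x : ℝ) (w : ℝ → Plane),
        |θ - θstar| ≤ C * ε ∧ |x - xσ| ≤ C * ε ∧ w θ = (x, 0) ∧
        IsPeriodicSolution (perturbedField (upperField F) Gp Hp ε) (perturbedField F Gm Hm ε)
          D (2 * σ) w ∧
        IsCrossing (perturbedField (upperField F) Gp Hp ε) (perturbedField F Gm Hm ε) w ∧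
        IsIsolated (perturbedField (upperField F) Gp Hp ε) (perturbedField F Gm Hm ε)
          D (2 * σ) w := by
  have hpm := isPerturbation_perturbedField hε₀ hF hGm hHm
  have hpp := isPerturbation_perturbedField hε₀ hF (contDiffOn_reflectField hD_symm hGp)
    (H := fun t z ε => reflectField (fun t z => Hp t z ε) t z)
    (contDiffOn_reflectField_parameter hD_symm hHp)
  have hpu := isPerturbation_perturbedField hε₀ (contDiffOn_upperField hD_symm hF) hGp hHp
  have hσ0 : 0 < σ := hσ ▸ h2.pos xσ (Ioo_subset_Ioc_self hxσ)
  obtain ⟨ζm, τm, ηm, ηm', rm, rm', hζm, hrm, hZm, hF2⟩ :=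
    exists_arcs_of_returnCondition (κ := 1) (θ₀ := θstar) hpm hD_open hε₀ h1 h2 hxσ
  obtain ⟨ζp, τp, ηp, ηp', rp, rp', hζp, hrp, hZp, -⟩ :=
    exists_arcs_of_returnCondition (κ := -1) (θ₀ := θstar) hpp hD_open hε₀ h1 h2 hxσ
  rw [hσ] at hζm hZm hζp hZp hF2
  obtain ⟨C, hC, ρ, hρ, ε₁, hε₁, hbranch⟩ := exists_branch_of_melnikov hζm hrm hZm hpm hζp hrp hZp hpp
    hD_open hε₀ hσ0 hσ hσ' hF2.ne' hM hM'
  have hr : 0 < min (min rm' rp') ρ := lt_min (lt_min hZm.r_pos hZp.r_pos) hρ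
  refine ⟨C, hC, min (min ε₁ ε₀) (min (min rm' rp') ρ / (C + 1)),
    lt_min (lt_min hε₁ hε₀) (div_pos hr (by linarith)),
    (min_le_left _ _).trans (min_le_right _ _), fun ε hε => ?_⟩
  obtain ⟨hε0, hεlt⟩ := hε
  rw [lt_min_iff, lt_min_iff, lt_div_iff₀ (by linarith), lt_min_iff, lt_min_iff] at hεlt
  obtain ⟨⟨hεε₁, hεε₀⟩, ⟨hεm, hεp⟩, hερ⟩ := hεlt
  obtain ⟨θ, x, hθ, hx, hS, hP, huniq⟩ := hbranch ε ⟨hε0, hεε₁⟩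
  have hCε : 0 < C * ε := mul_pos hC hε0
  have hlt : ∀ {r : ℝ}, ε * (C + 1) < r → C * ε < r ∧ ε < r := fun {r} h =>
    ⟨by linarith, by linarith⟩
  have hball : ∀ {r : ℝ}, ε * (C + 1) < r →
      ((ε, θ, x) : ℝ × ℝ × ℝ) ∈ Metric.ball (0, θstar, xσ) r := by
    intro r h
    rw [Metric.mem_ball, Prod.dist_eq, Prod.dist_eq, Real.dist_eq, Real.dist_eq, Real.dist_eq]
    refine max_lt ?_ (max_lt (hθ.trans_lt (hlt h).1) (hx.trans_lt (hlt h).1))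
    simpa [abs_of_pos hε0] using (hlt h).2
  have hεI : ε ∈ Ioo (-ε₀) ε₀ := ⟨by linarith, hεε₀⟩
  obtain ⟨w, hwθ, hw, hcr, his⟩ := exists_isolated_periodicSolution
    (Xp := perturbedField (upperField F) Gp Hp ε) (Xm := perturbedField F Gm Hm ε)
    hD_open hD_symm hZm hZp (hpu.contDiffOn_slice hεI) (hpm.contDiffOn_slice hεI)
    (perturbedField_add_period hεI hGp_per hHp_per) (perturbedField_add_period hεI hGm_per hHm_per)
    (fun _ _ _ => rfl) (fun t z _ => perturbedField_upperField ε t z) (hball hεm) (hball hεp)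
    (sub_eq_zero.1 hS) (sub_eq_zero.1 hP) (by
      have h3 : Metric.ball θstar ρ ×ˢ Metric.ball xσ ρ ∈ nhds (θ, x) :=
        (Metric.isOpen_ball.prod Metric.isOpen_ball).mem_nhds
          ⟨hθ.trans_lt (hlt hερ).1, hx.trans_lt (hlt hερ).1⟩
      filter_upwards [h3] with p hp hSp hPp
      obtain ⟨h4, h5⟩ := huniq p.1 p.2 hp.1 hp.2 (sub_eq_zero.2 hSp) (sub_eq_zero.2 hPp)
      exact Prod.ext h4 h5)
  exact ⟨θ, x, w, hθ, hx, hwθ, hw, hcr, his⟩
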